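/- Momenta lie in $\mathbb R^4$. For $n,r\ge 1$ a vertex $V^{(r)}_{2n}$ is a real function of $2n$ momenta $p_1,\dots,p_{2n}\in\mathbb R^4$ with $\sum_{i=1}^{2n}p_i=0$, written as a function of the independent momenta: $V^{(r)}_{2n}(p_1,\dots,p_{2n-1})$, $p_{2n}=-\sum_{i=1}^{2n-1}p_i$. Put $C(p)=e^{-p^2}$. Fix a formal power series $\lambda(g)=g+\sum_{r\ge2}\lambda^{(r)}g^r/r!\in g+g^2\mathbb R[[g]]$. Let $\mathbb V$ be the set of all families $(V^{(r)}_{2n})_{n,r\ge1}$ such that, for all $n,r\ge 1$: (I) (Bose symmetry) $V^{(r)}_{2n}(p_{\pi(1)},\dots,p_{\pi(2n)})=V^{(r)}_{2n}(p_1,\dots,p_{2n})$ for every permutation $\pi$ of $\{1,\dots,2n\}$; (II) $V^{(r)}_{2n}(Rp_1,\dots,Rp_{2n-1})=V^{(r)}_{2n}(p_1,\dots,p_{2n-1})$ for every $R\in O(4)$; (III) $V^{(r)}_{2n}$ is $C^\infty$ on $(\mathbb R^4)^{2n-1}$; (IV) $\sup_{p}\,|\partial^\alpha V^{(r)}_{2n}(p_1,\dots,p_{2n-1})|\,e^{-\epsilon\sum_{i=1}^{2n-1}p_i^2}<\infty$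 for every multi-index $\alpha$ and every $0<\epsilon<\tfrac12$; (V) $V^{(r)}_{2n}=0$ if $n>r+1$; (VI) $V^{(r)}_4(0,0,0)=\lambda^{(r)}$ if $r>1$; (VII) $V^{(1)}_2(p)=\mu^{(1)}+\zeta^{(1)}p^2$ for some real numbers $\mu^{(1)},\zeta^{(1)}$, $V^{(1)}_4=1$, and $V^{(1)}_{2n}=0$ for $n>2$. A scaling pair consists of a formal power series $\beta(g)=\sum_{r\ge1}\beta^{(r)}g^r/r!$ with real coefficients and a family $V=(V^{(r)}_{2n})_{n,r\ge1}$ such that, for all $n,r\ge1$ and all momenta, the following integral converges absolutely and $$\Bigl\{\sum_{i=1}^{2n-1}p_i\cdot\frac{\partial}{\partial p_i}-4+2n+r\beta^{(1)}\Bigr\}V^{(r)}_{2n}(p_1,\dots,p_{2n-1})=-\sum_{s=2}^{r}\binom rs\beta^{(s)}V^{(r-s+1)}_{2n}(p_1,\dots,p_{2n-1})$$ $$+\int\frac{d^4q}{(2\pi)^4}\,C(q)\,V^{(r)}_{2(n+1)}(p_1,\dots,p_{2n-1},q,-q)$$ $$-\sum_{s=1}^{r-1}\binom rs\sum_{m=1}^{n}\binom{2n}{2m-1}\Bigl[C(Q_m)\,V^{(s)}_{2m}(p_1,\dots,p_{2m-1})\,V^{(r-s)}_{2(n-m+1)}(p_{2m},\dots,p_{2n-1},Q_m)\Bigr]_{S_{2n}},\qquad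 Q_m=\sum_{i=1}^{2m-1}p_i,$$ where $[\,\cdot\,]_{S_{2n}}$ is the average over all permutations of $p_1,\dots,p_{2n}$, with $p_{2n}=-\sum_{i=1}^{2n-1}p_i$. Theorem. (A) There is exactly one scaling pair $(\beta,V)$ with $V\in\mathbb V$. (B) Its $\beta$-function satisfies $\beta^{(1)}=0$ and $\beta^{(2)}=-\frac{6}{(4\pi)^2}$, that is, $\beta(g)=-\frac{3}{(4\pi)^2}g^2+O(g^3)$ as a formal power series. The running coupling is therefore asymptotically free in the infrared: if $b:\mathbb R\to\mathbb R$ is any continuous function with $b(g)=\beta^{(1)}g+\frac12\beta^{(2)}g^2+O(g^3)$ as $g\downarrow0$, then there is $\delta>0$ such that for every $0<g_1<\delta$ the flow equation $L\frac{d}{dL}g(L)=b(g(L))$ has a solution on $[1,\infty)$ with $g(1)=g_1$, and every such solution is positive for all large $L$ and satisfies $g(L)\to0$ as $L\to\infty$. -/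

import Mathlib

open Filter Topology MeasureTheory
open scoped ContDiff Nat

namespace Phi4

noncomputable section

/-- Four dimensional Euclidean momentum space. -/
abbrev Mom : Type := EuclideanSpace ℝ (Fin 4)

/-- A family of vertices. For `1 ≤ n` and `1 ≤ r` the function `V n r` is the order `r` coefficient
of the vertex with `2 n` legs, as a function of the `2 n - 1` independent momenta
`p_1, ..., p_{2n-1}` (the last momentum being `p_{2n} = -(p_1 + ... + p_{2n-1})`). -/
abbrev VertexFamily : Type := (n : ℕ) → ℕ → (Fin (2 * n - 1) → Mom) → ℝ

/-- The coefficient `f^{(r)}` in `f(g) = ∑ f^{(r)} g^r / r!`. -/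
def ordCoeff (f : PowerSeries ℝ) (r : ℕ) : ℝ := (r ! : ℝ) * PowerSeries.coeff r f

/-- All `2 n` momenta `(p_1, ..., p_{2n})` with `p_{2n} = -(p_1 + ... + p_{2n-1})`. -/
def fullMom {n : ℕ} (p : Fin (2 * n - 1) → Mom) : Fin (2 * n) → Mom :=
  fun i => if h : (i : ℕ) < 2 * n - 1 then p ⟨i, h⟩ else -∑ j, p j

/-- The first `2 n - 1` of `2 n` momenta. -/
def redMom {n : ℕ} (P : Fin (2 * n) → Mom) : Fin (2 * n - 1) → Mom :=
  fun i => P (Fin.castLE (Nat.sub_le _ _) i)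

/-- A finite tuple of momenta as a sequence, continued by zero. -/
def momSeq {N : ℕ} (P : Fin N → Mom) : ℕ → Mom :=
  fun i => if h : i < N then P ⟨i, h⟩ else 0

/-- The cutoff function `C(p) = exp (-p²)`. -/
def cutoff (p : Mom) : ℝ := Real.exp (-‖p‖ ^ 2)

/-- The arguments `(p_1, ..., p_{2n-1}, q, -q)` of the vertex with `2 (n + 1)` legs. -/
def loopMom {n : ℕ} (p : Fin (2 * n - 1) → Mom) (q : Mom) : Fin (2 * (n + 1) - 1) → Mom :=
  fun i =>
    if h : (i : ℕ) < 2 * n - 1 then p ⟨i, h⟩ else if (i : ℕ) = 2 * n - 1 then q else -q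

/-- The integrand `C(q) W(p_1, ..., p_{2n-1}, q, -q)` of the loop integral. -/
def loopIntegrand {n : ℕ} (W : (Fin (2 * (n + 1) - 1) → Mom) → ℝ)
    (p : Fin (2 * n - 1) → Mom) (q : Mom) : ℝ :=
  cutoff q * W (loopMom p q)

/-- The loop integral `∫ d⁴q/(2π)⁴ C(q) W(p_1, ..., p_{2n-1}, q, -q)`. -/
def loopTerm {n : ℕ} (W : (Fin (2 * (n + 1) - 1) → Mom) → ℝ) (p : Fin (2 * n - 1) → Mom) : ℝ :=
  ((2 * Real.pi) ^ 4)⁻¹ * ∫ q : Mom, loopIntegrand W p q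

/-- The tree product, before symmetrization: for `P = (p_1, ..., p_{2n})` and
`Q = p_1 + ... + p_{2m-1}` it is
`C(Q) A(p_1, ..., p_{2m-1}) B(p_{2m}, ..., p_{2n-1}, Q)`. -/
def treeProduct (n m : ℕ) (A : (Fin (2 * m - 1) → Mom) → ℝ)
    (B : (Fin (2 * (n - m + 1) - 1) → Mom) → ℝ) (P : Fin (2 * n) → Mom) : ℝ :=
  let Q : Mom := ∑ i : Fin (2 * m - 1), momSeq P i
  cutoff Q * A (fun i => momSeq P i) *
    B (fun i => if (i : ℕ) < 2 * (n - m) then momSeq P (2 * m - 1 + i) else Q)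

/-- Bose symmetrization of a function of `2 n` momenta of total momentum zero, written as a
function of the `2 n - 1` independent ones. -/
def boseSymm {n : ℕ} (F : (Fin (2 * n) → Mom) → ℝ) (p : Fin (2 * n - 1) → Mom) : ℝ :=
  (((2 * n)! : ℕ) : ℝ)⁻¹ * ∑ π : Equiv.Perm (Fin (2 * n)), F (fun i => fullMom p (π i))

/-- `(β, V)` is a scaling pair: `β(g) = ∑_{r ≥ 1} β^{(r)} g^r / r!`, the loop integrals converge
absolutely, and the renormalization group equation holds at every order `r` and for every number
`2 n` of legs. The Euler operator `∑ p_i ∂/∂p_i` is the derivative at `p` in the direction `p`. -/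
structure IsScalingPair (β : PowerSeries ℝ) (V : VertexFamily) : Prop where
  beta_zero : PowerSeries.constantCoeff β = 0
  loop_integrable : ∀ n r : ℕ, 1 ≤ n → 1 ≤ r → ∀ p : Fin (2 * n - 1) → Mom,
    Integrable (loopIntegrand (V (n + 1) r) p)
  equation : ∀ n r : ℕ, 1 ≤ n → 1 ≤ r → ∀ p : Fin (2 * n - 1) → Mom,
    fderiv ℝ (V n r) p p + (-4 + 2 * (n : ℝ) + (r : ℝ) * ordCoeff β 1) * V n r p =
      -(∑ s ∈ Finset.Icc 2 r, (r.choose s : ℝ) * ordCoeff β s * V n (r - s + 1) p)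
      + loopTerm (V (n + 1) r) p
      - ∑ s ∈ Finset.Icc 1 (r - 1), (r.choose s : ℝ) *
          ∑ m ∈ Finset.Icc 1 n, ((2 * n).choose (2 * m - 1) : ℝ) *
            boseSymm (treeProduct n m (V m s) (V (n - m + 1) (r - s))) p

/-- The space of vertices of the `φ⁴` theory whose coupling is the formal power series `lam`. -/
structure IsPhi4Vertices (lam : PowerSeries ℝ) (V : VertexFamily) : Prop where
  /-- There is no field independent term: the sum over `n` starts at `1`. -/
  no_constant : ∀ r p, V 0 r p = 0
  /-- There is no term of order zero: the sum over `r` starts at `1`. -/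
  no_order_zero : ∀ n p, V n 0 p = 0
  bose : ∀ (n r : ℕ) (π : Equiv.Perm (Fin (2 * n))) (p : Fin (2 * n - 1) → Mom),
    V n r (redMom (fun i => fullMom p (π i))) = V n r p
  orthogonal : ∀ (n r : ℕ) (R : Mom ≃ₗᵢ[ℝ] Mom) (p : Fin (2 * n - 1) → Mom),
    V n r (fun i => R (p i)) = V n r p
  smooth : ∀ n r : ℕ, ContDiff ℝ ∞ (V n r)
  /-- The bound on all partial derivatives of order `k`, for every `k`: they are together
  equivalent to the `k`-th Fréchet derivative. -/
  large_momentum : ∀ (n r k : ℕ) (ε : ℝ), 0 < ε → ε < 1 / 2 →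
    BddAbove (Set.range fun p : Fin (2 * n - 1) → Mom =>
      ‖iteratedFDeriv ℝ k (V n r) p‖ * Real.exp (-ε * ∑ i, ‖p i‖ ^ 2))
  connected : ∀ n r : ℕ, 1 ≤ r → r + 1 < n → ∀ p, V n r p = 0
  coupling : ∀ r : ℕ, 1 < r → V 2 r 0 = ordCoeff lam r
  order_one_quadratic : ∃ μ ζ : ℝ, ∀ p : Fin (2 * 1 - 1) → Mom, V 1 1 p = μ + ζ * ‖p 0‖ ^ 2
  order_one_quartic : ∀ p, V 2 1 p = 1
  order_one_higher : ∀ n : ℕ, 2 < n → ∀ p, V n 1 p = 0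

/-- `g` is a running coupling on `1 ≤ L < ∞` for the flow equation `L dg/dL = b(g)`. -/
def IsRunningCoupling (b g : ℝ → ℝ) : Prop :=
  ∀ L : ℝ, 1 ≤ L → HasDerivWithinAt g (b (g L) / L) (Set.Ici 1) L

/-- Infrared asymptotic freedom of a formal `β`-function at weak positive coupling: for every
continuous function `b` which agrees with `β(g)` up to `O(g³)` as `g ↓ 0`, running couplings
exist for all `L ≥ 1` and all small initial values `g(1) > 0`, and all of them tend to zero
through positive values as `L → ∞`. -/
def IsInfraredFree (β : PowerSeries ℝ) : Prop :=
  ∀ b : ℝ → ℝ, Continuous b →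
    (fun x => b x - (PowerSeries.trunc 3 β).eval x) =O[𝓝[>] 0] (fun x => x ^ 3) →
    ∃ δ : ℝ, 0 < δ ∧ ∀ g₁ : ℝ, 0 < g₁ → g₁ < δ →
      (∃ g : ℝ → ℝ, IsRunningCoupling b g ∧ g 1 = g₁) ∧
      ∀ g : ℝ → ℝ, IsRunningCoupling b g → g 1 = g₁ → Tendsto g atTop (𝓝[>] 0)

end

end Phi4

set_option linter.unusedSectionVars false
set_option maxSynthPendingDepth 3

namespace Phi4

noncomputable section

/-! ### Calculus of smooth functions with sub-Gaussian derivatives -/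

section Tame

variable {E E' F G H : Type} [NormedAddCommGroup E] [NormedSpace ℝ E]
  [NormedAddCommGroup E'] [NormedSpace ℝ E']
  [NormedAddCommGroup F] [NormedSpace ℝ F] [NormedAddCommGroup G] [NormedSpace ℝ G]
  [NormedAddCommGroup H] [NormedSpace ℝ H]

/-! The equations are solved order by order in r and, within one order, downwards in the number of
legs, starting from the connectedness bound n ≤ r + 1. Since β⁽¹⁾ = 0 (four legs, first order), the
left side is D + 2n − 4, with D the Euler operator, and the right side contains only lower orders,
β⁽ʳ⁾ and the vertex with two more legs. Everything takes place among smooth functions whose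
derivatives are sub-Gaussian, a class stable under loop integrals, tree products and averages along
rays.

For n ≥ 3 the operator D + 2n − 4 is bijective, its inverse being a ray average (`euler_rayAverage`,
`euler_unique_pos`). For n = 2 the right side must vanish at zero momentum, which fixes β⁽ʳ⁾; the
constant in the kernel is fixed by the coupling λ⁽ʳ⁾. For n = 1 the operator D − 2 has kernel ζp² on
symmetric vertices, and the obstruction is exactly the p² coefficient of the right side
(`IsVertex.exists_euler_two`, `IsVertex.hasQuadCoeff_euler`).

This last obstruction determines the free wave function term one order below. Adding ζp² at order R
changes the trees of order R + 1, and through them the four point vertex by a multiple of ∑(1 −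
C(p_i)). In the p² coefficient the tree and loop contributions cancel, because V₂⁽¹⁾(0) =
−1/(2(4π)²); only −binom(R + 1, 2) β⁽²⁾ ζ survives (`hasQuadCoeff_shift`). As β⁽²⁾ ≠ 0, ζ is
determined. The inductive statement is therefore that solutions up to order R exist
(`exists_extension`) and are unique up to ζp² at the top order (`isShift_succ`), so all orders
strictly below the top are unique.

The value of β⁽²⁾ comes from the four point equation at zero momentum, where ζ⁽¹⁾ drops out: the
loop over the six point tree gives −14/(4π)², the trees with V₂⁽¹⁾(0) give +8/(4π)² (`beta_two_eq`).
Infrared freedom follows by comparing 1/g with linear functions of log L. -/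

/-- `f` grows more slowly than every Gaussian `exp (ε x²)`. -/
def SubGaussian (f : E → F) : Prop :=
  ∀ ε : ℝ, 0 < ε → ∃ C : ℝ, 0 ≤ C ∧ ∀ x, ‖f x‖ ≤ C * Real.exp (ε * ‖x‖ ^ 2)

/-- `f` is of class `C^n` and its derivatives up to order `n` grow more slowly than every
Gaussian. -/
structure Tame (n : ℕ) (f : E → F) : Prop where
  smooth : ContDiff ℝ n f
  growth : ∀ k ≤ n, SubGaussian (iteratedFDeriv ℝ k f)

theorem SubGaussian.of_le {f : E → F} {g : E → G} (hg : SubGaussian g) (C : ℝ)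
    (h : ∀ x, ‖f x‖ ≤ C * ‖g x‖) : SubGaussian f := by
  intro ε hε
  obtain ⟨D, hD, hg⟩ := hg ε hε
  refine ⟨|C| * D, by positivity, fun x => (h x).trans ?_⟩
  calc C * ‖g x‖ ≤ |C| * (D * Real.exp (ε * ‖x‖ ^ 2)) := by
        gcongr
        · exact le_abs_self C
        · exact hg x
    _ = _ := by ring

theorem SubGaussian.add {f g : E → F} (hf : SubGaussian f) (hg : SubGaussian g) :
    SubGaussian (fun x => f x + g x) := by
  intro ε hε
  obtain ⟨C, hC, hf⟩ := hf ε hε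
  obtain ⟨D, hD, hg⟩ := hg ε hε
  refine ⟨C + D, by positivity, fun x => (norm_add_le _ _).trans ?_⟩
  rw [add_mul]
  exact add_le_add (hf x) (hg x)

theorem SubGaussian.mul {f : E → F} {g : E → G} (hf : SubGaussian f) (hg : SubGaussian g) :
    SubGaussian (fun x => ‖f x‖ * ‖g x‖) := by
  intro ε hε
  obtain ⟨C, hC, hf⟩ := hf (ε / 2) (by positivity)
  obtain ⟨D, hD, hg⟩ := hg (ε / 2) (by positivity)
  refine ⟨C * D, by positivity, fun x => ?_⟩
  rw [Real.norm_of_nonneg (by positivity)]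
  calc ‖f x‖ * ‖g x‖ ≤ (C * Real.exp (ε / 2 * ‖x‖ ^ 2)) * (D * Real.exp (ε / 2 * ‖x‖ ^ 2)) := by
        gcongr
        · exact hf x
        · exact hg x
    _ = C * D * (Real.exp (ε / 2 * ‖x‖ ^ 2) * Real.exp (ε / 2 * ‖x‖ ^ 2)) := by ring
    _ = _ := by rw [← Real.exp_add]; congr 2; ring

theorem SubGaussian.const (c : F) : SubGaussian (fun _ : E => c) := by
  intro ε hε
  refine ⟨‖c‖, norm_nonneg _, fun x => ?_⟩
  exact le_mul_of_one_le_right (norm_nonneg _) (Real.one_le_exp (by positivity))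

theorem SubGaussian.sum {ι : Type*} (s : Finset ι) {f : ι → E → F}
    (h : ∀ i ∈ s, SubGaussian (f i)) : SubGaussian (fun x => ∑ i ∈ s, f i x) := by
  classical
  induction s using Finset.induction_on with
  | empty => simpa using SubGaussian.const (0 : F)
  | insert i s hi ih =>
    simp only [Finset.sum_insert hi]
    exact (h i (by simp)).add (ih fun j hj => h j (by simp [hj]))

theorem subGaussian_id : SubGaussian (fun x : E => x) := by
  intro ε hε
  refine ⟨1 + 1 / ε, by positivity, fun x => ?_⟩
  have h1 : ε * ‖x‖ ^ 2 + 1 ≤ Real.exp (ε * ‖x‖ ^ 2) := Real.add_one_le_exp _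
  have h2 : ‖x‖ ≤ 1 + ‖x‖ ^ 2 := by nlinarith [sq_nonneg (‖x‖ - 1), norm_nonneg x]
  have h3 : 0 ≤ 1 / ε := by positivity
  calc ‖x‖ ≤ 1 + ‖x‖ ^ 2 := h2
    _ ≤ (1 + 1 / ε) * (ε * ‖x‖ ^ 2 + 1) := by
        have : (1 + 1 / ε) * (ε * ‖x‖ ^ 2 + 1)
          = 1 + ‖x‖ ^ 2 + (ε * ‖x‖ ^ 2 + 1 / ε) := by field_simp; ring
        rw [this]; have := sq_nonneg ‖x‖; nlinarith
    _ ≤ _ := by gcongr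

theorem SubGaussian.comp_clm {f : E → F} (hf : SubGaussian f) (L : E' →L[ℝ] E) :
    SubGaussian (fun x => f (L x)) := by
  intro ε hε
  have hL : 0 < ‖L‖ ^ 2 + 1 := by positivity
  obtain ⟨C, hC, hf⟩ := hf (ε / (‖L‖ ^ 2 + 1)) (by positivity)
  refine ⟨C, hC, fun x => (hf _).trans ?_⟩
  refine mul_le_mul_of_nonneg_left (Real.exp_le_exp.2 ?_) hC
  have h : ‖L x‖ ^ 2 ≤ (‖L‖ * ‖x‖) ^ 2 := by gcongr; exact L.le_opNorm x
  rw [div_mul_eq_mul_div, div_le_iff₀ hL]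
  nlinarith [sq_nonneg ‖x‖]

theorem Tame.subGaussian {n : ℕ} {f : E → F} (h : Tame n f) : SubGaussian f :=
  (h.growth 0 n.zero_le).of_le 1 fun x =>
    (by simp : ‖f x‖ ≤ 1 * ‖iteratedFDeriv ℝ 0 f x‖)

theorem Tame.continuous {n : ℕ} {f : E → F} (h : Tame n f) : Continuous f :=
  h.smooth.continuous

theorem tame_zero_iff {f : E → F} : Tame 0 f ↔ Continuous f ∧ SubGaussian f := by
  refine ⟨fun h => ⟨h.continuous, h.subGaussian⟩, fun h => ⟨?_, ?_⟩⟩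
  · exact contDiff_zero.2 h.1
  · intro k hk
    obtain rfl : k = 0 := by omega
    exact h.2.of_le 1 fun x => by simp

/-- This recursion allows tameness to be proved by induction whenever the derivative is again a
function of the same kind. -/
theorem tame_succ_iff {n : ℕ} {f : E → F} :
    Tame (n + 1) f ↔ SubGaussian f ∧ Differentiable ℝ f ∧ Tame n (fderiv ℝ f) := by
  constructor
  · intro h
    have hs := h.smooth
    rw [Nat.cast_add, Nat.cast_one, contDiff_succ_iff_fderiv] at hs
    refine ⟨h.subGaussian, hs.1, hs.2.2, fun k hk => ?_⟩
    exact (h.growth (k + 1) (by omega)).of_le 1 fun x => by rw [norm_iteratedFDeriv_fderiv, one_mul]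
  · rintro ⟨h0, hd, h⟩
    refine ⟨?_, fun k hk => ?_⟩
    · rw [Nat.cast_add, Nat.cast_one, contDiff_succ_iff_fderiv]
      exact ⟨hd, by simp, h.smooth⟩
    · cases k with
      | zero => exact h0.of_le 1 fun x => by simp
      | succ k =>
        exact (h.growth k (by omega)).of_le 1 fun x => by
          rw [norm_iteratedFDeriv_fderiv, one_mul]

theorem Tame.mono {m n : ℕ} {f : E → F} (h : Tame n f) (hmn : m ≤ n) : Tame m f :=
  ⟨h.smooth.of_le (by exact_mod_cast hmn), fun k hk => h.growth k (hk.trans hmn)⟩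

theorem Tame.fderiv {n : ℕ} {f : E → F} (h : Tame (n + 1) f) : Tame n (fderiv ℝ f) :=
  (tame_succ_iff.1 h).2.2

theorem Tame.differentiable {n : ℕ} {f : E → F} (h : Tame (n + 1) f) : Differentiable ℝ f :=
  (tame_succ_iff.1 h).2.1

theorem tame_const (n : ℕ) (c : F) : Tame n (fun _ : E => c) := by
  induction n generalizing F with
  | zero => exact tame_zero_iff.2 ⟨continuous_const, .const c⟩
  | succ n ih =>
    refine tame_succ_iff.2 ⟨.const c, differentiable_const c, ?_⟩
    have : _root_.fderiv ℝ (fun _ : E => c) = fun _ => 0 := by ext; simp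
    rw [this]; exact ih 0

theorem tame_clm (n : ℕ) (L : E →L[ℝ] F) : Tame n (fun x => L x) := by
  have h0 : SubGaussian (fun x => L x) := subGaussian_id.of_le ‖L‖ L.le_opNorm
  cases n with
  | zero => exact tame_zero_iff.2 ⟨L.continuous, h0⟩
  | succ n =>
    refine tame_succ_iff.2 ⟨h0, L.differentiable, ?_⟩
    have : _root_.fderiv ℝ (fun x => L x) = fun _ => L := by ext; simp
    rw [this]; exact tame_const n L

theorem Tame.add {n : ℕ} {f g : E → F} (hf : Tame n f) (hg : Tame n g) :
    Tame n (fun x => f x + g x) := by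
  refine ⟨hf.smooth.add hg.smooth, fun k hk => ?_⟩
  refine ((hf.growth k hk).add (hg.growth k hk)).of_le 1 fun x => ?_
  have hk' : (k : ℕ∞ω) ≤ n := by exact_mod_cast hk
  rw [one_mul, show (fun x => f x + g x) = f + g from rfl,
    iteratedFDeriv_add_apply (hf.smooth.of_le hk').contDiffAt (hg.smooth.of_le hk').contDiffAt]

theorem Tame.clm_comp {n : ℕ} {f : E → F} (hf : Tame n f) (L : F →L[ℝ] G) :
    Tame n (fun x => L (f x)) :=
  ⟨L.contDiff.comp hf.smooth, fun k hk => (hf.growth k hk).of_le ‖L‖ fun x =>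
    L.norm_iteratedFDeriv_comp_left (N := n) hf.smooth.contDiffAt (by exact_mod_cast hk)⟩

theorem Tame.comp_clm {n : ℕ} {f : E → F} (hf : Tame n f) (L : E' →L[ℝ] E) :
    Tame n (fun x => f (L x)) := by
  refine ⟨hf.smooth.comp L.contDiff, fun k hk => ?_⟩
  refine ((hf.growth k hk).comp_clm L).of_le (‖L‖ ^ k) fun x => ?_
  have hk' : (k : ℕ∞ω) ≤ n := by exact_mod_cast hk
  rw [show (fun x => f (L x)) = f ∘ L from rfl, L.iteratedFDeriv_comp_right hf.smooth x hk']
  refine (ContinuousMultilinearMap.norm_compContinuousLinearMap_le _ _).trans ?_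
  simp [mul_comm]

theorem Tame.bilin {n : ℕ} {f : E → F} {g : E → G} (hf : Tame n f) (hg : Tame n g)
    (B : F →L[ℝ] G →L[ℝ] H) : Tame n (fun x => B (f x) (g x)) := by
  refine ⟨B.isBoundedBilinearMap.contDiff.comp₂ hf.smooth hg.smooth, fun k hk => ?_⟩
  have h : SubGaussian (fun x => ∑ i ∈ Finset.range (k + 1),
      ((k.choose i : ℝ) * (‖iteratedFDeriv ℝ i f x‖ * ‖iteratedFDeriv ℝ (k - i) g x‖))) := by
    refine SubGaussian.sum _ fun i hi => ?_
    have hi' := Finset.mem_range.1 hi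
    exact ((hf.growth i (by omega)).mul (hg.growth (k - i) (by omega))).of_le (k.choose i) fun x => by
      rw [norm_mul]; simp
  refine h.of_le ‖B‖ fun x => ?_
  refine (B.norm_iteratedFDeriv_le_of_bilinear hf.smooth hg.smooth x
    (by exact_mod_cast hk)).trans ?_
  gcongr
  simp only [mul_assoc]
  exact le_abs_self _

theorem Tame.mul {n : ℕ} {f g : E → ℝ} (hf : Tame n f) (hg : Tame n g) :
    Tame n (fun x => f x * g x) :=
  hf.bilin hg (ContinuousLinearMap.mul ℝ ℝ)

theorem Tame.const_mul {n : ℕ} {f : E → ℝ} (hf : Tame n f) (c : ℝ) : Tame n (fun x => c * f x) :=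
  (tame_const n c).mul hf

theorem Tame.clm_apply_self {n : ℕ} {f : E → E →L[ℝ] F} (hf : Tame n f) :
    Tame n (fun x => f x x) :=
  hf.bilin (tame_clm n (ContinuousLinearMap.id ℝ E)) (ContinuousLinearMap.id ℝ _)

theorem Tame.sum {n : ℕ} {ι : Type*} (s : Finset ι) {f : ι → E → F}
    (h : ∀ i ∈ s, Tame n (f i)) : Tame n (fun x => ∑ i ∈ s, f i x) := by
  classical
  induction s using Finset.induction_on with
  | empty => simpa using tame_const n (0 : F)
  | insert i s hi ih =>
    simp only [Finset.sum_insert hi]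
    exact (h i (by simp)).add (ih fun j hj => h j (by simp [hj]))

theorem Tame.comp_isLinearMap [FiniteDimensional ℝ E'] {n : ℕ} {f : E → F} (hf : Tame n f)
    {L : E' → E} (hL : IsLinearMap ℝ L) : Tame n (fun x => f (L x)) :=
  hf.comp_clm (LinearMap.toContinuousLinearMap (IsLinearMap.mk' L hL))

theorem hasFDerivAt_cutoff (p : Mom) :
    HasFDerivAt cutoff ((-2 * cutoff p) • innerSL ℝ p) p := by
  have h := ((hasStrictFDerivAt_norm_sq p).hasFDerivAt.neg).exp
  refine h.congr_fderiv ?_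
  ext v
  simp [cutoff]
  ring

/-- The derivative is −2C(p)⟨p, ·⟩, the cutoff times a linear map, so the induction closes on the
cutoff itself. -/
theorem tame_cutoff (n : ℕ) : Tame n cutoff := by
  have h0 : SubGaussian cutoff := (SubGaussian.const (1 : ℝ)).of_le 1 fun x => by
    simp [cutoff]
  have hd : Differentiable ℝ cutoff := fun p => (hasFDerivAt_cutoff p).differentiableAt
  induction n with
  | zero => exact tame_zero_iff.2 ⟨hd.continuous, h0⟩
  | succ n ih =>
    refine tame_succ_iff.2 ⟨h0, hd, ?_⟩
    have : _root_.fderiv ℝ cutoff = fun p => (-2 * cutoff p) • innerSL ℝ p := by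
      ext p; rw [(hasFDerivAt_cutoff p).fderiv]
    rw [this]
    exact (ih.const_mul (-2)).bilin (tame_clm n (innerSL ℝ))
      (ContinuousLinearMap.lsmul ℝ ℝ)

theorem tame_norm_sq (n : ℕ) : Tame n (fun p : Mom => ‖p‖ ^ 2) := by
  have h := (tame_clm n (innerSL ℝ (E := Mom))).clm_apply_self
  convert h using 2 with p
  exact (real_inner_self_eq_norm_sq p).symm

/-! ### Parameter integrals: a common form for loop integrals and ray averages -/

section Integral

variable {T : Type} [TopologicalSpace T] [SecondCountableTopology T] [MeasurableSpace T]
  [OpensMeasurableSpace T] (μ : Measure T)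

/-- The integral of a function along an affine family of arguments. -/
def affineIntegral (w a : T → ℝ) (c : T → E') (A : E →L[ℝ] E') (W : E' → F) (p : E) : F :=
  ∫ t, w t • W (a t • A p + c t) ∂μ

/-- The weight `w` and the shift `c` are continuous, and `w` is integrable against a Gaussian
of `c`, while the dilatations `a` do not exceed one. -/
structure AdmissibleFamily (w a : T → ℝ) (c : T → E') : Prop where
  continuous_weight : Continuous w
  continuous_dilatation : Continuous a
  continuous_shift : Continuous c
  dilatation_le : ∀ᵐ t ∂μ, |a t| ≤ 1
  integrable : ∃ ε : ℝ, 0 < ε ∧ Integrable (fun t => w t * Real.exp (ε * ‖c t‖ ^ 2)) μ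

variable {μ}

theorem AdmissibleFamily.mul_dilatation {w a : T → ℝ} {c : T → E'}
    (h : AdmissibleFamily μ w a c) : AdmissibleFamily μ (fun t => w t * a t) a c := by
  refine ⟨h.continuous_weight.mul h.continuous_dilatation, h.continuous_dilatation,
    h.continuous_shift, h.dilatation_le, ?_⟩
  obtain ⟨ε, hε, hi⟩ := h.integrable
  refine ⟨ε, hε, hi.mono ?_ ?_⟩
  · have h1 := h.continuous_weight
    have h2 := h.continuous_dilatation
    have h3 := h.continuous_shift
    exact Continuous.aestronglyMeasurable (by fun_prop)
  · filter_upwards [h.dilatation_le] with t ht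
    rw [norm_mul, norm_mul, norm_mul, Real.norm_eq_abs (a t)]
    gcongr
    exact mul_le_of_le_one_right (norm_nonneg _) ht

/-- Uniform domination of the integrand on balls. -/
theorem AdmissibleFamily.dominated {w a : T → ℝ} {c : T → E'} (h : AdmissibleFamily μ w a c)
    (A : E →L[ℝ] E') {W : E' → F} (hW : SubGaussian W) {ε : ℝ} (hε : 0 < ε) :
    ∃ g : T → ℝ, Integrable g μ ∧ ∀ᵐ t ∂μ, 0 ≤ g t ∧ ∀ p : E,
      ‖w t • W (a t • A p + c t)‖ ≤ g t * Real.exp (ε * ‖p‖ ^ 2) := by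
  obtain ⟨ε₀, hε₀, hi⟩ := h.integrable
  have hA : 0 < ‖A‖ ^ 2 + 1 := by positivity
  -- The square of a sum is at most twice the sum of the squares. The first entry of the minimum
  -- lets the given Gaussian weight absorb the shift `c`, the second keeps the growth in `p` below
  -- ε.
  set δ : ℝ := min (ε₀ / 2) (ε / (2 * (‖A‖ ^ 2 + 1))) with hδ
  have hδ0 : 0 < δ := lt_min (by positivity) (by positivity)
  obtain ⟨C, hC, hW⟩ := hW δ hδ0
  refine ⟨fun t => C * ‖w t * Real.exp (ε₀ * ‖c t‖ ^ 2)‖, hi.norm.const_mul C, ?_⟩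
  filter_upwards [h.dilatation_le] with t ht
  refine ⟨by positivity, fun p => ?_⟩
  have h1 : ‖a t • A p + c t‖ ≤ ‖A‖ * ‖p‖ + ‖c t‖ := by
    refine (norm_add_le _ _).trans ?_
    gcongr
    rw [norm_smul, Real.norm_eq_abs]
    exact (mul_le_of_le_one_left (norm_nonneg _) ht).trans (A.le_opNorm p)
  have h2 : ‖a t • A p + c t‖ ^ 2 ≤ 2 * ((‖A‖ ^ 2 + 1) * ‖p‖ ^ 2) + 2 * ‖c t‖ ^ 2 := by
    have : ‖a t • A p + c t‖ ^ 2 ≤ (‖A‖ * ‖p‖ + ‖c t‖) ^ 2 := by gcongr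
    nlinarith [sq_nonneg (‖A‖ * ‖p‖ - ‖c t‖), sq_nonneg ‖p‖]
  have h3 : δ * ‖a t • A p + c t‖ ^ 2 ≤ ε₀ * ‖c t‖ ^ 2 + ε * ‖p‖ ^ 2 := by
    have e1 : δ ≤ ε₀ / 2 := min_le_left _ _
    have e2 : δ * (2 * (‖A‖ ^ 2 + 1)) ≤ ε := by
      rw [← le_div_iff₀ (by positivity)]; exact min_le_right _ _
    have e3 := mul_le_mul_of_nonneg_left h2 hδ0.le
    have e4 := mul_le_mul_of_nonneg_right e2 (sq_nonneg ‖p‖)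
    have e5 := mul_le_mul_of_nonneg_right e1 (sq_nonneg ‖c t‖)
    nlinarith
  rw [norm_smul, norm_mul, Real.norm_of_nonneg (Real.exp_pos _).le]
  calc ‖w t‖ * ‖W (a t • A p + c t)‖
      ≤ ‖w t‖ * (C * Real.exp (ε₀ * ‖c t‖ ^ 2 + ε * ‖p‖ ^ 2)) := by
        gcongr
        exact (hW _).trans (by gcongr)
    _ = _ := by rw [Real.exp_add]; ring

theorem AdmissibleFamily.aestronglyMeasurable {w a : T → ℝ} {c : T → E'}
    (h : AdmissibleFamily μ w a c) (A : E →L[ℝ] E') {W : E' → F} (hW : Continuous W) (p : E) :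
    AEStronglyMeasurable (fun t => w t • W (a t • A p + c t)) μ := by
  have h1 := h.continuous_weight
  have h2 := h.continuous_dilatation
  have h3 := h.continuous_shift
  exact Continuous.aestronglyMeasurable (by fun_prop)

theorem AdmissibleFamily.integrable_comp {w a : T → ℝ} {c : T → E'}
    (h : AdmissibleFamily μ w a c) (A : E →L[ℝ] E') {W : E' → F} (hc : Continuous W)
    (hW : SubGaussian W) (p : E) : Integrable (fun t => w t • W (a t • A p + c t)) μ := by
  obtain ⟨g, hg, hd⟩ := h.dominated A hW one_pos
  refine (hg.mul_const (Real.exp (1 * ‖p‖ ^ 2))).mono' (h.aestronglyMeasurable A hc p) ?_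
  filter_upwards [hd] with t ht using ht.2 p

theorem AdmissibleFamily.subGaussian_affineIntegral {w a : T → ℝ} {c : T → E'}
    (h : AdmissibleFamily μ w a c) (A : E →L[ℝ] E') {W : E' → F} (hW : SubGaussian W) :
    SubGaussian (affineIntegral μ w a c A W) := by
  intro ε hε
  obtain ⟨g, hg, hd⟩ := h.dominated A hW hε
  refine ⟨∫ t, g t ∂μ, integral_nonneg_of_ae (hd.mono fun t ht => ht.1), fun p => ?_⟩
  rw [← integral_mul_const]
  exact norm_integral_le_of_norm_le (hg.mul_const _) (hd.mono fun t ht => ht.2 p)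

/-- Differentiation stays within the class of affine integrals: the chain rule puts a factor `a`
into the weight and composes DW with A. As |a| ≤ 1, the new weight is still admissible, which closes
the induction for higher derivatives. -/
theorem AdmissibleFamily.hasFDerivAt_affineIntegral {w a : T → ℝ} {c : T → E'}
    (h : AdmissibleFamily μ w a c) (A : E →L[ℝ] E') {W : E' → F} (hW : Tame 1 W) (p : E) :
    HasFDerivAt (affineIntegral μ w a c A W)
      (affineIntegral μ (fun t => w t * a t) a c A (fun x => (fderiv ℝ W x).comp A) p) p := by
  have hT : Tame 0 (fun x => (fderiv ℝ W x).comp A) :=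
    hW.fderiv.clm_comp ((ContinuousLinearMap.compL ℝ E E' F).flip A)
  obtain ⟨g, hg, hd⟩ := h.mul_dilatation.dominated A hT.subGaussian one_pos
  refine hasFDerivAt_integral_of_dominated_of_fderiv_le
    (F' := fun p t => (w t * a t) • (fderiv ℝ W (a t • A p + c t)).comp A)
    (bound := fun t => g t * Real.exp (1 * (‖p‖ + 1) ^ 2)) (Metric.ball_mem_nhds p one_pos)
    (.of_forall fun x => h.aestronglyMeasurable A hW.continuous x)
    (h.integrable_comp A hW.continuous hW.subGaussian p)
    (h.mul_dilatation.aestronglyMeasurable A hT.continuous p) ?_ (hg.mul_const _) ?_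
  · filter_upwards [hd] with t ht x hx
    refine (ht.2 x).trans ?_
    have hx' : ‖x‖ ≤ ‖p‖ + 1 := by
      have := norm_add_le p (x - p)
      rw [mem_ball_iff_norm] at hx
      rw [add_sub_cancel] at this
      linarith
    have := ht.1
    gcongr
  · refine .of_forall fun t x _ => ?_
    have h1 : HasFDerivAt (fun x : E => a t • A x + c t) (a t • A) x :=
      (A.hasFDerivAt.const_smul (a t)).add_const (c t)
    have h2 := ((hW.differentiable _).hasFDerivAt.comp x h1).const_smul (w t)
    refine h2.congr_fderiv ?_
    ext v
    simp [mul_smul]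

theorem AdmissibleFamily.tame_affineIntegral {n : ℕ} {w a : T → ℝ} {c : T → E'}
    (h : AdmissibleFamily μ w a c) (A : E →L[ℝ] E') {W : E' → F} (hW : Tame n W) :
    Tame n (affineIntegral μ w a c A W) := by
  induction n generalizing F w with
  | zero =>
    refine tame_zero_iff.2 ⟨?_, h.subGaussian_affineIntegral A hW.subGaussian⟩
    obtain ⟨g, hg, hd⟩ := h.dominated A hW.subGaussian one_pos
    refine continuous_iff_continuousAt.2 fun p => ?_
    refine continuousAt_of_dominated (bound := fun t => g t * Real.exp (1 * (‖p‖ + 1) ^ 2))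
      (.of_forall fun x => h.aestronglyMeasurable A hW.continuous x) ?_ (hg.mul_const _) ?_
    · filter_upwards [Metric.ball_mem_nhds p one_pos] with x hx
      filter_upwards [hd] with t ht
      refine (ht.2 x).trans ?_
      have hx' : ‖x‖ ≤ ‖p‖ + 1 := by
        have := norm_add_le p (x - p)
        rw [mem_ball_iff_norm] at hx
        rw [add_sub_cancel] at this
        linarith
      have := ht.1
      gcongr
    · refine .of_forall fun t => ?_
      have := hW.continuous
      fun_prop
  | succ n ih =>
    have hd := h.hasFDerivAt_affineIntegral A (hW.mono (by omega : 1 ≤ n + 1))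
    refine tame_succ_iff.2 ⟨h.subGaussian_affineIntegral A hW.subGaussian,
      fun p => (hd p).differentiableAt, ?_⟩
    rw [show _root_.fderiv ℝ (affineIntegral μ w a c A W) = _ from funext fun p => (hd p).fderiv]
    exact ih h.mul_dilatation
      (hW.fderiv.clm_comp ((ContinuousLinearMap.compL ℝ E E' F).flip A))

end Integral

end Tame

/-! ### The Euler operator plus a constant: solutions and kernels -/

section Euler

variable {E F G : Type} [NormedAddCommGroup E] [NormedSpace ℝ E]
  [NormedAddCommGroup F] [NormedSpace ℝ F] [CompleteSpace F]
  [NormedAddCommGroup G] [NormedSpace ℝ G]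

theorem admissible_ray (a : ℕ) : AdmissibleFamily (volume.restrict (Set.Ioc (0 : ℝ) 1))
    (fun t => t ^ a) (fun t => t) (fun _ => (0 : E)) := by
  refine ⟨by fun_prop, continuous_id, continuous_const, ?_, 1, one_pos, ?_⟩
  · filter_upwards [ae_restrict_mem measurableSet_Ioc] with t ht
    rw [abs_of_pos ht.1]; exact ht.2
  · exact (Continuous.integrableOn_Icc (by fun_prop)).mono_set Set.Ioc_subset_Icc_self

/-- The weighted average `∫₀¹ t^a f(t p) dt` along a ray. -/
def rayAverage (a : ℕ) (f : E → F) : E → F :=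
  affineIntegral (volume.restrict (Set.Ioc (0 : ℝ) 1)) (fun t => t ^ a) (fun t => t)
    (fun _ => (0 : E)) (ContinuousLinearMap.id ℝ E) f

theorem rayAverage_apply (a : ℕ) (f : E → F) (p : E) :
    rayAverage a f p = ∫ t in Set.Ioc (0 : ℝ) 1, t ^ a • f (t • p) := by
  simp [rayAverage, affineIntegral]

theorem Tame.rayAverage {n : ℕ} {f : E → F} (hf : Tame n f) (a : ℕ) :
    Tame n (rayAverage a f) :=
  (admissible_ray a).tame_affineIntegral _ hf

theorem hasDerivAt_ray {f : E → F} (hf : Differentiable ℝ f) (p : E) (t : ℝ) :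
    HasDerivAt (fun t : ℝ => f (t • p)) (fderiv ℝ f (t • p) p) t := by
  have h1 : HasDerivAt (fun t : ℝ => t • p) p t := by
    simpa using (hasDerivAt_id t).smul_const p
  exact (hf (t • p)).hasFDerivAt.comp_hasDerivAt t h1

theorem continuous_fderiv_ray {f : E → F} (hf : Tame 1 f) (p : E) :
    Continuous fun t : ℝ => fderiv ℝ f (t • p) p := by
  have := hf.fderiv.continuous
  fun_prop

theorem rayAverage_fderiv_apply (a : ℕ) {f : E → F} (hf : Tame 1 f) (p v : E) :
    rayAverage a (fderiv ℝ f) p v = ∫ t in Set.Ioc (0 : ℝ) 1, t ^ a • fderiv ℝ f (t • p) v := by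
  rw [rayAverage_apply, ContinuousLinearMap.integral_apply]
  · simp
  · have := (admissible_ray (E := E) a).integrable_comp (ContinuousLinearMap.id ℝ E)
      hf.fderiv.continuous hf.fderiv.subGaussian p
    simpa using this

theorem integral_fderiv_ray {f : E → F} (hf : Tame 1 f) (p : E) :
    rayAverage 0 (fderiv ℝ f) p p = f p - f 0 := by
  rw [rayAverage_fderiv_apply 0 hf, ← intervalIntegral.integral_of_le zero_le_one]
  simp only [pow_zero, one_smul]
  rw [intervalIntegral.integral_eq_sub_of_hasDerivAt
    (fun t _ => hasDerivAt_ray hf.differentiable p t)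
    ((continuous_fderiv_ray hf p).intervalIntegrable _ _)]
  simp

/-- Integrate the derivative of t^(a+1) f(tp) over [0, 1]; the boundary term at 0 vanishes. Hence
averaging with weight t^a inverts D + a + 1. -/
theorem euler_rayAverage (a : ℕ) {f : E → F} (hf : Tame 1 f) (p : E) :
    fderiv ℝ (rayAverage a f) p p + ((a : ℝ) + 1) • rayAverage a f p = f p := by
  have hd := ((admissible_ray (E := E) a).hasFDerivAt_affineIntegral
    (ContinuousLinearMap.id ℝ E) hf p).fderiv
  have h1 : fderiv ℝ (rayAverage a f) p p = rayAverage (a + 1) (fderiv ℝ f) p p := by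
    change fderiv ℝ (affineIntegral _ _ _ _ _ f) p p = _
    rw [hd, rayAverage_apply, affineIntegral]
    simp [pow_succ]
  have c1 := continuous_fderiv_ray hf p
  have c2 : Continuous fun t : ℝ => f (t • p) := by
    have := hf.continuous
    fun_prop
  rw [h1, rayAverage_fderiv_apply _ hf, rayAverage_apply, ← integral_smul, ← integral_add,
    ← intervalIntegral.integral_of_le zero_le_one,
    intervalIntegral.integral_eq_sub_of_hasDerivAt (f := fun t : ℝ => t ^ (a + 1) • f (t • p))]
  · simp
  · intro t _
    have := (hasDerivAt_pow (a + 1) t).smul (hasDerivAt_ray hf.differentiable p t)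
    refine this.congr_deriv ?_
    simp [mul_smul]
  · exact (((continuous_pow (a + 1)).smul c1).add
      (((continuous_pow a).smul c2).const_smul ((a : ℝ) + 1))).intervalIntegrable _ _
  · exact (((continuous_pow (a + 1)).smul c1).integrableOn_Icc).mono_set Set.Ioc_subset_Icc_self
  · exact ((((continuous_pow a).smul c2).const_smul ((a : ℝ) + 1)).integrableOn_Icc).mono_set
      Set.Ioc_subset_Icc_self

theorem fderiv_clm_apply_self {N : E → E →L[ℝ] G} (hN : Differentiable ℝ N) (p v : E) :
    fderiv ℝ (fun x => N x x) p v = fderiv ℝ N p v p + N p v := by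
  have := (hN p).hasFDerivAt.clm_apply (hasFDerivAt_id p)
  have h2 : HasFDerivAt (fun x => N x x) _ p := this
  rw [h2.fderiv]
  simp [add_comm]

theorem taylor_one {f : E → F} (hf : Tame 1 f) (p : E) :
    f p = f 0 + rayAverage 0 (fderiv ℝ f) p p := by
  rw [integral_fderiv_ray hf]; abel

/-- The third order Taylor formula with a tame remainder. -/
theorem exists_taylor_three {f : E → ℝ} (hf : ∀ k, Tame k f) :
    ∃ (f₁ : E →L[ℝ] ℝ) (f₂ : E →L[ℝ] E →L[ℝ] ℝ) (M : E → E →L[ℝ] E →L[ℝ] E →L[ℝ] ℝ),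
      (∀ k, Tame k M) ∧ ∀ p, f p = f 0 + f₁ p + f₂ p p + M p p p p := by
  have h1 : ∀ k, Tame k (rayAverage 0 (fderiv ℝ f)) := fun k => (hf (k + 1)).fderiv.rayAverage 0
  have h2 : ∀ k, Tame k (rayAverage 0 (fderiv ℝ (rayAverage 0 (fderiv ℝ f)))) :=
    fun k => (h1 (k + 1)).fderiv.rayAverage 0
  refine ⟨rayAverage 0 (fderiv ℝ f) 0, rayAverage 0 (fderiv ℝ (rayAverage 0 (fderiv ℝ f))) 0, _,
    fun k => (h2 (k + 1)).fderiv.rayAverage 0, fun p => ?_⟩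
  conv_lhs => rw [taylor_one (hf 1) p, taylor_one (h1 1) p, taylor_one (h2 1) p]
  simp only [add_apply, add_assoc]

theorem euler_pos_solution (d : ℕ) {f : E → ℝ} (hf : ∀ k, Tame k f) :
    ∃ W : E → ℝ, (∀ k, Tame k W) ∧ ∀ p, fderiv ℝ W p p + ((d : ℝ) + 1) * W p = f p :=
  ⟨rayAverage d f, fun k => (hf k).rayAverage d, fun p => euler_rayAverage d (hf 1) p⟩

/-- If f(0) = 0 then f(p) = L(p)p with L the ray average of the derivative. On functions of the form
N(p)p the operator D acts as D + 1 on N, so one more ray average solves the equation. -/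
theorem euler_zero_solution {f : E → ℝ} (hf : ∀ k, Tame k f) (h0 : f 0 = 0) :
    ∃ W : E → ℝ, (∀ k, Tame k W) ∧ W 0 = 0 ∧ ∀ p, fderiv ℝ W p p = f p := by
  have h1 : ∀ k, Tame k (rayAverage 0 (fderiv ℝ f)) := fun k => (hf (k + 1)).fderiv.rayAverage 0
  have h2 : ∀ k, Tame k (rayAverage 0 (rayAverage 0 (fderiv ℝ f))) :=
    fun k => (h1 k).rayAverage 0
  refine ⟨fun p => rayAverage 0 (rayAverage 0 (fderiv ℝ f)) p p,
    fun k => (h2 k).clm_apply_self, by simp, fun p => ?_⟩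
  rw [fderiv_clm_apply_self (h2 1).differentiable]
  have h := euler_rayAverage 0 (h1 1) p
  have h' := congrArg (fun L : E →L[ℝ] ℝ => L p) h
  simp only [add_apply, Nat.cast_zero, zero_add, one_smul] at h'
  rw [h', integral_fderiv_ray (hf 1), h0, sub_zero]

theorem euler_cubic {M : E → E →L[ℝ] E →L[ℝ] E →L[ℝ] ℝ} (hM : ∀ k, Tame k M) (p : E) :
    fderiv ℝ (fun p => M p p p p) p p = fderiv ℝ M p p p p p + 3 * M p p p p := by
  have h1 : ∀ k, Tame k fun p => M p p := fun k => (hM k).clm_apply_self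
  have h2 : ∀ k, Tame k fun p => M p p p := fun k => (h1 k).clm_apply_self
  rw [fderiv_clm_apply_self (h2 1).differentiable, fderiv_clm_apply_self (h1 1).differentiable,
    fderiv_clm_apply_self (hM 1).differentiable]
  simp only [add_apply]
  ring

/-- On cubic expressions M(p)(p, p, p) the operator D acts as D + 3 on M. So D − 2 becomes D + 1,
which a ray average inverts, and the solution again vanishes to third order. -/
theorem euler_two_solution {M : E → E →L[ℝ] E →L[ℝ] E →L[ℝ] ℝ} (hM : ∀ k, Tame k M) :
    ∃ W : E → ℝ, (∀ k, Tame k W) ∧ (∃ N : E → E →L[ℝ] E →L[ℝ] E →L[ℝ] ℝ,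
      (∀ k, Tame k N) ∧ ∀ p, W p = N p p p p) ∧
      ∀ p, fderiv ℝ W p p - 2 * W p = M p p p p := by
  have h : ∀ k, Tame k (rayAverage 0 M) := fun k => (hM k).rayAverage 0
  refine ⟨fun p => rayAverage 0 M p p p p,
    fun k => (h k).clm_apply_self.clm_apply_self.clm_apply_self, ⟨_, h, fun p => rfl⟩,
    fun p => ?_⟩
  rw [euler_cubic h]
  have h' := congrArg (fun L : E →L[ℝ] E →L[ℝ] E →L[ℝ] ℝ => L p p p) (euler_rayAverage 0 (hM 1) p)
  simp only [add_apply, Nat.cast_zero, zero_add, one_smul] at h'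
  linarith

/-- The equation at tp says that t^d W(tp) has zero derivative in t; the mean value theorem then
equates its values at 1 and 0. The factor 0^d, with 0^0 = 1, treats the constant kernel at d = 0 and
the trivial one at d > 0 together. -/
theorem euler_homogeneous_nonneg (d : ℕ) {W : E → ℝ} (hW : Differentiable ℝ W)
    (h : ∀ p, fderiv ℝ W p p + (d : ℝ) * W p = 0) (p : E) : W p = 0 ^ d * W 0 := by
  have hd : ∀ t : ℝ, HasDerivAt (fun t : ℝ => t ^ d * W (t • p))
      (d * t ^ (d - 1) * W (t • p) + t ^ d * fderiv ℝ W (t • p) p) t := fun t =>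
    (hasDerivAt_pow d t).mul (hasDerivAt_ray hW p t)
  obtain ⟨c, hc, hs⟩ := exists_hasDerivAt_eq_slope (fun t : ℝ => t ^ d * W (t • p)) _ zero_lt_one
    (fun t _ => (hd t).continuousAt.continuousWithinAt) fun t _ => hd t
  have hz : d * c ^ (d - 1) * W (c • p) + c ^ d * fderiv ℝ W (c • p) p = 0 := by
    have h' := h (c • p)
    rw [map_smul, smul_eq_mul] at h'
    have hc0 : c ≠ 0 := hc.1.ne'
    refine mul_left_cancel₀ hc0 ?_
    rcases d with _ | d
    · simp at h' ⊢
      exact Or.inr (by simpa [hc0] using h')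
    · rw [Nat.add_sub_cancel, pow_succ]
      linear_combination c ^ (d + 1) * h'
  rw [hz] at hs
  simp only [one_smul, one_pow, zero_smul, sub_zero, div_one, one_mul] at hs
  linarith

theorem euler_unique_pos (d : ℕ) {W : E → ℝ} (hW : Differentiable ℝ W)
    (h : ∀ p, fderiv ℝ W p p + ((d : ℝ) + 1) * W p = 0) (p : E) : W p = 0 := by
  have := euler_homogeneous_nonneg (d + 1) hW (by exact_mod_cast h) p
  simpa using this

theorem euler_unique_zero {W : E → ℝ} (hW : Differentiable ℝ W)
    (h : ∀ p, fderiv ℝ W p p = 0) (p : E) : W p = W 0 := by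
  have := euler_homogeneous_nonneg 0 hW (by simpa using h) p
  simpa using this

/-- The quotient W(tp)/t² is constant for t > 0. It need not extend to t = 0, so no value at the
origin can be used. -/
theorem euler_homogeneous_two {W : E → ℝ} (hW : Differentiable ℝ W)
    (h : ∀ p, fderiv ℝ W p p - 2 * W p = 0) (p : E) {s : ℝ} (hs : 0 < s) :
    W (s • p) = s ^ 2 * W p := by
  have hd : ∀ t : ℝ, 0 < t → HasDerivAt (fun t : ℝ => W (t • p) / t ^ 2) 0 t := fun t ht => by
    refine ((hasDerivAt_ray hW p t).div (hasDerivAt_pow 2 t) (by positivity)).congr_deriv ?_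
    have h' := h (t • p)
    rw [map_smul, smul_eq_mul] at h'
    rw [div_eq_zero_iff]
    left
    push_cast
    linear_combination t * h'
  have := isOpen_Ioi.is_const_of_deriv_eq_zero (isPreconnected_Ioi (a := (0 : ℝ)))
    (fun t ht => (hd t ht).differentiableAt.differentiableWithinAt)
    (fun t ht => (hd t ht).deriv) (Set.mem_Ioi.2 hs) (Set.mem_Ioi.2 one_pos)
  simp only [one_smul, one_pow, div_one] at this
  rw [← this]
  field_simp

end Euler

/-- The momenta of the first `2 n - 1` legs. -/
abbrev Conf (n : ℕ) : Type := Fin (2 * n - 1) → Mom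

/-! ### Momentum conservation and permutations of the legs -/

section Momenta

variable {n : ℕ}

theorem fullMom_castLE (p : Conf n) (i : Fin (2 * n - 1)) :
    fullMom p (Fin.castLE (Nat.sub_le _ _) i) = p i := by
  simp [fullMom]

theorem fullMom_last (p : Conf n) (i : Fin (2 * n)) (h : (i : ℕ) = 2 * n - 1) :
    fullMom p i = -∑ j, p j := by
  simp [fullMom, h]

theorem sum_split_last {N M : ℕ} (h : N = M + 1) (f : Fin N → Mom) :
    ∑ i, f i = ∑ j : Fin M, f (Fin.castLE (by omega) j) + f ⟨M, by omega⟩ := by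
  subst h
  exact Fin.sum_univ_castSucc f

theorem sum_fullMom (hn : 1 ≤ n) (p : Conf n) : ∑ i, fullMom p i = 0 := by
  rw [sum_split_last (by omega : 2 * n = (2 * n - 1) + 1), fullMom_last p _ rfl]
  simp only [fullMom_castLE]
  abel

theorem fullMom_redMom (hn : 1 ≤ n) (P : Fin (2 * n) → Mom) (h : ∑ i, P i = 0) :
    fullMom (redMom P) = P := by
  funext i
  by_cases hi : (i : ℕ) < 2 * n - 1
  · simp [fullMom, hi, redMom]
  · have hi' : (i : ℕ) = 2 * n - 1 := by omega
    rw [fullMom_last _ _ hi']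
    rw [sum_split_last (by omega : 2 * n = (2 * n - 1) + 1)] at h
    have : P i = P ⟨2 * n - 1, by omega⟩ := congrArg P (Fin.ext hi')
    rw [this, eq_comm, eq_neg_iff_add_eq_zero, add_comm]
    exact h

/-- The action of permutations of all `2 n` momenta on the independent ones. -/
def permMom (π : Equiv.Perm (Fin (2 * n))) (p : Conf n) : Conf n :=
  redMom fun i => fullMom p (π i)

theorem fullMom_permMom (hn : 1 ≤ n) (π : Equiv.Perm (Fin (2 * n))) (p : Conf n) :
    fullMom (permMom π p) = fun i => fullMom p (π i) :=
  fullMom_redMom hn _ ((Equiv.sum_comp π (fullMom p)).trans (sum_fullMom hn p))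

theorem isLinearMap_fullMom : IsLinearMap ℝ (fullMom : Conf n → Fin (2 * n) → Mom) := by
  constructor
  · intro p q; ext1 i
    by_cases h : (i : ℕ) < 2 * n - 1
    · simp [fullMom, h]
    · simp [fullMom, h, Finset.sum_add_distrib, add_comm]
  · intro c p; ext1 i
    by_cases h : (i : ℕ) < 2 * n - 1
    · simp [fullMom, h]
    · simp [fullMom, h, Finset.smul_sum]

theorem isLinearMap_permMom (π : Equiv.Perm (Fin (2 * n))) :
    IsLinearMap ℝ (permMom π : Conf n → Conf n) := by
  constructor
  · intro p q; ext1 i; simp [permMom, redMom, isLinearMap_fullMom.map_add]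
  · intro c p; ext1 i; simp [permMom, redMom, isLinearMap_fullMom.map_smul]

theorem fullMom_map (R : Mom →ₗ[ℝ] Mom) (p : Conf n) (i : Fin (2 * n)) :
    fullMom (fun j => R (p j)) i = R (fullMom p i) := by
  by_cases h : (i : ℕ) < 2 * n - 1
  · simp [fullMom, h]
  · simp [fullMom, h]

theorem loopMom_map (R : Mom →ₗ[ℝ] Mom) (p : Conf n) (q : Mom) (i : Fin (2 * (n + 1) - 1)) :
    loopMom (fun j => R (p j)) (R q) i = R (loopMom p q i) := by
  unfold loopMom
  split_ifs <;> simp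

theorem loopMom_eq_add (p : Conf n) (q : Mom) :
    loopMom p q = loopMom p 0 + loopMom (0 : Conf n) q := by
  ext1 i
  simp only [loopMom, Pi.add_apply]
  split_ifs <;> simp

theorem isLinearMap_loopMom_zero :
    IsLinearMap ℝ (fun p : Conf n => (loopMom p 0 : Conf (n + 1))) := by
  constructor
  · intro p q; ext1 i
    simp only [loopMom, Pi.add_apply]
    split_ifs <;> simp
  · intro c p; ext1 i
    simp only [loopMom, Pi.smul_apply]
    split_ifs <;> simp

theorem isLinearMap_zero_loopMom :
    IsLinearMap ℝ (fun q : Mom => (loopMom (0 : Conf n) q : Conf (n + 1))) := by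
  constructor
  · intro p q; ext1 i
    simp only [loopMom, Pi.add_apply]
    split_ifs <;> simp [add_comm]
  · intro c p; ext1 i
    simp only [loopMom, Pi.smul_apply]
    split_ifs <;> simp

theorem norm_zero_loopMom_le (q : Mom) : ‖(loopMom (0 : Conf n) q : Conf (n + 1))‖ ≤ ‖q‖ := by
  refine (pi_norm_le_iff_of_nonneg (norm_nonneg q)).2 fun i => ?_
  simp only [loopMom]
  split_ifs <;> simp

/-- The legs of a vertex with a loop attached which remain external. -/
def externalLeg (hn : 1 ≤ n) : Fin (2 * n) ↪ Fin (2 * (n + 1)) where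
  -- The dependent momentum is always the last leg; it moves from index 2n − 1 to 2n + 1 because the
  -- loop momenta q, −q are inserted before it.
  toFun i := if (i : ℕ) < 2 * n - 1 then ⟨i, by omega⟩ else ⟨2 * n + 1, by omega⟩
  inj' i j h := by
    simp only at h
    split_ifs at h <;> simp only [Fin.mk.injEq] at h <;> ext <;> omega

theorem externalLeg_val (hn : 1 ≤ n) (i : Fin (2 * n)) :
    (externalLeg hn i : ℕ) = if (i : ℕ) < 2 * n - 1 then (i : ℕ) else 2 * n + 1 := by
  change ((if (i : ℕ) < 2 * n - 1 then _ else _ : Fin (2 * (n + 1))) : ℕ) = _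
  split_ifs <;> rfl

theorem sum_loopMom (hn : 1 ≤ n) (p : Conf n) (q : Mom) :
    ∑ i, (loopMom p q : Conf (n + 1)) i = ∑ i, p i := by
  rw [sum_split_last (by omega : 2 * (n + 1) - 1 = 2 * n + 1 - 1 + 1),
    sum_split_last (by omega : 2 * n + 1 - 1 = 2 * n - 1 + 1)]
  have h1 : (loopMom p q : Conf (n + 1)) ⟨2 * n + 1 - 1, by omega⟩ = -q := by
    simp only [loopMom]
    rw [dif_neg (by omega), if_neg (by omega)]
  have h2 : (loopMom p q : Conf (n + 1)) ⟨2 * n - 1, by omega⟩ = q := by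
    simp [loopMom]
  have h3 : ∀ j : Fin (2 * n - 1), (loopMom p q : Conf (n + 1)) ⟨j, by omega⟩ = p j := by
    intro j
    simp [loopMom]
  rw [h1]
  simp only [Fin.castLE, h2, h3]
  abel

theorem fullMom_loopMom_externalLeg (hn : 1 ≤ n) (p : Conf n) (q : Mom) (i : Fin (2 * n)) :
    fullMom (loopMom p q : Conf (n + 1)) (externalLeg hn i) = fullMom p i := by
  by_cases h : (i : ℕ) < 2 * n - 1
  · have h' : (i : ℕ) < 2 * (n + 1) - 1 := by omega
    simp [externalLeg_val, h, fullMom, loopMom, h']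
  · rw [fullMom_last p i (by omega), fullMom_last, sum_loopMom hn]
    rw [externalLeg_val, if_neg h]
    omega

/-- A permutation of the external legs extends to all legs by fixing q and −q. Bose symmetry of a
loop integral thus reduces to that of its vertex. -/
theorem loopMom_permMom (hn : 1 ≤ n) (π : Equiv.Perm (Fin (2 * n))) (p : Conf n) (q : Mom) :
    (loopMom (permMom π p) q : Conf (n + 1)) =
      permMom (π.viaEmbedding (externalLeg hn)) (loopMom p q) := by
  ext1 i
  by_cases h : (i : ℕ) < 2 * n - 1
  · have hi : (Fin.castLE (Nat.sub_le _ _) i : Fin (2 * (n + 1))) =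
        externalLeg hn ⟨i, by omega⟩ := by
      simp [externalLeg_val, h, Fin.ext_iff]
    have h1 : permMom (π.viaEmbedding (externalLeg hn)) (loopMom p q) i =
        fullMom (loopMom p q : Conf (n + 1))
          (π.viaEmbedding (externalLeg hn) (Fin.castLE (Nat.sub_le _ _) i)) := rfl
    rw [h1, hi, Equiv.Perm.viaEmbedding_apply, fullMom_loopMom_externalLeg]
    simp [loopMom, h, permMom, redMom]
  · have hi : (Fin.castLE (Nat.sub_le _ _) i : Fin (2 * (n + 1))) ∉
        Set.range (externalLeg hn) := by
      rintro ⟨j, hj⟩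
      have hj' := congrArg Fin.val hj
      simp only [externalLeg_val, Fin.val_castLE] at hj'
      split_ifs at hj' <;> omega
    have h1 : permMom (π.viaEmbedding (externalLeg hn)) (loopMom p q) i =
        fullMom (loopMom p q : Conf (n + 1))
          (π.viaEmbedding (externalLeg hn) (Fin.castLE (Nat.sub_le _ _) i)) := rfl
    rw [h1, Equiv.Perm.viaEmbedding_apply_of_notMem _ _ _ hi, fullMom_castLE]
    simp [loopMom, h]

end Momenta

/-! ### Gaussian integrals in four dimensions -/

section Gaussian

theorem integral_exp_neg_mul_norm_sq {b : ℝ} (hb : 0 < b) :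
    ∫ q : Mom, Real.exp (-b * ‖q‖ ^ 2) = (Real.pi / b) ^ 2 := by
  rw [GaussianFourier.integral_rexp_neg_mul_sq_norm hb, ← Real.rpow_natCast]
  norm_num

theorem integrable_exp_neg_mul_norm_sq {b : ℝ} (hb : 0 < b) :
    Integrable fun q : Mom => Real.exp (-b * ‖q‖ ^ 2) := by
  refine .of_integral_ne_zero ?_
  rw [integral_exp_neg_mul_norm_sq hb]
  have := Real.pi_pos
  positivity

theorem integral_cutoff : ∫ q : Mom, cutoff q = Real.pi ^ 2 := by
  simpa [cutoff] using integral_exp_neg_mul_norm_sq one_pos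

theorem integrable_cutoff : Integrable cutoff := by
  have := integrable_exp_neg_mul_norm_sq one_pos
  simp only [neg_one_mul] at this
  exact this

theorem cutoff_isometry (R : Mom ≃ₗᵢ[ℝ] Mom) (q : Mom) : cutoff (R q) = cutoff q := by
  simp [cutoff]

end Gaussian

/-- The symmetry and growth conditions on a single vertex. -/
structure IsVertex (n : ℕ) (f : Conf n → ℝ) : Prop where
  tame : ∀ k, Tame k f
  bose : ∀ (π : Equiv.Perm (Fin (2 * n))) (p : Conf n), f (permMom π p) = f p
  orthogonal : ∀ (R : Mom ≃ₗᵢ[ℝ] Mom) (p : Conf n), f (fun i => R (p i)) = f p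

namespace IsVertex

variable {n : ℕ} {f g : Conf n → ℝ}

theorem const (c : ℝ) : IsVertex n fun _ => c :=
  ⟨fun k => tame_const k c, fun _ _ => rfl, fun _ _ => rfl⟩

theorem add (hf : IsVertex n f) (hg : IsVertex n g) : IsVertex n fun p => f p + g p :=
  ⟨fun k => (hf.tame k).add (hg.tame k), fun π p => by rw [hf.bose, hg.bose],
    fun R p => by rw [hf.orthogonal, hg.orthogonal]⟩

theorem const_mul (hf : IsVertex n f) (c : ℝ) : IsVertex n fun p => c * f p :=
  ⟨fun k => (hf.tame k).const_mul c, fun π p => by rw [hf.bose], fun R p => by rw [hf.orthogonal]⟩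

theorem neg (hf : IsVertex n f) : IsVertex n fun p => -f p := by
  simpa using hf.const_mul (-1)

theorem sub (hf : IsVertex n f) (hg : IsVertex n g) : IsVertex n fun p => f p - g p := by
  simpa [sub_eq_add_neg] using hf.add hg.neg

theorem sum {ι : Type*} (s : Finset ι) {f : ι → Conf n → ℝ} (h : ∀ i ∈ s, IsVertex n (f i)) :
    IsVertex n fun p => ∑ i ∈ s, f i p :=
  ⟨fun k => Tame.sum s fun i hi => (h i hi).tame k,
    fun π p => Finset.sum_congr rfl fun i hi => (h i hi).bose π p,
    fun R p => Finset.sum_congr rfl fun i hi => (h i hi).orthogonal R p⟩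

end IsVertex

/-! ### The loop integral -/

section Loop

variable {n : ℕ} {W : Conf (n + 1) → ℝ}

theorem admissible_loop : AdmissibleFamily (volume : Measure Mom) cutoff (fun _ => 1)
    (fun q => (loopMom (0 : Conf n) q : Conf (n + 1))) := by
  have hc : Continuous fun q => (loopMom (0 : Conf n) q : Conf (n + 1)) :=
    (LinearMap.toContinuousLinearMap (IsLinearMap.mk' _ isLinearMap_zero_loopMom)).continuous
  refine ⟨(tame_cutoff 0).continuous, continuous_const, hc, by simp, 1 / 2, by norm_num, ?_⟩
  refine (integrable_exp_neg_mul_norm_sq (b := 1 / 2) (by norm_num)).mono' ?_ ?_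
  · have := (tame_cutoff 0).continuous
    exact Continuous.aestronglyMeasurable (by fun_prop)
  · refine .of_forall fun q => ?_
    rw [cutoff, ← Real.exp_add, Real.norm_of_nonneg (Real.exp_pos _).le]
    refine Real.exp_le_exp.2 ?_
    have : ‖(loopMom (0 : Conf n) q : Conf (n + 1))‖ ^ 2 ≤ ‖q‖ ^ 2 := by
      gcongr; exact norm_zero_loopMom_le q
    linarith

/-- The linear map `p ↦ (p, 0, 0)`. -/
def loopMomCLM (n : ℕ) : Conf n →L[ℝ] Conf (n + 1) :=
  LinearMap.toContinuousLinearMap (IsLinearMap.mk' _ isLinearMap_loopMom_zero)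

theorem loopIntegrand_eq (W : Conf (n + 1) → ℝ) (p : Conf n) (q : Mom) :
    loopIntegrand W p q = cutoff q • W ((1 : ℝ) • loopMomCLM n p + loopMom (0 : Conf n) q) := by
  rw [loopIntegrand, loopMom_eq_add, one_smul, smul_eq_mul]
  rfl

theorem loopTerm_eq (W : Conf (n + 1) → ℝ) (p : Conf n) :
    loopTerm W p = ((2 * Real.pi) ^ 4)⁻¹ * affineIntegral volume cutoff (fun _ => 1)
      (fun q => (loopMom (0 : Conf n) q : Conf (n + 1))) (loopMomCLM n) W p := by
  simp only [loopTerm, affineIntegral, loopIntegrand_eq]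

theorem integrable_loopIntegrand (hW : Tame 0 W) (p : Conf n) :
    Integrable (loopIntegrand W p) := by
  rw [funext (loopIntegrand_eq W p)]
  exact admissible_loop.integrable_comp _ hW.continuous hW.subGaussian p

/-- For orthogonal invariance the loop variable is rotated together with the external momenta, which
preserves both Lebesgue measure and the cutoff. -/
theorem IsVertex.loopTerm (hn : 1 ≤ n) (hW : IsVertex (n + 1) W) :
    IsVertex n (Phi4.loopTerm W) := by
  refine ⟨fun k => ?_, fun π p => ?_, fun R p => ?_⟩
  · rw [funext (loopTerm_eq W)]
    exact (admissible_loop.tame_affineIntegral _ (hW.tame k)).const_mul _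
  · simp only [Phi4.loopTerm, loopIntegrand, loopMom_permMom hn, hW.bose]
  · simp only [Phi4.loopTerm]
    congr 1
    rw [← MeasurePreserving.integral_comp R.measurePreserving R.toHomeomorph.measurableEmbedding]
    refine integral_congr_ae (.of_forall fun q => ?_)
    simp only [loopIntegrand]
    rw [cutoff_isometry, ← hW.orthogonal R (loopMom p q)]
    congr 2
    exact funext fun i => loopMom_map R.toLinearEquiv.toLinearMap p q i

theorem loopTerm_add {W' : Conf (n + 1) → ℝ} (hW : Tame 0 W) (hW' : Tame 0 W') (p : Conf n) :
    loopTerm (fun x => W x + W' x) p = loopTerm W p + loopTerm W' p := by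
  simp only [loopTerm, ← mul_add]
  rw [← integral_add (integrable_loopIntegrand hW p) (integrable_loopIntegrand hW' p)]
  simp only [loopIntegrand, mul_add]

theorem loopTerm_const_mul (c : ℝ) (p : Conf n) :
    loopTerm (fun x => c * W x) p = c * loopTerm W p := by
  simp only [loopTerm, loopIntegrand]
  rw [mul_left_comm, ← integral_const_mul c]
  congr 2
  funext q
  ring

theorem loopTerm_zero (p : Conf n) : loopTerm (fun _ : Conf (n + 1) => 0) p = 0 := by
  simp [loopTerm, loopIntegrand]

/-- Here π²/(2π)⁴ = 1/(4π)², the origin of this factor in all later constants. -/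
theorem loopTerm_const (c : ℝ) (p : Conf n) :
    loopTerm (fun _ : Conf (n + 1) => c) p = c / (4 * Real.pi) ^ 2 := by
  simp only [loopTerm, loopIntegrand]
  rw [integral_mul_const, integral_cutoff]
  have := Real.pi_pos.ne'
  field_simp
  ring

end Loop

/-! ### Tree products and Bose symmetrization -/

section Tree

variable {n m : ℕ} {A : Conf m → ℝ} {B : Conf (n - m + 1) → ℝ}

theorem isLinearMap_momSeq {N : ℕ} (i : ℕ) :
    IsLinearMap ℝ (fun P : Fin N → Mom => momSeq P i) := by
  constructor
  · intro p q; simp only [momSeq, Pi.add_apply]; split_ifs <;> simp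
  · intro c p; simp only [momSeq, Pi.smul_apply]; split_ifs <;> simp

theorem momSeq_map {N : ℕ} (R : Mom →ₗ[ℝ] Mom) (P : Fin N → Mom) (i : ℕ) :
    momSeq (fun j => R (P j)) i = R (momSeq P i) := by
  simp only [momSeq]; split_ifs <;> simp

theorem tame_treeProduct {k : ℕ} (hA : Tame k A) (hB : Tame k B) :
    Tame k (treeProduct n m A B) := by
  have hQ : IsLinearMap ℝ (fun P : Fin (2 * n) → Mom => ∑ i : Fin (2 * m - 1), momSeq P i) := by
    constructor
    · intro p q; simp [(isLinearMap_momSeq _).map_add, Finset.sum_add_distrib]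
    · intro c p; simp [(isLinearMap_momSeq _).map_smul, Finset.smul_sum]
  refine (((tame_cutoff k).comp_isLinearMap hQ).mul (hA.comp_isLinearMap ?_)).mul
    (hB.comp_isLinearMap ?_)
  · constructor
    · intro p q; ext1 i; simp [(isLinearMap_momSeq _).map_add]
    · intro c p; ext1 i; simp [(isLinearMap_momSeq _).map_smul]
  · constructor
    · intro p q; ext1 i
      simp only [Pi.add_apply]
      split_ifs
      · exact (isLinearMap_momSeq _).map_add p q
      · exact hQ.map_add p q
    · intro c p; ext1 i
      simp only [Pi.smul_apply]
      split_ifs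
      · exact (isLinearMap_momSeq _).map_smul c p
      · exact hQ.map_smul c p

theorem treeProduct_isometry (hA : IsVertex m A) (hB : IsVertex (n - m + 1) B)
    (R : Mom ≃ₗᵢ[ℝ] Mom) (P : Fin (2 * n) → Mom) :
    treeProduct n m A B (fun i => R (P i)) = treeProduct n m A B P := by
  have h : ∀ i, momSeq (fun j => R (P j)) i = R (momSeq P i) :=
    momSeq_map R.toLinearEquiv.toLinearMap P
  simp only [treeProduct, h, ← map_sum, cutoff_isometry, hA.orthogonal]
  congr 1
  refine (congrArg B (funext fun i => ?_)).trans (hB.orthogonal R _)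
  split_ifs <;> rfl

theorem boseSymm_permMom (hn : 1 ≤ n) (F : (Fin (2 * n) → Mom) → ℝ)
    (π : Equiv.Perm (Fin (2 * n))) (p : Conf n) : boseSymm F (permMom π p) = boseSymm F p := by
  simp only [boseSymm, fullMom_permMom hn]
  congr 1
  exact Equiv.sum_comp (Equiv.mulLeft π) fun σ => F fun i => fullMom p (σ i)

theorem IsVertex.tree (hn : 1 ≤ n) (hA : IsVertex m A) (hB : IsVertex (n - m + 1) B) :
    IsVertex n (boseSymm (treeProduct n m A B)) := by
  refine ⟨fun k => ?_, boseSymm_permMom hn _, fun R p => ?_⟩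
  · refine (Tame.sum _ fun π _ => ?_).const_mul _
    refine (tame_treeProduct (hA.tame k) (hB.tame k)).comp_isLinearMap ?_
    constructor
    · intro p q; ext1 i; simp [isLinearMap_fullMom.map_add]
    · intro c p; ext1 i; simp [isLinearMap_fullMom.map_smul]
  · simp only [boseSymm]
    congr 1
    refine Finset.sum_congr rfl fun π _ => ?_
    refine (congrArg _ ?_).trans (treeProduct_isometry hA hB R _)
    exact funext fun i => fullMom_map R.toLinearEquiv.toLinearMap p (π i)

end Tree

theorem isLinearMap_isometry {n : ℕ} (R : Mom ≃ₗᵢ[ℝ] Mom) :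
    IsLinearMap ℝ (fun p : Conf n => (fun i => R (p i) : Conf n)) :=
  ⟨fun p q => by ext1 i; simp, fun c p => by ext1 i; simp⟩

theorem fderiv_comp_clm_self {E : Type} [NormedAddCommGroup E] [NormedSpace ℝ E] {W : E → ℝ}
    (hW : Differentiable ℝ W) (L : E →L[ℝ] E) (p : E) :
    fderiv ℝ (fun x => W (L x)) p p = fderiv ℝ W (L p) (L p) := by
  have h : HasFDerivAt (fun x => W (L x)) _ p := (hW (L p)).hasFDerivAt.comp p L.hasFDerivAt
  rw [h.fderiv]
  simp

theorem fderiv_sub_self {E : Type} [NormedAddCommGroup E] [NormedSpace ℝ E] {V W : E → ℝ}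
    (hV : Differentiable ℝ V) (hW : Differentiable ℝ W) (p : E) :
    fderiv ℝ (fun x => V x - W x) p p = fderiv ℝ V p p - fderiv ℝ W p p := by
  rw [fderiv_fun_sub (hV p) (hW p)]; simp

theorem fderiv_add_self {E : Type} [NormedAddCommGroup E] [NormedSpace ℝ E] {V W : E → ℝ}
    (hV : Differentiable ℝ V) (hW : Differentiable ℝ W) (p : E) :
    fderiv ℝ (fun x => V x + W x) p p = fderiv ℝ V p p + fderiv ℝ W p p := by
  rw [fderiv_fun_add (hV p) (hW p)]; simp

theorem fderiv_const_mul_self {E : Type} [NormedAddCommGroup E] [NormedSpace ℝ E] {V : E → ℝ}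
    (hV : Differentiable ℝ V) (c : ℝ) (p : E) :
    fderiv ℝ (fun x => c * V x) p p = c * fderiv ℝ V p p := by
  rw [fderiv_const_mul (hV p)]; simp

namespace IsVertex

variable {n : ℕ} {f W : Conf n → ℝ}

theorem differentiable (hf : IsVertex n f) : Differentiable ℝ f := (hf.tame 1).differentiable

/-- A tame function which inherits the linear symmetries of a vertex is a vertex. -/
theorem of_invariant (hf : IsVertex n f) (hW : ∀ k, Tame k W)
    (h : ∀ L : Conf n →L[ℝ] Conf n, (∀ p, f (L p) = f p) → ∀ p, W (L p) = W p) :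
    IsVertex n W :=
  ⟨hW, fun π => h (LinearMap.toContinuousLinearMap (IsLinearMap.mk' _ (isLinearMap_permMom π)))
      (hf.bose π),
    fun R => h (LinearMap.toContinuousLinearMap (IsLinearMap.mk' _ (isLinearMap_isometry R)))
      (hf.orthogonal R)⟩

/-- The difference of W ∘ L and W solves the homogeneous equation for each linear symmetry L of f,
hence vanishes: invariance of the solution is a consequence of uniqueness. -/
theorem exists_euler_pos (d : ℕ) (hf : IsVertex n f) :
    ∃ W, IsVertex n W ∧ ∀ p, fderiv ℝ W p p + ((d : ℝ) + 1) * W p = f p := by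
  obtain ⟨W, hW, he⟩ := euler_pos_solution d hf.tame
  have hd := (hW 1).differentiable
  refine ⟨W, hf.of_invariant hW fun L hL p => ?_, he⟩
  have hd' : Differentiable ℝ fun x => W (L x) := hd.comp L.differentiable
  refine sub_eq_zero.1 (euler_unique_pos d (hd'.sub hd) (fun x => ?_) p)
  change fderiv ℝ (fun x => W (L x) - W x) x x + ((d : ℝ) + 1) * (W (L x) - W x) = 0
  rw [fderiv_sub_self hd' hd, fderiv_comp_clm_self hd]
  linear_combination he (L x) - he x + hL x

theorem exists_euler_zero (hf : IsVertex n f) (h0 : f 0 = 0) (c : ℝ) :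
    ∃ W, IsVertex n W ∧ W 0 = c ∧ ∀ p, fderiv ℝ W p p = f p := by
  obtain ⟨W, hW, hW0, he⟩ := euler_zero_solution hf.tame h0
  have hd := (hW 1).differentiable
  have hv : IsVertex n W := hf.of_invariant hW fun L hL p => by
    have hd' : Differentiable ℝ fun x => W (L x) := hd.comp L.differentiable
    have := euler_unique_zero (hd'.sub hd) (fun x => ?_) p
    · simp only [Pi.sub_apply, map_zero, sub_self] at this
      exact sub_eq_zero.1 this
    · change fderiv ℝ (fun x => W (L x) - W x) x x = 0
      rw [fderiv_sub_self hd' hd, fderiv_comp_clm_self hd, he, he, hL, sub_self]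
  refine ⟨fun p => W p + c, hv.add (.const c), by simp [hW0], fun p => ?_⟩
  rw [fderiv_add_const, he]

end IsVertex

/-! ### Two point vertices and the p² obstruction -/

section TwoLegs

/-- A unit vector of momentum space. -/
def unitMom : Mom := EuclideanSpace.single 0 1

theorem norm_unitMom : ‖unitMom‖ = 1 := by simp [unitMom]

/-- The configuration `t e` of a vertex with two legs. -/
def axisConf (t : ℝ) : Conf 1 := fun _ => t • unitMom

theorem exists_isometry_apply_unitMom (x : Mom) :
    ∃ R : Mom ≃ₗᵢ[ℝ] Mom, R (‖x‖ • unitMom) = x := by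
  refine ⟨(ℝ ∙ (‖x‖ • unitMom - x))ᗮ.reflection, Submodule.reflection_sub ?_⟩
  simp [norm_smul, norm_unitMom]

theorem eq_zero_conf_one (p : Conf 1) : p = fun _ => p 0 := by
  funext i
  exact congrArg p (Subsingleton.elim (α := Fin 1) i 0)

/-- The orthogonal group is transitive on spheres, so a two point vertex is radial and can be
evaluated on a fixed axis. -/
theorem IsVertex.apply_axisConf {f : Conf 1 → ℝ} (hf : IsVertex 1 f) (p : Conf 1) (t : ℝ) :
    f (axisConf (t * ‖p 0‖)) = f (t • p) := by
  obtain ⟨R, hR⟩ := exists_isometry_apply_unitMom (p 0)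
  rw [← hf.orthogonal R]
  congr 1
  funext i
  rw [eq_zero_conf_one p]
  simp only [axisConf, mul_smul, map_smul, hR, Pi.smul_apply]

theorem norm_axisConf_zero (t : ℝ) : ‖axisConf t 0‖ ^ 2 = t ^ 2 := by
  simp [axisConf, norm_smul, norm_unitMom]

/-- `ρ` is the coefficient of `p²` in the expansion of `f` at zero momentum. -/
def HasQuadCoeff (f : Conf 1 → ℝ) (ρ : ℝ) : Prop :=
  Tendsto (fun t : ℝ => (f (axisConf t) - f 0) / t ^ 2) (𝓝[>] 0) (𝓝 ρ)

theorem HasQuadCoeff.unique {f : Conf 1 → ℝ} {ρ σ : ℝ} (h : HasQuadCoeff f ρ)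
    (h' : HasQuadCoeff f σ) : ρ = σ := tendsto_nhds_unique h h'

theorem HasQuadCoeff.add {f g : Conf 1 → ℝ} {ρ σ : ℝ} (hf : HasQuadCoeff f ρ)
    (hg : HasQuadCoeff g σ) : HasQuadCoeff (fun p => f p + g p) (ρ + σ) := by
  refine (Tendsto.add hf hg).congr fun t => ?_
  ring

theorem HasQuadCoeff.const_mul {f : Conf 1 → ℝ} {ρ : ℝ} (hf : HasQuadCoeff f ρ) (c : ℝ) :
    HasQuadCoeff (fun p => c * f p) (c * ρ) := by
  refine (Tendsto.const_mul c hf).congr fun t => ?_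
  ring

theorem hasQuadCoeff_const (c : ℝ) : HasQuadCoeff (fun _ => c) 0 := by
  simp [HasQuadCoeff]

theorem hasQuadCoeff_of_mul {f : Conf 1 → ℝ} {u : ℝ → ℝ} {ρ : ℝ}
    (h : ∀ t : ℝ, 0 < t → f (axisConf t) - f 0 = t ^ 2 * u t)
    (hu : Tendsto u (𝓝[>] 0) (𝓝 ρ)) : HasQuadCoeff f ρ := by
  refine hu.congr' ?_
  filter_upwards [self_mem_nhdsWithin] with t ht
  have : t ≠ 0 := ne_of_gt ht
  rw [h t ht]
  field_simp

theorem axisConf_eq_smul (t : ℝ) : axisConf t = t • axisConf 1 := by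
  funext i; simp [axisConf]

theorem hasQuadCoeff_cubic {M : Conf 1 → Conf 1 →L[ℝ] Conf 1 →L[ℝ] Conf 1 →L[ℝ] ℝ}
    (hM : Continuous M) : HasQuadCoeff (fun p => M p p p p) 0 := by
  set e := axisConf 1 with he
  refine hasQuadCoeff_of_mul (u := fun t => t * M (t • e) e e e) (fun t _ => ?_) ?_
  · rw [axisConf_eq_smul, ← he]
    simp only [map_smul, smul_apply, map_zero, smul_eq_mul]
    ring
  · have hc : Continuous fun t : ℝ => t * M (t • e) e e e := by fun_prop
    have := hc.tendsto 0
    simp only [zero_mul] at this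
    exact this.mono_left nhdsWithin_le_nhds

theorem hasQuadCoeff_norm_sq : HasQuadCoeff (fun p => ‖p 0‖ ^ 2) 1 :=
  hasQuadCoeff_of_mul (u := fun _ => 1) (fun t _ => by rw [norm_axisConf_zero]; simp)
    tendsto_const_nhds

/-- Taylor's formula for a vertex with two legs. -/
theorem IsVertex.exists_taylor {f : Conf 1 → ℝ} (hf : IsVertex 1 f) :
    ∃ (ρ : ℝ) (M : Conf 1 → Conf 1 →L[ℝ] Conf 1 →L[ℝ] Conf 1 →L[ℝ] ℝ),
      (∀ k, Tame k M) ∧ ∀ p, f p = f 0 + ρ * ‖p 0‖ ^ 2 + M p p p p := by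
  obtain ⟨f₁, f₂, M₀, hM₀, ht⟩ := exists_taylor_three hf.tame
  -- Since −1 is orthogonal, f is even; averaging the Taylor formulas at p and −p removes the linear
  -- term and antisymmetrizes the coefficient of the remainder.
  set M : Conf 1 → Conf 1 →L[ℝ] Conf 1 →L[ℝ] Conf 1 →L[ℝ] ℝ :=
    fun p => (1 / 2 : ℝ) • (M₀ p + (-1 : ℝ) • M₀ (-p)) with hMdef
  have hM : ∀ k, Tame k M := fun k =>
    ((hM₀ k).add (((hM₀ k).comp_clm (-ContinuousLinearMap.id ℝ _)).clm_comp
      ((-1 : ℝ) • ContinuousLinearMap.id ℝ _))).clm_comp ((1 / 2 : ℝ) • ContinuousLinearMap.id ℝ _)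
  have hneg : ∀ p, f (-p) = f p := fun p => hf.orthogonal (LinearIsometryEquiv.neg ℝ) p
  have hf2 : ∀ p, f p = f 0 + f₂ p p + M p p p p := fun p => by
    have h1 := ht p
    have h2 := ht (-p)
    rw [hneg] at h2
    simp only [map_neg, neg_apply] at h2
    simp only [hMdef, smul_apply, add_apply, smul_eq_mul]
    linarith
  have hlim : ∀ p, Tendsto (fun t : ℝ => (f (t • p) - f 0) / t ^ 2) (𝓝[>] 0) (𝓝 (f₂ p p)) := by
    intro p
    have hc : Continuous fun t : ℝ => f₂ p p + t * M (t • p) p p p := by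
      have := (hM 0).continuous
      fun_prop
    have := (hc.tendsto 0).mono_left (nhdsWithin_le_nhds (s := Set.Ioi 0))
    simp only [zero_mul, add_zero] at this
    refine this.congr' ?_
    filter_upwards [self_mem_nhdsWithin] with t ht
    have ht' : t ≠ 0 := ne_of_gt ht
    rw [hf2 (t • p)]
    simp only [map_smul, smul_apply, smul_eq_mul]
    field_simp
    ring
  refine ⟨f₂ (axisConf 1) (axisConf 1), M, hM, fun p => ?_⟩
  rw [hf2 p]
  -- The quadratic form is a limit of difference quotients of f, so it inherits radial symmetry from
  -- f and is a multiple of p².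
  have hE : f₂ p p = f₂ (‖p 0‖ • axisConf 1) (‖p 0‖ • axisConf 1) := by
    refine tendsto_nhds_unique (hlim p) ((hlim _).congr fun t => ?_)
    rw [smul_smul, ← axisConf_eq_smul, hf.apply_axisConf]
  rw [hE]
  simp only [map_smul, smul_apply, smul_eq_mul]
  ring

theorem hasQuadCoeff_of_taylor {f : Conf 1 → ℝ} {ρ : ℝ}
    {M : Conf 1 → Conf 1 →L[ℝ] Conf 1 →L[ℝ] Conf 1 →L[ℝ] ℝ} (hM : ∀ k, Tame k M)
    (h : ∀ p, f p = f 0 + ρ * ‖p 0‖ ^ 2 + M p p p p) : HasQuadCoeff f ρ := by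
  rw [funext h]
  simpa using ((hasQuadCoeff_const (f 0)).add (hasQuadCoeff_norm_sq.const_mul ρ)).add
    (hasQuadCoeff_cubic (hM 0).continuous)

theorem isVertex_norm_sq : IsVertex 1 fun p => ‖p 0‖ ^ 2 := by
  refine ⟨fun k => ?_, fun π p => ?_, fun R p => by simp⟩
  · exact (tame_norm_sq k).comp_isLinearMap (L := fun p : Conf 1 => p 0)
      ⟨fun p q => rfl, fun c p => rfl⟩
  · have h : ∀ i : Fin (2 * 1), ‖fullMom p i‖ = ‖p 0‖ := by
      intro i
      change Fin 2 at i
      fin_cases i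
      · simp [fullMom]
      · rw [fullMom_last p _ rfl, norm_neg]
        congr 1
        exact Fin.sum_univ_one _
    have h' : permMom π p 0 = fullMom p (π (Fin.castLE (Nat.sub_le _ _) 0)) := rfl
    rw [h', h]

theorem euler_norm_sq (p : Conf 1) :
    fderiv ℝ (fun p : Conf 1 => ‖p 0‖ ^ 2) p p = 2 * ‖p 0‖ ^ 2 := by
  have h1 : HasFDerivAt (fun p : Conf 1 => p 0)
      (ContinuousLinearMap.proj 0 : Conf 1 →L[ℝ] Mom) p :=
    (ContinuousLinearMap.proj 0 : Conf 1 →L[ℝ] Mom).hasFDerivAt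
  have h2 := (hasStrictFDerivAt_norm_sq (p 0)).hasFDerivAt.comp p h1
  have h3 : HasFDerivAt (fun p : Conf 1 => ‖p 0‖ ^ 2) _ p := h2
  rw [h3.fderiv]
  simp

/-- The only obstruction to integrating the flow of a two point vertex is its `p²` term. -/
theorem IsVertex.exists_euler_two {f : Conf 1 → ℝ} (hf : IsVertex 1 f) :
    ∃ ρ, HasQuadCoeff f ρ ∧ ∃ W, IsVertex 1 W ∧
      ∀ p, fderiv ℝ W p p - 2 * W p = f p - ρ * ‖p 0‖ ^ 2 := by
  obtain ⟨ρ, M, hM, ht⟩ := hf.exists_taylor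
  refine ⟨ρ, hasQuadCoeff_of_taylor hM ht, ?_⟩
  obtain ⟨W, hW, ⟨N, hN, hWN⟩, he⟩ := euler_two_solution hM
  have hd := (hW 1).differentiable
  have hg : IsVertex 1 fun p => M p p p p := by
    have := (hf.sub (.const (f 0))).sub (isVertex_norm_sq.const_mul ρ)
    refine (funext fun p => ?_ : _ = fun p => M p p p p) ▸ this
    rw [ht p]; ring
  have hv : IsVertex 1 W := hg.of_invariant hW fun L hL p => by
    have hd' : Differentiable ℝ fun x => W (L x) := hd.comp L.differentiable
    -- Uniqueness fails for D − 2, but the difference of W ∘ L and W is homogeneous of degree two,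
    -- while W vanishes to third order at 0. Letting s tend to 0 forces the difference to be zero.
    have hom : ∀ s : ℝ, 0 < s → W (L (s • p)) - W (s • p) = s ^ 2 * (W (L p) - W p) :=
      fun s hs => euler_homogeneous_two (W := fun x => W (L x) - W x) (hd'.sub hd) (fun x => by
        rw [fderiv_sub_self hd' hd, fderiv_comp_clm_self hd]
        linear_combination he (L x) - he x + hL x) p hs
    have hc : Continuous fun s : ℝ => s * (N (s • L p) (L p) (L p) (L p) - N (s • p) p p p) := by
      have := (hN 0).continuous
      fun_prop
    have hl := (hc.tendsto 0).mono_left (nhdsWithin_le_nhds (s := Set.Ioi 0))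
    simp only [zero_mul] at hl
    refine sub_eq_zero.1 (tendsto_nhds_unique (tendsto_const_nhds.congr' ?_) hl)
    filter_upwards [self_mem_nhdsWithin] with s hs
    have hs' : s ≠ 0 := ne_of_gt hs
    have := hom s hs
    rw [hWN, hWN (s • p)] at this
    simp only [map_smul, smul_apply, smul_eq_mul] at this
    refine mul_left_cancel₀ (pow_ne_zero 2 hs') ?_
    rw [← this]
    ring
  -- The added constant accounts for f(0), since D − 2 multiplies constants by −2.
  refine ⟨fun p => W p + -(f 0 / 2), hv.add (.const _), fun p => ?_⟩
  rw [fderiv_add_const]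
  linear_combination he p - ht p

/-- In the Taylor expansion D − 2 annihilates p² and maps constants to constants and cubic
remainders to cubic remainders. A p² term is therefore a true obstruction, as the uniqueness proof
needs. -/
theorem IsVertex.hasQuadCoeff_euler {W : Conf 1 → ℝ} (hW : IsVertex 1 W) :
    HasQuadCoeff (fun p => fderiv ℝ W p p - 2 * W p) 0 := by
  obtain ⟨ρ, M, hM, ht⟩ := hW.exists_taylor
  have h : ∀ p, fderiv ℝ W p p - 2 * W p = -2 * W 0 + (fderiv ℝ M p p p p p + M p p p p) := by
    intro p
    have d1 : Differentiable ℝ fun p => M p p p p :=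
      (hM 1).clm_apply_self.clm_apply_self.clm_apply_self.differentiable
    have d2 := isVertex_norm_sq.differentiable
    have : fderiv ℝ W p p = ρ * (2 * ‖p 0‖ ^ 2) + (fderiv ℝ M p p p p p + 3 * M p p p p) := by
      conv_lhs => rw [funext ht]
      rw [fderiv_add_self ((d2.const_mul ρ).const_add _) d1, euler_cubic hM, fderiv_const_add,
        fderiv_const_mul_self d2, euler_norm_sq]
    rw [this, ht p]
    ring
  rw [funext h]
  have h1 := hasQuadCoeff_cubic (hM 0).continuous
  have h2 : HasQuadCoeff (fun p => fderiv ℝ M p p p p p) 0 := by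
    have hc := ((hM 1).fderiv.clm_apply_self (E := Conf 1)).continuous
    exact hasQuadCoeff_cubic (M := fun p => fderiv ℝ M p p) hc
  simpa using (hasQuadCoeff_const (-2 * W 0)).add (h2.add h1)

/-- A solution is homogeneous of degree two and radial, so its value on the unit axis determines it.
-/
theorem IsVertex.eq_norm_sq_of_euler {W : Conf 1 → ℝ} (hW : IsVertex 1 W)
    (h : ∀ p, fderiv ℝ W p p - 2 * W p = 0) : ∃ ζ, ∀ p, W p = ζ * ‖p 0‖ ^ 2 := by
  refine ⟨W (axisConf 1), fun p => ?_⟩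
  have h1 := hW.apply_axisConf p 1
  rw [one_mul, one_smul] at h1
  rw [← h1]
  rcases (norm_nonneg (p 0)).eq_or_lt with h0 | h0
  · rw [← h0]
    have hz : axisConf 0 = 0 := by funext i; simp [axisConf]
    have := h 0
    simp only [map_zero] at this
    rw [hz]; simp; linarith
  · rw [axisConf_eq_smul, euler_homogeneous_two hW.differentiable h _ h0]
    ring

end TwoLegs

/-- The vertices of one given order. -/
abbrev Slice : Type := (n : ℕ) → Conf n → ℝ

/-- The tree graphs built from two slices. -/
def treeForm (A B : Slice) (n : ℕ) (p : Conf n) : ℝ :=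
  ∑ m ∈ Finset.Icc 1 n, ((2 * n).choose (2 * m - 1) : ℝ) *
    boseSymm (treeProduct n m (A m) (B (n - m + 1))) p

/-- The sum of all tree graphs of order `r`. -/
def treeSum (V : VertexFamily) (n r : ℕ) (p : Conf n) : ℝ :=
  ∑ s ∈ Finset.Icc 1 (r - 1), (r.choose s : ℝ) *
    treeForm (fun k => V k s) (fun k => V k (r - s)) n p

/-- The contribution of the `β`-function of order `r`. -/
def betaSum (b : ℕ → ℝ) (V : VertexFamily) (n r : ℕ) (p : Conf n) : ℝ :=
  ∑ s ∈ Finset.Icc 2 r, (r.choose s : ℝ) * b s * V n (r - s + 1) p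

/-! ### Trees containing the quadratic vertex p² -/

section TreeForm

variable {n : ℕ}

theorem boseSymm_of_const {F : (Fin (2 * n) → Mom) → ℝ} {p : Conf n} {c : ℝ}
    (h : ∀ π : Equiv.Perm (Fin (2 * n)), F (fun i => fullMom p (π i)) = c) :
    boseSymm F p = c := by
  have : (((2 * n)! : ℕ) : ℝ) ≠ 0 := by exact_mod_cast Nat.factorial_ne_zero _
  simp only [boseSymm, h, Finset.sum_const, Finset.card_univ, Fintype.card_perm, Fintype.card_fin,
    nsmul_eq_mul]
  field_simp

theorem boseSymm_treeProduct_of_left {m : ℕ} {A : Conf m → ℝ} {B : Conf (n - m + 1) → ℝ}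
    (hA : ∀ x, A x = 0) (p : Conf n) : boseSymm (treeProduct n m A B) p = 0 :=
  boseSymm_of_const fun π => by simp [treeProduct, hA]

theorem boseSymm_treeProduct_of_right {m : ℕ} {A : Conf m → ℝ} {B : Conf (n - m + 1) → ℝ}
    (hB : ∀ x, B x = 0) (p : Conf n) : boseSymm (treeProduct n m A B) p = 0 :=
  boseSymm_of_const fun π => by simp [treeProduct, hB]

theorem treeForm_bilinear (A B D : Slice) (c d : ℝ) (p : Conf n) :
    treeForm (fun k x => A k x + c * D k x) (fun k x => B k x + d * D k x) n p =
      treeForm A B n p + c * treeForm D B n p + d * treeForm A D n p +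
        c * d * treeForm D D n p := by
  simp only [treeForm, Finset.mul_sum, ← Finset.sum_add_distrib]
  refine Finset.sum_congr rfl fun m _ => ?_
  simp only [boseSymm, Finset.mul_sum, ← Finset.sum_add_distrib]
  refine Finset.sum_congr rfl fun π _ => ?_
  simp only [treeProduct]
  ring

/-- The quadratic vertex `p²` with two legs. -/
def quadSlice : Slice := fun n p => if n = 1 then ∑ i, ‖p i‖ ^ 2 else 0

theorem quadSlice_one (p : Conf 1) : quadSlice 1 p = ‖p 0‖ ^ 2 := by
  simp only [quadSlice, if_true]
  exact Fin.sum_univ_one (fun i => ‖p i‖ ^ 2)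

theorem quadSlice_of_ne (hn : n ≠ 1) (p : Conf n) : quadSlice n p = 0 := if_neg hn

theorem isVertex_quadSlice (n : ℕ) : IsVertex n (quadSlice n) := by
  by_cases hn : n = 1
  · subst hn
    rw [funext quadSlice_one]
    exact isVertex_norm_sq
  · rw [funext (quadSlice_of_ne hn)]
    exact .const 0

/-- A slice of first order: the four point vertex is one and there are no higher vertices. -/
structure IsFirstOrder (A : Slice) : Prop where
  four : ∀ p, A 2 p = 1
  higher : ∀ n, 2 < n → ∀ p, A n p = 0

variable {A : Slice}

theorem treeForm_quad_left_high (hA : IsFirstOrder A) (hn : 3 ≤ n) (p : Conf n) :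
    treeForm quadSlice A n p = 0 := by
  refine Finset.sum_eq_zero fun m hm => ?_
  by_cases h : m = 1
  · rw [boseSymm_treeProduct_of_right fun x => hA.higher _ (by omega) x, mul_zero]
  · rw [boseSymm_treeProduct_of_left (quadSlice_of_ne h), mul_zero]

theorem treeForm_quad_right_high (hA : IsFirstOrder A) (hn : 3 ≤ n) (p : Conf n) :
    treeForm A quadSlice n p = 0 := by
  refine Finset.sum_eq_zero fun m hm => ?_
  have := Finset.mem_Icc.1 hm
  by_cases h : n - m + 1 = 1
  · rw [boseSymm_treeProduct_of_left fun x => hA.higher _ (by omega) x, mul_zero]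
  · rw [boseSymm_treeProduct_of_right (quadSlice_of_ne h), mul_zero]

theorem treeForm_quad_quad_high (hn : 2 ≤ n) (p : Conf n) :
    treeForm quadSlice quadSlice n p = 0 := by
  refine Finset.sum_eq_zero fun m hm => ?_
  by_cases h : m = 1
  · rw [boseSymm_treeProduct_of_right (quadSlice_of_ne (by omega)), mul_zero]
  · rw [boseSymm_treeProduct_of_left (quadSlice_of_ne h), mul_zero]

/-- The sum over permutations does not depend on the chosen position, by composition with a
transposition; summing over all positions gives the identity. -/
theorem sum_perm_apply {N : ℕ} (f : Fin N → ℝ) (a : Fin N) :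
    (N : ℝ) * ∑ π : Equiv.Perm (Fin N), f (π a) = (N ! : ℝ) * ∑ i, f i := by
  have h : ∀ c, ∑ π : Equiv.Perm (Fin N), f (π c) = ∑ π : Equiv.Perm (Fin N), f (π a) := by
    intro c
    rw [← Equiv.sum_comp (Equiv.mulRight (Equiv.swap a c)) fun π : Equiv.Perm (Fin N) => f (π c)]
    simp
  have h2 : ∑ c, ∑ π : Equiv.Perm (Fin N), f (π c) = (N ! : ℝ) * ∑ i, f i := by
    rw [Finset.sum_comm]
    simp [Equiv.sum_comp, Fintype.card_perm]
  rw [← h2, Finset.sum_congr rfl fun c _ => h c]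
  simp

theorem boseSymm_apply_two (f : Mom → ℝ) (a : Fin (2 * 2)) (p : Conf 2) :
    boseSymm (fun P => f (P a)) p = (∑ i, f (fullMom p i)) / 4 := by
  have h := sum_perm_apply (fun i => f (fullMom p i)) a
  have h4 : ((2 * 2)! : ℝ) = 24 := by norm_num [Nat.factorial]
  rw [h4] at h
  rw [boseSymm, h4]
  push_cast at h
  linarith

/-- The function `∑ C(p_i) p_i²` of four momenta. -/
def cutoffQuadSum (p : Conf 2) : ℝ :=
  ∑ i : Fin (2 * 2), cutoff (fullMom p i) * ‖fullMom p i‖ ^ 2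

theorem treeForm_quad_left_two (hA : IsFirstOrder A) (p : Conf 2) :
    treeForm quadSlice A 2 p = cutoffQuadSum p := by
  have h : boseSymm (treeProduct 2 1 (quadSlice 1) (A (2 - 1 + 1))) p = cutoffQuadSum p / 4 := by
    rw [cutoffQuadSum, ← boseSymm_apply_two (fun q => cutoff q * ‖q‖ ^ 2) 0]
    congr 1
    funext P
    have h1 : A (2 - 1 + 1) = fun _ => 1 := funext hA.four
    have h2 : momSeq P 0 = P 0 := by simp [momSeq]
    have h3 : ∑ i : Fin (2 * 1 - 1), momSeq P i = momSeq P 0 := Fin.sum_univ_one _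
    simp only [treeProduct, quadSlice_one, h1, mul_one, h3]
    rw [← h2]; rfl
  rw [treeForm, Finset.sum_Icc_succ_top (by norm_num), Finset.Icc_self, Finset.sum_singleton, h,
    boseSymm_treeProduct_of_left (quadSlice_of_ne (by norm_num))]
  norm_num
  ring

/-- The quadratic vertex now carries the momentum Q = p₁ + p₂ + p₃ = −p₄, so cutoff and p² are
evaluated on the last leg. The multiplicity binom(4, 3) = 4 cancels the average over the legs. -/
theorem treeForm_quad_right_two (hA : IsFirstOrder A) (p : Conf 2) :
    treeForm A quadSlice 2 p = cutoffQuadSum p := by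
  have h : boseSymm (treeProduct 2 2 (A 2) (quadSlice (2 - 2 + 1))) p = cutoffQuadSum p / 4 := by
    rw [cutoffQuadSum, ← boseSymm_apply_two (fun q => cutoff q * ‖q‖ ^ 2) 3]
    simp only [boseSymm]
    congr 1
    refine Finset.sum_congr rfl fun π _ => ?_
    set P : Fin (2 * 2) → Mom := fun i => fullMom p (π i) with hP
    have hs : ∑ i, P i = 0 := by
      rw [hP, Equiv.sum_comp π (fullMom p)]; exact sum_fullMom (by norm_num) p
    have h1 : A 2 = fun _ => 1 := funext hA.four
    have h3 : ∑ i : Fin (2 * 2 - 1), momSeq P i = -P 3 := by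
      rw [sum_split_last (by norm_num : 2 * 2 = 3 + 1)] at hs
      rw [eq_neg_iff_add_eq_zero, ← hs]
      congr 1
    have h4 : ∀ x : Conf (2 - 2 + 1), quadSlice (2 - 2 + 1) x = ‖x 0‖ ^ 2 := quadSlice_one
    simp only [treeProduct, h1, mul_one, h3, h4]
    simp [cutoff, hP]
  rw [treeForm, Finset.sum_Icc_succ_top (by norm_num), Finset.Icc_self, Finset.sum_singleton, h,
    boseSymm_treeProduct_of_right (quadSlice_of_ne (by norm_num))]
  norm_num [Nat.choose]
  ring

theorem treeForm_one {A B : Slice} (hA : IsVertex 1 (A 1)) (hB : IsVertex 1 (B 1)) (p : Conf 1) :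
    treeForm A B 1 p = 2 * (cutoff (p 0) * A 1 p * B 1 p) := by
  rw [treeForm, Finset.Icc_self, Finset.sum_singleton,
    boseSymm_of_const (c := cutoff (p 0) * A 1 p * B 1 p)]
  · norm_num
  · intro π
    set P : Fin (2 * 1) → Mom := fun i => fullMom p (π i) with hP
    have h2 : momSeq P 0 = permMom π p 0 := by simp [momSeq, permMom, redMom, hP]
    have h3 : ∑ i : Fin (2 * 1 - 1), permMom π p i = permMom π p 0 := Fin.sum_univ_one _
    have h4 : (fun _ => permMom π p 0 : Conf 1) = permMom π p := (eq_zero_conf_one _).symm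
    have h5 : (fun i : Fin (2 * 1 - 1) => momSeq P i) = permMom π p := by
      rw [eq_zero_conf_one (permMom π p), ← h2]
      funext i
      have : (i : ℕ) = 0 := by omega
      rw [this]
    have h6 : cutoff (permMom π p 0) = cutoff (p 0) := by
      simp only [cutoff]
      have := isVertex_norm_sq.bose π p
      rw [this]
    have h9 : ∀ i : Fin (2 * 1 - 1), momSeq P i = permMom π p i := fun i => congrFun h5 i
    simp only [treeProduct, h9, h3]
    rw [h6, hA.bose]
    congr 1
    have h8 : (fun i : Fin (2 * (1 - 1 + 1) - 1) => if (i : ℕ) < 2 * (1 - 1)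
        then momSeq P (2 * 1 - 1 + i) else permMom π p 0) = permMom π p := by
      rw [← h4]; funext i; simp
    rw [h8]
    exact hB.bose π p

end TreeForm

/-! ### Effect of a wave function shift at order R on order R + 1 -/

section Shift

variable {n R : ℕ} {V V' : VertexFamily} {b b' : ℕ → ℝ} {ζ : ℝ}

/-- Up to order `R` the families `V` and `V'` differ by the two point vertex `ζ p²` of order `R`. -/
def IsShift (R : ℕ) (ζ : ℝ) (V V' : VertexFamily) : Prop :=
  ∀ n s, s ≤ R → ∀ p, V' n s p = V n s p + (if s = R then ζ else 0) * quadSlice n p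

/-- A vertex of order R enters a tree of order R + 1 only with a partner of order 1, through s = R
or s = 1, each with binomial factor R + 1. For R = 1 both cases coincide and a term quadratic in ζ
appears. -/
theorem treeSum_shift (hR : 1 ≤ R) (h : IsShift R ζ V V') (p : Conf n) :
    treeSum V' n (R + 1) p = treeSum V n (R + 1) p +
      ((R + 1 : ℝ) * ζ * (treeForm quadSlice (fun k => V k 1) n p +
          treeForm (fun k => V k 1) quadSlice n p) +
        if R = 1 then 2 * ζ ^ 2 * treeForm quadSlice quadSlice n p else 0) := by
  have e : ∀ s ∈ Finset.Icc 1 (R + 1 - 1), ((R + 1).choose s : ℝ) *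
      treeForm (fun k => V' k s) (fun k => V' k (R + 1 - s)) n p =
      ((R + 1).choose s : ℝ) * treeForm (fun k => V k s) (fun k => V k (R + 1 - s)) n p +
      ((if s = R then (R + 1 : ℝ) * ζ * treeForm quadSlice (fun k => V k 1) n p else 0) +
        ((if s = 1 then (R + 1 : ℝ) * ζ * treeForm (fun k => V k 1) quadSlice n p else 0) +
        if s = 1 then if R = 1 then 2 * ζ ^ 2 * treeForm quadSlice quadSlice n p else 0 else 0)) := by
    intro s hs
    have hs' := Finset.mem_Icc.1 hs
    have e1 : (fun k => V' k s) = fun k x => V k s x + (if s = R then ζ else 0) * quadSlice k x :=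
      funext fun k => funext fun x => h k s (by omega) x
    have e2 : (fun k => V' k (R + 1 - s)) = fun k x => V k (R + 1 - s) x +
        (if R + 1 - s = R then ζ else 0) * quadSlice k x :=
      funext fun k => funext fun x => h k _ (by omega) x
    have e3 : R + 1 - s = R ↔ s = 1 := by omega
    rw [e1, e2, treeForm_bilinear]
    simp only [e3]
    by_cases h1 : s = R <;> by_cases h2 : s = 1
    · subst h2
      subst h1
      norm_num
      ring
    · have h3 : R ≠ 1 := fun h3 => h2 (h1.trans h3)
      subst h1
      simp [h3, Nat.choose_succ_self_right]
      ring
    · have h3 : R ≠ 1 := fun h3 => h1 (h2.trans h3.symm)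
      subst h2
      simp [h1, h3]
      ring
    · simp [h1, h2]
  rw [treeSum, Finset.sum_congr rfl e, Finset.sum_add_distrib, Finset.sum_add_distrib,
    Finset.sum_add_distrib, Finset.sum_ite_eq', Finset.sum_ite_eq', Finset.sum_ite_eq',
    if_pos (by simp; omega), if_pos (by simp; omega), if_pos (by simp; omega), treeSum]
  ring

/-- Only s = R + 1 sees the changed coefficient of β, multiplied by the first order vertex, and only
s = 2 sees the shifted vertex of order R. -/
theorem betaSum_shift (hR : 1 ≤ R) (h : IsShift R ζ V V') (hb : ∀ s ≤ R, b' s = b s)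
    (p : Conf n) :
    betaSum b' V' n (R + 1) p = betaSum b V n (R + 1) p +
      ((b' (R + 1) - b (R + 1)) * V n 1 p +
        ((R + 1).choose 2 : ℝ) * b' 2 * ζ * quadSlice n p) := by
  have e : ∀ s ∈ Finset.Icc 2 (R + 1), ((R + 1).choose s : ℝ) * b' s * V' n (R + 1 - s + 1) p =
      ((R + 1).choose s : ℝ) * b s * V n (R + 1 - s + 1) p +
      ((if s = R + 1 then (b' (R + 1) - b (R + 1)) * V n 1 p else 0) +
        if s = 2 then ((R + 1).choose 2 : ℝ) * b' 2 * ζ * quadSlice n p else 0) := by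
    intro s hs
    have hs' := Finset.mem_Icc.1 hs
    have e3 : R + 1 - s + 1 = R ↔ s = 2 := by omega
    rw [h n _ (by omega)]
    simp only [e3]
    by_cases h1 : s = R + 1
    · subst h1
      simp only [Nat.choose_self, Nat.sub_self, zero_add, if_true]
      by_cases h2 : R + 1 = 2
      · simp only [h2, if_true, Nat.choose_self]
        push_cast
        ring
      · simp only [h2, if_false]
        push_cast
        ring
    · rw [← hb s (by omega)]
      by_cases h2 : s = 2
      · subst h2
        simp only [h1, if_false, if_true]
        ring
      · simp [h1, h2]
  rw [betaSum, Finset.sum_congr rfl e, Finset.sum_add_distrib, Finset.sum_add_distrib,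
    Finset.sum_ite_eq', Finset.sum_ite_eq', if_pos (by simp; omega), if_pos (by simp; omega),
    betaSum]

/-- The contributions to the flow of order `r` of the vertices of lower order. -/
def lowerTerms (b : ℕ → ℝ) (V : VertexFamily) (n r : ℕ) (p : Conf n) : ℝ :=
  -betaSum b V n r p - treeSum V n r p

/-- Joining p² to a first order vertex yields at most four legs, and the new β coefficient
multiplies a first order vertex; neither reaches six legs. -/
theorem lowerTerms_shift_high (hR : 1 ≤ R) (h : IsShift R ζ V V') (hb : ∀ s ≤ R, b' s = b s)
    (hV : IsFirstOrder fun k => V k 1) (hn : 3 ≤ n) (p : Conf n) :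
    lowerTerms b' V' n (R + 1) p = lowerTerms b V n (R + 1) p := by
  rw [lowerTerms, lowerTerms, betaSum_shift hR h hb, treeSum_shift hR h,
    treeForm_quad_left_high hV hn, treeForm_quad_right_high hV hn,
    treeForm_quad_quad_high (by omega), quadSlice_of_ne (by omega)]
  have := hV.higher n (by omega) p
  rw [this]
  simp

theorem lowerTerms_shift_two (hR : 1 ≤ R) (h : IsShift R ζ V V') (hb : ∀ s ≤ R, b' s = b s)
    (hV : IsFirstOrder fun k => V k 1) (p : Conf 2) :
    lowerTerms b' V' 2 (R + 1) p = lowerTerms b V 2 (R + 1) p -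
      (b' (R + 1) - b (R + 1)) - 2 * (R + 1) * ζ * cutoffQuadSum p := by
  rw [lowerTerms, lowerTerms, betaSum_shift hR h hb, treeSum_shift hR h,
    treeForm_quad_left_two hV, treeForm_quad_right_two hV,
    treeForm_quad_quad_high (by omega), quadSlice_of_ne (by omega)]
  have := hV.four p
  rw [this]
  simp only [mul_zero, ite_self]
  ring

theorem lowerTerms_shift_one (hR : 1 ≤ R) (h : IsShift R ζ V V') (hb : ∀ s ≤ R + 1, b' s = b s)
    (hV : IsVertex 1 (V 1 1)) (p : Conf 1) :
    lowerTerms b' V' 1 (R + 1) p = lowerTerms b V 1 (R + 1) p -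
      (((R + 1).choose 2 : ℝ) * b' 2 * ζ * ‖p 0‖ ^ 2 +
        (4 * (R + 1) * ζ * (cutoff (p 0) * ‖p 0‖ ^ 2 * V 1 1 p) +
          (if R = 1 then 4 * ζ ^ 2 else 0) * (cutoff (p 0) * ‖p 0‖ ^ 2 * ‖p 0‖ ^ 2))) := by
  have hq := isVertex_quadSlice 1
  rw [lowerTerms, lowerTerms, betaSum_shift hR h fun s hs => hb s (by omega), treeSum_shift hR h,
    treeForm_one hq hV, treeForm_one hV hq, treeForm_one hq hq, quadSlice_one, hb _ le_rfl]
  split_ifs <;> ring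

end Shift

/-! ### The induced change of the four point vertex -/

section FourLegs

/-- The function `∑ (1 - C(p_i))` of four momenta. -/
def cutoffSum (p : Conf 2) : ℝ := ∑ i : Fin (2 * 2), (1 - cutoff (fullMom p i))

theorem isLinearMap_fullMom_apply {n : ℕ} (i : Fin (2 * n)) :
    IsLinearMap ℝ (fun p : Conf n => fullMom p i) :=
  ⟨fun p q => congrFun (isLinearMap_fullMom.map_add p q) i,
    fun c p => congrFun (isLinearMap_fullMom.map_smul c p) i⟩

theorem isVertex_cutoffSum : IsVertex 2 cutoffSum := by
  refine ⟨fun k => Tame.sum _ fun i _ => ?_, fun π p => ?_, fun R p => ?_⟩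
  · have h := (tame_const k (1 : ℝ)).add ((tame_cutoff k).const_mul (-1))
    have := h.comp_isLinearMap (isLinearMap_fullMom_apply (n := 2) i)
    simpa [sub_eq_add_neg] using this
  · simp only [cutoffSum, fullMom_permMom (by norm_num : 1 ≤ 2)]
    exact Equiv.sum_comp π fun i => 1 - cutoff (fullMom p i)
  · refine Finset.sum_congr rfl fun i _ => ?_
    rw [show fullMom (fun j => R (p j)) i = R (fullMom p i) from
      fullMom_map R.toLinearEquiv.toLinearMap p i, cutoff_isometry]

theorem cutoffSum_zero : cutoffSum 0 = 0 := by
  simp [cutoffSum, (isLinearMap_fullMom_apply _).map_zero, cutoff]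

/-- Thus −(R + 1)ζ ∑(1 − C(p_i)) is the response of the four point vertex to the shift; it vanishes
at zero momentum and leaves the coupling condition intact. -/
theorem euler_cutoffSum (p : Conf 2) : fderiv ℝ cutoffSum p p = 2 * cutoffQuadSum p := by
  have h : ∀ i : Fin (2 * 2), HasFDerivAt (fun p : Conf 2 => 1 - cutoff (fullMom p i))
      (-(((-2 * cutoff (fullMom p i)) • innerSL ℝ (fullMom p i)).comp
        (LinearMap.toContinuousLinearMap (IsLinearMap.mk' _ (isLinearMap_fullMom_apply i))))) p :=
    fun i => ((hasFDerivAt_cutoff _).comp p (LinearMap.toContinuousLinearMap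
      (IsLinearMap.mk' _ (isLinearMap_fullMom_apply i))).hasFDerivAt).const_sub 1
  have h' : HasFDerivAt cutoffSum _ p := HasFDerivAt.fun_sum fun i _ => h i
  rw [h'.fderiv]
  simp [cutoffQuadSum, Finset.mul_sum, mul_assoc]

theorem cutoffSum_loopMom (p : Conf 1) (q : Mom) :
    cutoffSum (loopMom p q) = 2 * (1 - cutoff (p 0)) + 2 * (1 - cutoff q) := by
  have hc : ∀ x : Mom, cutoff (-x) = cutoff x := fun x => by simp [cutoff]
  have h0 : fullMom (loopMom p q : Conf 2) 0 = p 0 := by simp [fullMom, loopMom]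
  have h1 : fullMom (loopMom p q : Conf 2) 1 = q := by simp [fullMom, loopMom]
  have h2 : fullMom (loopMom p q : Conf 2) 2 = -q := by simp [fullMom, loopMom]
  have h3 : fullMom (loopMom p q : Conf 2) 3 = -p 0 := by
    rw [fullMom_last _ _ rfl, sum_loopMom le_rfl]
    exact congrArg _ (Fin.sum_univ_one p)
  have : cutoffSum (loopMom p q) = ∑ i : Fin 4, (1 - cutoff (fullMom (loopMom p q : Conf 2) i)) :=
    rfl
  rw [this, Fin.sum_univ_four, h0, h1, h2, h3, hc, hc]
  ring

/-- The loop carries the legs p, q, −q, −p, so the dependence on p separates from that on q. -/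
theorem loopTerm_cutoffSum : ∃ c : ℝ, ∀ p : Conf 1,
    loopTerm cutoffSum p = 2 / (4 * Real.pi) ^ 2 * (1 - cutoff (p 0)) + c := by
  have hi : Integrable fun q : Mom => cutoff q * (2 * (1 - cutoff q)) := by
    refine (integrable_cutoff.const_mul 2).mono' ?_ (.of_forall fun q => ?_)
    · have := (tame_cutoff 0).continuous
      exact Continuous.aestronglyMeasurable (by fun_prop)
    · have h1 : 0 ≤ cutoff q := (Real.exp_pos _).le
      have h2 : cutoff q ≤ 1 := Real.exp_le_one_iff.2 (by simp)
      rw [Real.norm_of_nonneg (mul_nonneg h1 (by linarith))]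
      nlinarith
  refine ⟨((2 * Real.pi) ^ 4)⁻¹ * ∫ q : Mom, cutoff q * (2 * (1 - cutoff q)), fun p => ?_⟩
  have h2 : ∀ q, loopIntegrand (n := 1) cutoffSum p q = cutoff q * (2 * (1 - cutoff (p 0))) +
      cutoff q * (2 * (1 - cutoff q)) := fun q => by
    rw [loopIntegrand, cutoffSum_loopMom]; ring
  have h3 := loopTerm_const (n := 1) (2 * (1 - cutoff (p 0))) p
  simp only [loopTerm, loopIntegrand] at h3
  simp only [loopTerm, h2]
  rw [integral_add (integrable_cutoff.mul_const _) hi, mul_add, h3]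
  ring

end FourLegs

/-! ### The p² coefficient of the shifted two point flow -/

section QuadCoeff

theorem cutoff_axisConf (t : ℝ) : cutoff (axisConf t 0) = Real.exp (-t ^ 2) := by
  rw [cutoff, norm_axisConf_zero]

theorem hasQuadCoeff_one_sub_cutoff : HasQuadCoeff (fun p => 1 - cutoff (p 0)) 1 := by
  have h1 : HasDerivAt (fun s : ℝ => -Real.exp (-s)) 1 0 :=
    ((hasDerivAt_id' (0 : ℝ)).fun_neg.exp).fun_neg.congr_deriv (by simp)
  have h2 := h1.tendsto_slope_zero_right
  have h3 : Tendsto (fun t : ℝ => t ^ 2) (𝓝[>] 0) (𝓝[>] 0) := by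
    refine tendsto_nhdsWithin_iff.2 ⟨?_, ?_⟩
    · have : Tendsto (fun t : ℝ => t ^ 2) (𝓝 0) (𝓝 (0 ^ 2)) := (continuous_pow 2).tendsto 0
      rw [zero_pow two_ne_zero] at this
      exact this.mono_left nhdsWithin_le_nhds
    · filter_upwards [self_mem_nhdsWithin] with t ht
      exact pow_pos (Set.mem_Ioi.1 ht) 2
  refine (h2.comp h3).congr fun t => ?_
  have h4 : cutoff ((0 : Conf 1) 0) = 1 := by simp [cutoff]
  simp only [Function.comp_apply, cutoff_axisConf, h4, smul_eq_mul, zero_add, neg_zero,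
    Real.exp_zero]
  ring

theorem hasQuadCoeff_cutoff_mul {f : Conf 1 → ℝ} (hf : Continuous f) :
    HasQuadCoeff (fun p => cutoff (p 0) * ‖p 0‖ ^ 2 * f p) (f 0) := by
  have hc : Continuous fun t : ℝ => Real.exp (-t ^ 2) * f (axisConf t) := by
    have : Continuous axisConf := continuous_pi fun _ => continuous_id.smul continuous_const
    fun_prop
  refine hasQuadCoeff_of_mul (u := fun t => Real.exp (-t ^ 2) * f (axisConf t)) (fun t _ => ?_) ?_
  · rw [cutoff_axisConf, norm_axisConf_zero]
    simp
    ring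
  · have := hc.tendsto 0
    have hz : axisConf 0 = 0 := by funext i; simp [axisConf]
    simp only [hz] at this
    simpa using this.mono_left nhdsWithin_le_nhds

/-- The change of the flow of the two point vertex of order `R + 1` under a shift by `ζ p²` at
order `R`: only the `β`-function contributes to its `p²` coefficient. -/
theorem hasQuadCoeff_shift (r x ζ y : ℝ) {f : Conf 1 → ℝ} (hf : Continuous f)
    (h0 : f 0 = -(1 / 2) / (4 * Real.pi) ^ 2) :
    HasQuadCoeff (fun p => -(x * ‖p 0‖ ^ 2 + (4 * r * ζ * (cutoff (p 0) * ‖p 0‖ ^ 2 * f p) +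
        y * (cutoff (p 0) * ‖p 0‖ ^ 2 * ‖p 0‖ ^ 2))) +
      -(r * ζ) * loopTerm cutoffSum p) (-x) := by
  obtain ⟨c, hc⟩ := loopTerm_cutoffSum
  have h1 := (hasQuadCoeff_norm_sq.const_mul (-x)).add
    (((hasQuadCoeff_cutoff_mul hf).const_mul (-(4 * r * ζ))).add
      ((hasQuadCoeff_cutoff_mul isVertex_norm_sq.differentiable.continuous).const_mul (-y)))
  have h2 := h1.add (((hasQuadCoeff_one_sub_cutoff.const_mul (2 / (4 * Real.pi) ^ 2)).add
    (hasQuadCoeff_const c)).const_mul (-(r * ζ)))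
  convert h2 using 1
  · funext p
    rw [hc]
    ring
  -- The cancellation: the trees give −4rζ · f(0) = 2rζ/(4π)², the loop gives −rζ · 2/(4π)².
  · rw [h0]
    simp
    ring

end QuadCoeff

/-! ### Computation of β⁽²⁾ -/

section SecondOrder

/-- The coefficients of `q` among the six momenta `(0, 0, 0, q, -q, 0)`. -/
def loopSign : Fin 6 → ℤ := ![0, 0, 0, 1, -1, 0]

/-- The coefficient of `q` in the momentum through the tree graph with six legs. -/
def treeSign (π : Equiv.Perm (Fin 6)) : ℤ :=
  loopSign (π 0) + loopSign (π 1) + loopSign (π 2)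

/-- The internal line carries ±q precisely when one of the two loop legs lies among the first three.
This happens for 12 of the 20 choices of three legs, that is for 432 of 720 permutations. -/
theorem sum_treeSign_sq : ∑ π : Equiv.Perm (Fin 6), treeSign π ^ 2 = 432 := by
  decide +kernel

theorem treeSign_mem (π : Equiv.Perm (Fin 6)) :
    treeSign π = 0 ∨ treeSign π = 1 ∨ treeSign π = -1 := by
  revert π
  decide +kernel

theorem fullMom_zero_loopMom (q : Mom) (i : Fin 6) :
    fullMom (loopMom (0 : Conf 2) q : Conf 3) i = (loopSign i : ℝ) • q := by
  by_cases h : i = 5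
  · subst h
    rw [fullMom_last _ _ rfl, sum_loopMom (by norm_num)]
    simp [loopSign]
  · have h5 : (i : ℕ) < 5 := by omega
    have h5' : (i : ℕ) < 2 * 3 - 1 := h5
    simp only [fullMom, h5', dif_pos, loopMom]
    interval_cases hi : (i : ℕ)
    · obtain rfl : i = 0 := Fin.ext hi
      simp [loopSign]
    · obtain rfl : i = 1 := Fin.ext hi
      simp [loopSign]
    · obtain rfl : i = 2 := Fin.ext hi
      simp [loopSign]
    · obtain rfl : i = 3 := Fin.ext hi
      simp [loopSign]
    · obtain rfl : i = 4 := Fin.ext hi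
      simp [loopSign]

theorem cutoff_sign_smul {k : ℤ} (hk : k = 0 ∨ k = 1 ∨ k = -1) (x : Mom) :
    cutoff ((k : ℝ) • x) = 1 + ((k ^ 2 : ℤ) : ℝ) * (cutoff x - 1) := by
  rcases hk with rfl | rfl | rfl <;> simp [cutoff]

theorem boseSymm_six_legs {A : Slice} (hA : IsFirstOrder A) (t : ℝ) (q : Mom) :
    boseSymm (treeProduct 3 2 (A 2) (A (3 - 2 + 1))) (t • loopMom (0 : Conf 2) q) =
      2 / 5 + 3 / 5 * cutoff (t • q) := by
  have h : ∀ π : Equiv.Perm (Fin 6), treeProduct 3 2 (A 2) (A (3 - 2 + 1))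
      (fun i => fullMom (t • loopMom (0 : Conf 2) q : Conf 3) (π i)) =
      1 + ((treeSign π ^ 2 : ℤ) : ℝ) * (cutoff (t • q) - 1) := by
    intro π
    rw [← cutoff_sign_smul (treeSign_mem π)]
    simp only [treeProduct, hA.four, mul_one]
    congr 1
    have hP : ∀ i : Fin 6, fullMom (t • loopMom (0 : Conf 2) q : Conf 3) i =
        (loopSign i : ℝ) • (t • q) := fun i => by
      have := congrFun (isLinearMap_fullMom.map_smul t (loopMom (0 : Conf 2) q : Conf 3)) i
      rw [this, Pi.smul_apply, fullMom_zero_loopMom, smul_comm]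
    refine (Fin.sum_univ_three _).trans ?_
    have hm : ∀ (P : Fin 6 → Mom) (i : Fin 6), momSeq P (i : ℕ) = P i := fun P i => by
      simp [momSeq]
    have e := fun i => hm (fun i => fullMom (t • loopMom (0 : Conf 2) q : Conf 3) (π i)) i
    refine (congrArg₂ (· + ·) (congrArg₂ (· + ·) (e 0) (e 1)) (e 2)).trans ?_
    simp only [hP, ← add_smul, treeSign]
    push_cast
    rfl
  have h6 : ((2 * 3)! : ℝ) = 720 := by norm_num [Nat.factorial]
  have hs : ∑ π : Equiv.Perm (Fin 6), ((treeSign π ^ 2 : ℤ) : ℝ) = 432 := by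
    rw [← Int.cast_sum, sum_treeSign_sq]; norm_num
  have hc : ∑ π : Equiv.Perm (Fin 6), (1 : ℝ) = 720 := by
    rw [Finset.sum_const, Finset.card_univ, Fintype.card_perm, Fintype.card_fin]
    norm_num [Nat.factorial]
  rw [boseSymm, h6, Finset.sum_congr rfl fun π _ => h π, Finset.sum_add_distrib, ← Finset.sum_mul]
  refine (congrArg₂ (fun x y : ℝ => (720 : ℝ)⁻¹ * (x + y * (cutoff (t • q) - 1))) hc hs).trans ?_
  ring

theorem cutoff_mul_cutoff_smul (t : ℝ) (q : Mom) :
    cutoff q * cutoff (t • q) = Real.exp (-(1 + t ^ 2) * ‖q‖ ^ 2) := by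
  rw [cutoff, cutoff, ← Real.exp_add, norm_smul, mul_pow, Real.norm_eq_abs, sq_abs]
  congr 1
  ring

theorem integral_loop_six_legs (t : ℝ) :
    ∫ q : Mom, cutoff q * (t * (2 / 5 + 3 / 5 * cutoff (t • q))) =
      Real.pi ^ 2 * (2 / 5 * t + 3 / 5 * (t / (1 + t ^ 2) ^ 2)) := by
  have hb : 0 < 1 + t ^ 2 := by positivity
  have h : ∀ q : Mom, cutoff q * (t * (2 / 5 + 3 / 5 * cutoff (t • q))) =
      2 / 5 * t * cutoff q + 3 / 5 * t * Real.exp (-(1 + t ^ 2) * ‖q‖ ^ 2) := fun q => by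
    rw [← cutoff_mul_cutoff_smul]; ring
  simp only [h]
  rw [integral_add (integrable_cutoff.const_mul _)
    ((integrable_exp_neg_mul_norm_sq hb).const_mul _), integral_const_mul, integral_const_mul,
    integral_cutoff, integral_exp_neg_mul_norm_sq hb]
  field_simp

/-- The weight t is the one of the ray average inverting D + 2 (six legs); the Gaussian integral
with cutoffs at q and tq gives 1/(1 + t²)². -/
theorem integral_unit_interval :
    ∫ t in Set.Ioc (0 : ℝ) 1, (2 / 5 * t + 3 / 5 * (t / (1 + t ^ 2) ^ 2)) = 7 / 20 := by
  have hp : ∀ t : ℝ, 1 + t ^ 2 ≠ 0 := fun t => by positivity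
  rw [← intervalIntegral.integral_of_le zero_le_one,
    intervalIntegral.integral_eq_sub_of_hasDerivAt
      (f := fun t : ℝ => 1 / 5 * t ^ 2 - 3 / 10 * (1 + t ^ 2)⁻¹)]
  · norm_num
  · intro t _
    have h1 := (hasDerivAt_pow 2 t).const_mul (1 / 5 : ℝ)
    have h2 := (((hasDerivAt_pow 2 t).const_add 1).inv (hp t)).const_mul (3 / 10 : ℝ)
    refine (h1.sub h2).congr_deriv ?_
    have := hp t
    push_cast
    field_simp
    ring
  · refine Continuous.intervalIntegrable ?_ _ _
    have : ∀ t : ℝ, (1 + t ^ 2) ^ 2 ≠ 0 := fun t => by positivity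
    fun_prop (disch := assumption)

theorem integral_loop_ray :
    ∫ q : Mom, cutoff q * ∫ t in Set.Ioc (0 : ℝ) 1, t * (2 / 5 + 3 / 5 * cutoff (t • q)) =
      7 / 20 * Real.pi ^ 2 := by
  simp only [← integral_const_mul]
  have hcut := (tame_cutoff 0).continuous
  rw [integral_integral_swap]
  · simp only [integral_loop_six_legs]
    rw [integral_const_mul, integral_unit_interval]
    ring
  · have hi : Integrable (fun t : ℝ => |t|) (volume.restrict (Set.Ioc (0 : ℝ) 1)) :=
      (continuous_abs.integrableOn_Icc).mono_set Set.Ioc_subset_Icc_self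
    refine (integrable_cutoff.mul_prod hi).mono' ?_ (.of_forall fun z => ?_)
    · refine Continuous.aestronglyMeasurable ?_
      simp only [Function.uncurry_def]
      fun_prop
    · have h1 : ∀ x : Mom, 0 ≤ cutoff x := fun x => (Real.exp_pos _).le
      have h2 : cutoff (z.2 • z.1) ≤ 1 := Real.exp_le_one_iff.2 (by simp)
      have h3 := h1 (z.2 • z.1)
      simp only [Function.uncurry_def, norm_mul]
      rw [Real.norm_of_nonneg (h1 z.1), Real.norm_eq_abs,
        Real.norm_of_nonneg (by linarith : 0 ≤ 2 / 5 + 3 / 5 * cutoff (z.2 • z.1))]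
      have := mul_le_mul_of_nonneg_left (by linarith : 2 / 5 + 3 / 5 * cutoff (z.2 • z.1) ≤ 1)
        (abs_nonneg z.2)
      exact mul_le_mul_of_nonneg_left (by linarith) (h1 z.1)

variable {V : VertexFamily} {b : ℕ → ℝ}

/-- Only the tree of two four point vertices survives; 40 = 2 · binom(6, 3). -/
theorem lowerTerms_six_legs (hA : IsFirstOrder fun k => V k 1) (p : Conf 3) :
    lowerTerms b V 3 2 p = -40 * boseSymm (treeProduct 3 2 (V 2 1) (V (3 - 2 + 1) 1)) p := by
  have h3 : ∀ x, V 3 1 x = 0 := hA.higher 3 (by norm_num)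
  have hb : betaSum b V 3 2 p = 0 := by simp [betaSum, h3]
  have ht : treeForm (fun k => V k 1) (fun k => V k (2 - 1)) 3 p =
      20 * boseSymm (treeProduct 3 2 (V 2 1) (V (3 - 2 + 1) 1)) p := by
    rw [treeForm, Finset.sum_Icc_succ_top (by norm_num), Finset.sum_Icc_succ_top (by norm_num),
      Finset.Icc_self, Finset.sum_singleton, boseSymm_treeProduct_of_left h3,
      boseSymm_treeProduct_of_right h3]
    norm_num [Nat.choose]
  rw [lowerTerms, hb, treeSum, Finset.Icc_self, Finset.sum_singleton, ht]
  norm_num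
  ring

/-- Here 16 = 2 (binom(4, 1) + binom(4, 3)). At zero momentum the unknown wave function term of
first order does not contribute. -/
theorem lowerTerms_four_legs_zero (hA : IsFirstOrder fun k => V k 1) :
    lowerTerms b V 2 2 0 = -b 2 - 16 * V 1 1 0 := by
  have h2 : ∀ x, V 2 1 x = 1 := hA.four
  have hb : betaSum b V 2 2 0 = b 2 := by simp [betaSum, h2]
  have hz : ∀ i, fullMom (0 : Conf 2) i = 0 := fun i => (isLinearMap_fullMom_apply i).map_zero
  have hm : ∀ i, momSeq (fun _ : Fin (2 * 2) => (0 : Mom)) i = 0 := fun i => by simp [momSeq]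
  have hc : cutoff 0 = 1 := by simp [cutoff]
  have t1 : boseSymm (treeProduct 2 1 (V 1 1) (V (2 - 1 + 1) 1)) 0 = V 1 1 0 :=
    boseSymm_of_const fun π => by
      have h2' : ∀ x, V (2 - 1 + 1) 1 x = 1 := h2
      simp only [treeProduct, hz, hm, h2', Finset.sum_const_zero, hc, one_mul, mul_one]
      rfl
  have t2 : boseSymm (treeProduct 2 2 (V 2 1) (V (2 - 2 + 1) 1)) 0 = V 1 1 0 :=
    boseSymm_of_const fun π => by
      simp only [treeProduct, hz, hm, h2, Finset.sum_const_zero, hc, one_mul, ite_self]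
      rfl
  have ht : treeForm (fun k => V k 1) (fun k => V k (2 - 1)) 2 0 = 8 * V 1 1 0 := by
    rw [treeForm, Finset.sum_Icc_succ_top (by norm_num), Finset.Icc_self, Finset.sum_singleton,
      t1, t2]
    norm_num [Nat.choose]
    ring
  rw [lowerTerms, hb, treeSum, Finset.Icc_self, Finset.sum_singleton, ht]
  norm_num
  ring

/-- The six point vertex is an explicit ray average, and its loop at zero momentum is −40 ·
(7/20)/(4π)² = −14/(4π)². With the trees this balances to −14 + 8 = −6. Only the equations for six
and four legs enter, so the result is available before the two point equation of second order is
solved. -/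
theorem beta_two_eq (hA : IsFirstOrder fun k => V k 1)
    (hμ : V 1 1 0 = -(1 / 2) / (4 * Real.pi) ^ 2) (hv2 : IsVertex 2 (V 2 1))
    (hd : IsVertex 3 (V 3 2))
    (h3 : ∀ p, fderiv ℝ (V 3 2) p p + 2 * V 3 2 p = lowerTerms b V 3 2 p)
    (h2 : loopTerm (V 3 2) 0 + lowerTerms b V 2 2 0 = 0) : b 2 = -6 / (4 * Real.pi) ^ 2 := by
  set F : Conf 3 → ℝ := lowerTerms b V 3 2 with hF
  have hFt : Tame 1 F := by
    rw [hF, funext (lowerTerms_six_legs hA)]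
    exact ((IsVertex.tree (by norm_num) hv2 hv2).tame 1).const_mul _
  have hsol : ∀ p, V 3 2 p = rayAverage 1 F p := fun p => by
    have hd2 := (hFt.rayAverage 1).differentiable
    refine sub_eq_zero.1 (euler_unique_pos 1 (W := fun x => V 3 2 x - rayAverage 1 F x)
      (hd.differentiable.sub hd2) (fun x => ?_) p)
    have := euler_rayAverage 1 hFt x
    rw [smul_eq_mul] at this
    rw [fderiv_sub_self hd.differentiable hd2]
    push_cast at this ⊢
    linear_combination h3 x - this
  have hval : ∀ q : Mom, V 3 2 (loopMom (0 : Conf 2) q) =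
      -40 * ∫ t in Set.Ioc (0 : ℝ) 1, t * (2 / 5 + 3 / 5 * cutoff (t • q)) := fun q => by
    rw [hsol, rayAverage_apply, ← integral_const_mul]
    refine integral_congr_ae (.of_forall fun t => ?_)
    simp only [hF]
    rw [lowerTerms_six_legs hA]
    have := boseSymm_six_legs hA t q
    rw [this, smul_eq_mul]
    ring
  have hloop : loopTerm (V 3 2) (0 : Conf 2) = -14 / (4 * Real.pi) ^ 2 := by
    simp only [loopTerm, loopIntegrand, hval]
    have e : ∀ q : Mom, cutoff q * (-40 * ∫ t in Set.Ioc (0 : ℝ) 1,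
        t * (2 / 5 + 3 / 5 * cutoff (t • q))) = -40 * (cutoff q * ∫ t in Set.Ioc (0 : ℝ) 1,
        t * (2 / 5 + 3 / 5 * cutoff (t • q))) := fun q => by ring
    simp only [e]
    rw [integral_const_mul, integral_loop_ray]
    have := Real.pi_pos.ne'
    field_simp
    norm_num
  rw [hloop, lowerTerms_four_legs_zero hA, hμ] at h2
  have e : -14 / (4 * Real.pi) ^ 2 + (-b 2 - 16 * (-(1 / 2) / (4 * Real.pi) ^ 2)) =
    -b 2 + -6 / (4 * Real.pi) ^ 2 := by ring
  linarith

end SecondOrder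

/-! ### Truncated solutions and the induction on the order -/

/-- The flow equation of order `r` for the vertex with `2 n` legs, when `β` has no linear term. -/
def FlowEq (b : ℕ → ℝ) (V : VertexFamily) (n r : ℕ) : Prop :=
  ∀ p, fderiv ℝ (V n r) p p + (-4 + 2 * (n : ℝ)) * V n r p =
    loopTerm (V (n + 1) r) p + lowerTerms b V n r p

/-- Scaling pairs up to order `R`. -/
structure IsTruncSolution (lam : ℕ → ℝ) (R : ℕ) (b : ℕ → ℝ) (V : VertexFamily) : Prop where
  no_constant : ∀ r p, V 0 r p = 0
  no_order_zero : ∀ n p, V n 0 p = 0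
  vertex : ∀ n r, IsVertex n (V n r)
  connected : ∀ n r, r + 1 < n → ∀ p, V n r p = 0
  coupling : ∀ r, 1 < r → r ≤ R → V 2 r 0 = lam r
  order_one_two : ∃ μ ζ : ℝ, ∀ p, V 1 1 p = μ + ζ * ‖p 0‖ ^ 2
  order_one_four : ∀ p, V 2 1 p = 1
  beta_zero : b 0 = 0
  beta_one : b 1 = 0
  flow : ∀ n r, 1 ≤ n → 1 ≤ r → r ≤ R → FlowEq b V n r

section LowerTerms

variable {n r : ℕ} {V V' : VertexFamily} {b b' : ℕ → ℝ}

theorem lowerTerms_congr (hV : ∀ n s, s < r → V' n s = V n s) (hb : ∀ s ≤ r, b' s = b s)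
    (p : Conf n) : lowerTerms b' V' n r p = lowerTerms b V n r p := by
  have h1 : betaSum b' V' n r p = betaSum b V n r p := Finset.sum_congr rfl fun s hs => by
    have := Finset.mem_Icc.1 hs
    rw [hV n _ (by omega), hb s (by omega)]
  have h2 : treeSum V' n r p = treeSum V n r p := Finset.sum_congr rfl fun s hs => by
    have := Finset.mem_Icc.1 hs
    have e1 : (fun k => V' k s) = fun k => V k s := funext fun k => hV k s (by omega)
    have e2 : (fun k => V' k (r - s)) = fun k => V k (r - s) := funext fun k => hV k _ (by omega)
    rw [e1, e2]
  rw [lowerTerms, lowerTerms, h1, h2]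

theorem isVertex_lowerTerms (hV : ∀ n s, IsVertex n (V n s)) (hn : 1 ≤ n) :
    IsVertex n (lowerTerms b V n r) := by
  refine (IsVertex.sum _ fun s _ => (hV n _).const_mul _).neg.sub
    (IsVertex.sum _ fun s _ => IsVertex.const_mul (IsVertex.sum _ fun m hm => ?_) _)
  exact ((hV m s).tree hn (hV _ _)).const_mul _

theorem lowerTerms_eq_zero (hV : ∀ n s, s + 1 < n → ∀ p, V n s p = 0) (hr : r + 1 < n)
    (p : Conf n) : lowerTerms b V n r p = 0 := by
  have h1 : betaSum b V n r p = 0 := Finset.sum_eq_zero fun s hs => by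
    have := Finset.mem_Icc.1 hs
    rw [hV n _ (by omega), mul_zero]
  have h2 : treeSum V n r p = 0 := Finset.sum_eq_zero fun s hs => by
    have := Finset.mem_Icc.1 hs
    rw [treeForm, Finset.sum_eq_zero, mul_zero]
    intro m hm
    have := Finset.mem_Icc.1 hm
    -- If both factors obeyed the connectedness bound, m ≤ s + 1 and n − m + 1 ≤ r − s + 1 would
    -- give n ≤ r + 1.
    by_cases h : s + 1 < m
    · rw [boseSymm_treeProduct_of_left (hV m s h), mul_zero]
    · rw [boseSymm_treeProduct_of_right (hV _ _ (by omega)), mul_zero]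
  rw [lowerTerms, h1, h2]
  simp

end LowerTerms

theorem euler_quadSlice (p : Conf 1) : fderiv ℝ (quadSlice 1) p p = 2 * quadSlice 1 p := by
  rw [funext quadSlice_one, euler_norm_sq]

namespace IsTruncSolution

variable {lam : ℕ → ℝ} {R : ℕ} {b b' : ℕ → ℝ} {V V' : VertexFamily}

theorem isFirstOrder (h : IsTruncSolution lam R b V) : IsFirstOrder fun k => V k 1 :=
  ⟨h.order_one_four, fun n hn => h.connected n 1 (by omega)⟩

theorem mono {S : ℕ} (h : IsTruncSolution lam R b V) (hS : S ≤ R) : IsTruncSolution lam S b V :=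
  { h with
    coupling := fun r h1 h2 => h.coupling r h1 (h2.trans hS)
    flow := fun n r hn h1 h2 => h.flow n r hn h1 (h2.trans hS) }

/-- At first order and zero momentum the flow reads −2 V₂(0) = 1/(4π)², the loop over the constant
four point vertex. -/
theorem two_one_zero (h : IsTruncSolution lam R b V) (hR : 1 ≤ R) :
    V 1 1 0 = -(1 / 2) / (4 * Real.pi) ^ 2 := by
  have h1 := h.flow 1 1 le_rfl le_rfl hR 0
  have h2 : lowerTerms b V 1 1 0 = 0 := by simp [lowerTerms, betaSum, treeSum]
  rw [h2, map_zero, show V (1 + 1) 1 = fun _ => 1 from funext h.order_one_four,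
    loopTerm_const] at h1
  norm_num at h1
  have e : -(1 / 2) / (4 * Real.pi) ^ 2 = -(1 / 2) * (1 / (4 * Real.pi) ^ 2) := by ring
  rw [e]
  simp only [one_div] at h1 ⊢
  linarith

theorem beta_two (h : IsTruncSolution lam R b V) (hR : 2 ≤ R) :
    b 2 = -6 / (4 * Real.pi) ^ 2 := by
  refine beta_two_eq h.isFirstOrder (h.two_one_zero (by omega)) (h.vertex _ _) (h.vertex _ _)
    (fun p => ?_) ?_
  · have h1 := h.flow 3 2 (by norm_num) (by norm_num) hR p
    rw [show V (3 + 1) 2 = fun _ => 0 from funext (h.connected 4 2 (by norm_num)),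
      loopTerm_zero] at h1
    norm_num at h1
    exact h1
  · have h1 := h.flow 2 2 (by norm_num) (by norm_num) hR 0
    rw [map_zero] at h1
    norm_num at h1
    exact h1.symm

/-- The family with `ζ p²` added to the two point vertex of order `R`. -/
def shiftFamily (R : ℕ) (ζ : ℝ) (V : VertexFamily) : VertexFamily :=
  fun n s p => V n s p + (if s = R then ζ else 0) * quadSlice n p

theorem isShift_shiftFamily (R : ℕ) (ζ : ℝ) (V : VertexFamily) :
    IsShift R ζ V (shiftFamily R ζ V) := fun _ _ _ _ => rfl

theorem shiftFamily_of_ne_order {s : ℕ} (hs : s ≠ R) (ζ : ℝ) (V : VertexFamily) (n : ℕ) :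
    shiftFamily R ζ V n s = V n s := by
  funext p; simp [shiftFamily, hs]

theorem shiftFamily_of_ne_one {n : ℕ} (hn : n ≠ 1) (ζ : ℝ) (V : VertexFamily) (s : ℕ) :
    shiftFamily R ζ V n s = V n s := by
  funext p; simp [shiftFamily, quadSlice_of_ne hn]

/-- The term p² is in the kernel of D − 2, a two point vertex never enters a loop, and order R
enters lower order terms only from order R + 1 on. -/
theorem shift (h : IsTruncSolution lam R b V) (hR : 1 ≤ R) (ζ : ℝ) :
    IsTruncSolution lam R b (shiftFamily R ζ V) where
  no_constant r p := by rw [shiftFamily_of_ne_one (by norm_num), h.no_constant]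
  no_order_zero n p := by rw [shiftFamily_of_ne_order (by omega), h.no_order_zero]
  vertex n r := (h.vertex n r).add ((isVertex_quadSlice n).const_mul _)
  connected n r hr p := by
    by_cases hn : n = 1
    · rw [shiftFamily_of_ne_order (by omega), h.connected n r hr]
    · rw [shiftFamily_of_ne_one hn, h.connected n r hr]
  coupling r h1 h2 := by rw [shiftFamily_of_ne_one (by norm_num), h.coupling r h1 h2]
  order_one_two := by
    obtain ⟨μ, ζ', h1⟩ := h.order_one_two
    refine ⟨μ, ζ' + if 1 = R then ζ else 0, fun p => ?_⟩
    rw [shiftFamily, h1, quadSlice_one]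
    ring
  order_one_four p := by rw [shiftFamily_of_ne_one (by norm_num), h.order_one_four]
  beta_zero := h.beta_zero
  beta_one := h.beta_one
  flow n r hn h1 h2 p := by
    have hlow : lowerTerms b (shiftFamily R ζ V) n r p = lowerTerms b V n r p :=
      lowerTerms_congr (fun n s hs => shiftFamily_of_ne_order (by omega) ζ V n)
        (fun _ _ => rfl) p
    rw [hlow, shiftFamily_of_ne_one (by omega : n + 1 ≠ 1)]
    rw [← h.flow n r hn h1 h2 p]
    by_cases hn1 : n = 1
    · subst hn1
      have d1 := (h.vertex 1 r).differentiable
      have d2 := (isVertex_quadSlice 1).differentiable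
      change fderiv ℝ (fun p => V 1 r p + (if r = R then ζ else 0) * quadSlice 1 p) p p +
        _ * (V 1 r p + (if r = R then ζ else 0) * quadSlice 1 p) = _
      rw [fderiv_add_self d1 (d2.const_mul _), fderiv_const_mul_self d2, euler_quadSlice]
      push_cast
      ring
    · rw [shiftFamily_of_ne_one hn1]

/-- The family whose vertices of order `R` are replaced by `W`. -/
def replaceOrder (R : ℕ) (W : Slice) (V : VertexFamily) : VertexFamily :=
  fun n r => if r = R then W n else V n r

theorem replaceOrder_self (R : ℕ) (W : Slice) (V : VertexFamily) (n : ℕ) :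
    replaceOrder R W V n R = W n := if_pos rfl

theorem replaceOrder_of_ne {r : ℕ} (hr : r ≠ R) (W : Slice) (V : VertexFamily) (n : ℕ) :
    replaceOrder R W V n r = V n r := if_neg hr

theorem extend (h : IsTruncSolution lam R b V) (hR : 1 ≤ R) (hb : ∀ s ≤ R, b' s = b s) {W : Slice}
    (hW0 : ∀ p, W 0 p = 0) (hW : ∀ n, IsVertex n (W n)) (hc : ∀ n, R + 2 < n → ∀ p, W n p = 0)
    (hl : W 2 0 = lam (R + 1))
    (hf : ∀ n, 1 ≤ n → ∀ p, fderiv ℝ (W n) p p + (-4 + 2 * (n : ℝ)) * W n p =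
      loopTerm (W (n + 1)) p + lowerTerms b' V n (R + 1) p) :
    IsTruncSolution lam (R + 1) b' (replaceOrder (R + 1) W V) where
  no_constant r p := by
    by_cases hr : r = R + 1
    · subst hr; rw [replaceOrder_self, hW0]
    · rw [replaceOrder_of_ne hr, h.no_constant]
  no_order_zero n p := by rw [replaceOrder_of_ne (by omega), h.no_order_zero]
  vertex n r := by
    by_cases hr : r = R + 1
    · subst hr; rw [replaceOrder_self]; exact hW n
    · rw [replaceOrder_of_ne hr]; exact h.vertex n r
  connected n r hn p := by
    by_cases hr : r = R + 1
    · subst hr; rw [replaceOrder_self]; exact hc n (by omega) p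
    · rw [replaceOrder_of_ne hr]; exact h.connected n r hn p
  coupling r h1 h2 := by
    by_cases hr : r = R + 1
    · subst hr; rw [replaceOrder_self]; exact hl
    · rw [replaceOrder_of_ne hr]; exact h.coupling r h1 (by omega)
  order_one_two := by rw [replaceOrder_of_ne (by omega)]; exact h.order_one_two
  order_one_four p := by rw [replaceOrder_of_ne (by omega)]; exact h.order_one_four p
  beta_zero := by rw [hb 0 (by omega)]; exact h.beta_zero
  beta_one := by rw [hb 1 hR]; exact h.beta_one
  flow n r hn h1 h2 p := by
    by_cases hr : r = R + 1
    · subst hr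
      rw [replaceOrder_self, replaceOrder_self, hf n hn p]
      congr 1
      exact (lowerTerms_congr (fun n s hs => replaceOrder_of_ne (by omega) W V n)
        (fun _ _ => rfl) p).symm
    · rw [replaceOrder_of_ne hr, replaceOrder_of_ne hr, h.flow n r hn h1 (by omega) p]
      congr 1
      exact (lowerTerms_congr (fun n s hs => replaceOrder_of_ne (by omega) W V n)
        (fun s hs => hb s (by omega)) p).symm

/-- The vertices of the next order with at least `2 N` legs. -/
theorem exists_slice_ge (h : IsTruncSolution lam R b V) (b' : ℕ → ℝ) (k : ℕ) (N : ℕ)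
    (hN : 3 ≤ N) (hk : R + 3 ≤ N + k) :
    ∃ W : Slice, (∀ n, IsVertex n (W n)) ∧ (∀ n, R + 2 < n → ∀ p, W n p = 0) ∧
      ∀ n, N ≤ n → ∀ p, fderiv ℝ (W n) p p + (-4 + 2 * (n : ℝ)) * W n p =
        loopTerm (W (n + 1)) p + lowerTerms b' V n (R + 1) p := by
  induction k generalizing N with
  | zero =>
    refine ⟨fun _ _ => 0, fun n => .const 0, fun _ _ _ => rfl, fun n hn p => ?_⟩
    rw [loopTerm_zero, lowerTerms_eq_zero h.connected (by omega)]
    simp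
  | succ k ih =>
    by_cases hNR : R + 2 < N
    · exact ih N hN (by omega)
    obtain ⟨W, hW, hc, hf⟩ := ih (N + 1) (by omega) (by omega)
    -- With d = 2N − 5 the operator D + d + 1 is D + 2N − 4; N ≥ 3 keeps the natural subtraction
    -- exact.
    obtain ⟨w, hw, hwf⟩ := (((hW (N + 1)).loopTerm (by omega)).add
      (isVertex_lowerTerms (b := b') (r := R + 1) h.vertex
        (by omega : 1 ≤ N))).exists_euler_pos (2 * N - 5)
    refine ⟨Function.update W N w, fun n => ?_, fun n hn p => ?_, fun n hn p => ?_⟩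
    · by_cases hnN : n = N
      · subst hnN; rw [Function.update_self]; exact hw
      · rw [Function.update_of_ne hnN]; exact hW n
    · rw [Function.update_of_ne (by omega)]; exact hc n hn p
    · rw [Function.update_of_ne (by omega : n + 1 ≠ N)]
      by_cases hnN : n = N
      · subst hnN
        rw [Function.update_self, ← hwf p]
        have : ((2 * n - 5 : ℕ) : ℝ) = 2 * n - 5 := by
          rw [Nat.cast_sub (by omega)]; push_cast; ring
        rw [this]
        ring
      · rw [Function.update_of_ne hnN]; exact hf n (by omega) p

end IsTruncSolution

theorem isShift_zero (R : ℕ) (V : VertexFamily) : IsShift R 0 V V := fun n s _ p => by simp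

theorem beta_two_ne_zero : (-6 / (4 * Real.pi) ^ 2 : ℝ) ≠ 0 := by
  have := Real.pi_pos
  exact div_ne_zero (by norm_num) (by positivity)

namespace IsTruncSolution

variable {lam : ℕ → ℝ} {R : ℕ} {b b' : ℕ → ℝ} {V V' : VertexFamily}

/-- Choosing the wave function shift requires division by β⁽²⁾. For R = 1 this coefficient is being
fixed in the same step, so its value must be read off from the four and six point equations alone.
-/
theorem beta_two_of_extension (h : IsTruncSolution lam R b V) (hR : 1 ≤ R)
    (hb : ∀ s ≤ R, b' s = b s) {W : Slice} (hW : ∀ n, IsVertex n (W n))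
    (hc : ∀ n, R + 2 < n → ∀ p, W n p = 0)
    (hf : ∀ n, 3 ≤ n → ∀ p, fderiv ℝ (W n) p p + (-4 + 2 * (n : ℝ)) * W n p =
      loopTerm (W (n + 1)) p + lowerTerms b' V n (R + 1) p)
    (h2 : loopTerm (W 3) 0 + lowerTerms b' V 2 (R + 1) 0 = 0) :
    b' 2 = -6 / (4 * Real.pi) ^ 2 := by
  rcases hR.eq_or_lt with rfl | hR2
  · have e1 : ∀ n, replaceOrder 2 W V n 1 = V n 1 := replaceOrder_of_ne (by norm_num) W V
    have e2 : ∀ n, replaceOrder 2 W V n 2 = W n := replaceOrder_self 2 W V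
    have hlow : ∀ n p, lowerTerms b' (replaceOrder 2 W V) n 2 p = lowerTerms b' V n 2 p :=
      fun n p => lowerTerms_congr (fun n s hs => replaceOrder_of_ne (by omega) W V n)
        (fun _ _ => rfl) p
    refine beta_two_eq (V := replaceOrder 2 W V) ?_ ?_ ?_ ?_ (fun p => ?_) ?_
    · simp only [e1]; exact h.isFirstOrder
    · rw [e1]; exact h.two_one_zero le_rfl
    · rw [e1]; exact h.vertex 2 1
    · rw [e2]; exact hW 3
    · have h1 := hf 3 le_rfl p
      rw [show W (3 + 1) = fun _ => 0 from funext (hc 4 (by norm_num)), loopTerm_zero] at h1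
      rw [e2, hlow]
      norm_num at h1
      exact h1
    · rw [e2, hlow]; exact h2
  · rw [hb 2 hR2]; exact h.beta_two hR2

theorem exists_extension (h : IsTruncSolution lam R b V) (hR : 1 ≤ R) :
    ∃ b' V', IsTruncSolution lam (R + 1) b' V' := by
  obtain ⟨W, hW, hc, hf⟩ := h.exists_slice_ge b R 3 le_rfl (by omega)
  -- Since β⁽ᴿ⁺¹⁾ multiplies −V₄⁽¹⁾ = −1, this increment makes the right side of the four point
  -- equation vanish at zero momentum.
  set β : ℝ := b (R + 1) + (loopTerm (W 3) 0 + lowerTerms b V 2 (R + 1) 0) with hβ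
  set b' : ℕ → ℝ := Function.update b (R + 1) β with hb'
  have hb : ∀ s ≤ R, b' s = b s := fun s hs => Function.update_of_ne (by omega) _ _
  have hbR : b' (R + 1) = β := Function.update_self _ _ _
  have hV1 := h.isFirstOrder
  have h2 : loopTerm (W 3) 0 + lowerTerms b' V 2 (R + 1) 0 = 0 := by
    rw [lowerTerms_shift_two hR (isShift_zero R V) hb hV1, hbR]
    ring
  have hf' : ∀ n, 3 ≤ n → ∀ p, fderiv ℝ (W n) p p + (-4 + 2 * (n : ℝ)) * W n p =
      loopTerm (W (n + 1)) p + lowerTerms b' V n (R + 1) p := fun n hn p => by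
    rw [hf n hn, lowerTerms_shift_high hR (isShift_zero R V) hb hV1 hn]
  have hb2 := h.beta_two_of_extension hR hb hW hc hf' h2
  obtain ⟨W₂, hW₂, hW₂0, hW₂f⟩ := (((hW 3).loopTerm (by norm_num)).add
    (isVertex_lowerTerms (b := b') (r := R + 1) h.vertex
      (by norm_num : 1 ≤ 2))).exists_euler_zero h2 (lam (R + 1))
  obtain ⟨ρ, hρ, -⟩ := ((hW₂.loopTerm le_rfl).add
    (isVertex_lowerTerms (b := b') (r := R + 1) h.vertex le_rfl)).exists_euler_two
  have hch : (((R + 1).choose 2 : ℕ) : ℝ) ≠ 0 := by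
    exact_mod_cast (Nat.choose_pos (by omega)).ne'
  -- The obstruction ρ of the unshifted two point equation is cancelled by the change −binom(R + 1,
  -- 2) β⁽²⁾ ζ.
  set ζ : ℝ := ρ / (((R + 1).choose 2 : ℝ) * b' 2) with hζ
  have hζρ : ((R + 1).choose 2 : ℝ) * b' 2 * ζ = ρ := by
    have : b' 2 ≠ 0 := by rw [hb2]; exact beta_two_ne_zero
    rw [hζ]; field_simp
  have hsh := isShift_shiftFamily R ζ V
  have hS := h.shift hR ζ
  set X : Conf 2 → ℝ := fun p => W₂ p + -((R + 1 : ℝ) * ζ) * cutoffSum p with hX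
  have hXv : IsVertex 2 X := hW₂.add (isVertex_cutoffSum.const_mul _)
  have hXloop : ∀ p, loopTerm (n := 1) X p =
      loopTerm (n := 1) W₂ p + -((R + 1 : ℝ) * ζ) * loopTerm (n := 1) cutoffSum p := fun p => by
    rw [hX, loopTerm_add (n := 1) (hW₂.tame 0) ((isVertex_cutoffSum.const_mul _).tame 0),
      loopTerm_const_mul (n := 1)]
  have hquad : HasQuadCoeff
      (fun p => loopTerm (n := 1) X p + lowerTerms b' (shiftFamily R ζ V) 1 (R + 1) p) 0 := by
    have h3 := hρ.add (hasQuadCoeff_shift (R + 1) (((R + 1).choose 2 : ℝ) * b' 2 * ζ) ζ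
      (if R = 1 then 4 * ζ ^ 2 else 0) (h.vertex 1 1).differentiable.continuous
      (h.two_one_zero hR))
    rw [hζρ, add_neg_cancel] at h3
    refine (funext fun p => ?_ : _ = fun p => _) ▸ h3
    rw [hXloop, lowerTerms_shift_one (b := b') hR hsh (fun _ _ => rfl) (h.vertex 1 1), hζρ]
    ring
  obtain ⟨ρ', hρ', Y, hY, hYf⟩ := ((hXv.loopTerm le_rfl).add
    (isVertex_lowerTerms (b := b') (r := R + 1) hS.vertex le_rfl)).exists_euler_two
  obtain rfl : ρ' = 0 := hρ'.unique hquad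
  let Z : Slice := fun n => match n with
    | 0 => fun _ => 0
    | 1 => Y
    | 2 => X
    | (n + 3) => W (n + 3)
  have hZ : ∀ n, 3 ≤ n → Z n = W n := fun n hn => by
    obtain ⟨m, rfl⟩ := Nat.exists_eq_add_of_le' hn
    rfl
  refine ⟨b', _, hS.extend hR hb (W := Z) (fun p => rfl) (fun n => ?_) (fun n hn p => ?_) ?_
    (fun n hn p => ?_)⟩
  · match n with
    | 0 => exact .const 0
    | 1 => exact hY
    | 2 => exact hXv
    | (n + 3) => exact hW (n + 3)
  · rw [hZ n (by omega)]; exact hc n hn p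
  · change X 0 = _
    simp [hX, hW₂0, cutoffSum_zero]
  · by_cases h3 : 3 ≤ n
    · rw [hZ n h3, hZ (n + 1) (by omega), hf' n h3]
      congr 1
      exact (lowerTerms_shift_high hR hsh (fun _ _ => rfl) hV1 h3 p).symm
    · obtain rfl | rfl : n = 1 ∨ n = 2 := by omega
      · change fderiv ℝ Y p p + (-4 + 2 * ((1 : ℕ) : ℝ)) * Y p = loopTerm X p + _
        have := hYf p
        push_cast
        linear_combination this
      · change fderiv ℝ X p p + (-4 + 2 * ((2 : ℕ) : ℝ)) * X p = loopTerm (W 3) p + _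
        rw [hX, fderiv_add_self hW₂.differentiable
          (isVertex_cutoffSum.differentiable.const_mul _),
          fderiv_const_mul_self isVertex_cutoffSum.differentiable, euler_cutoffSum, hW₂f,
          lowerTerms_shift_two (b := b') hR hsh (fun _ _ => rfl) hV1]
        push_cast
        ring

theorem isShift_one (h : IsTruncSolution lam 1 b V) (h' : IsTruncSolution lam 1 b' V') :
    ∃ ζ, IsShift 1 ζ V V' := by
  obtain ⟨μ, ζ, hμ⟩ := h.order_one_two
  obtain ⟨μ', ζ', hμ'⟩ := h'.order_one_two
  have e : μ = μ' := by
    have h1 := h.two_one_zero le_rfl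
    have h2 := h'.two_one_zero le_rfl
    rw [hμ] at h1
    rw [hμ'] at h2
    simp only [Pi.zero_apply, norm_zero] at h1 h2
    linarith
  refine ⟨ζ' - ζ, fun n s hs p => ?_⟩
  obtain rfl | rfl : s = 0 ∨ s = 1 := by omega
  · rw [h.no_order_zero, h'.no_order_zero]; simp
  · match n with
    | 0 => rw [h.no_constant, h'.no_constant]; simp [quadSlice]
    | 1 => rw [hμ, hμ', quadSlice_one, e]; simp; ring
    | 2 => rw [h.order_one_four, h'.order_one_four]; simp [quadSlice]
    | (n + 3) =>
      rw [h.connected _ _ (by omega), h'.connected _ _ (by omega)]; simp [quadSlice]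

/-- Two solutions which agree to order `R` up to a term `ζ p²` agree to order `R + 1` up to such a
term. -/
theorem isShift_succ (hR : 1 ≤ R) (h : IsTruncSolution lam (R + 1) b V)
    (h' : IsTruncSolution lam (R + 1) b' V') {ζ : ℝ} (hsh : IsShift R ζ V V')
    (hb : ∀ s ≤ R, b' s = b s) :
    (∃ ζ', IsShift (R + 1) ζ' V V') ∧ ∀ s ≤ R + 1, b' s = b s := by
  have hV1 := h.isFirstOrder
  -- Downward induction on the legs: above R + 2 both vertices vanish, and for n ≥ 3 the difference
  -- solves a homogeneous equation with trivial kernel.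
  have high : ∀ k n, 3 ≤ n → R + 3 ≤ n + k → V' n (R + 1) = V n (R + 1) := by
    intro k
    induction k with
    | zero =>
      intro n _ hk
      funext p
      rw [h.connected _ _ (by omega), h'.connected _ _ (by omega)]
    | succ k ih =>
      intro n hn hk
      have e := ih (n + 1) (by omega) (by omega)
      have d := (h.vertex n (R + 1)).differentiable
      have d' := (h'.vertex n (R + 1)).differentiable
      funext p
      refine sub_eq_zero.1 (euler_unique_pos (2 * n - 5)
        (W := fun x => V' n (R + 1) x - V n (R + 1) x) (d'.sub d) (fun x => ?_) p)
      have f := h.flow n (R + 1) (by omega) (by omega) le_rfl x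
      have f' := h'.flow n (R + 1) (by omega) (by omega) le_rfl x
      rw [e, lowerTerms_shift_high hR hsh hb hV1 hn] at f'
      have hcast : ((2 * n - 5 : ℕ) : ℝ) = 2 * n - 5 := by
        rw [Nat.cast_sub (by omega)]; push_cast; ring
      rw [fderiv_sub_self d' d, hcast]
      linear_combination f' - f
  have h3 : V' 3 (R + 1) = V 3 (R + 1) := high R 3 le_rfl (by omega)
  have f2 := h.flow 2 (R + 1) (by omega) (by omega) le_rfl
  have f2' := h'.flow 2 (R + 1) (by omega) (by omega) le_rfl
  have hl2 := lowerTerms_shift_two hR hsh hb hV1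
  have hβ : b' (R + 1) = b (R + 1) := by
    have e1 := f2 0
    have e2 := f2' 0
    have e3 := euler_cutoffSum 0
    rw [map_zero] at e1 e2 e3
    rw [hl2, show V' (2 + 1) (R + 1) = V (2 + 1) (R + 1) from h3] at e2
    push_cast at e1 e2
    have e4 : cutoffQuadSum 0 = 0 := by linarith
    rw [e4] at e2
    linarith
  have hb1 : ∀ s ≤ R + 1, b' s = b s := fun s hs => by
    by_cases hs' : s = R + 1
    · rw [hs', hβ]
    · exact hb s (by omega)
  have d2 := (h.vertex 2 (R + 1)).differentiable
  have d2' := (h'.vertex 2 (R + 1)).differentiable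
  have dc := isVertex_cutoffSum.differentiable
  have hV2 : V' 2 (R + 1) = fun p => V 2 (R + 1) p + -((R + 1 : ℝ) * ζ) * cutoffSum p := by
    funext p
    have hd : Differentiable ℝ fun x => V 2 (R + 1) x + -((R + 1 : ℝ) * ζ) * cutoffSum x :=
      d2.add (dc.const_mul _)
    have := euler_unique_zero (W := fun x => V' 2 (R + 1) x -
      (V 2 (R + 1) x + -((R + 1 : ℝ) * ζ) * cutoffSum x)) (d2'.sub hd) (fun x => ?_) p
    · rw [cutoffSum_zero, h.coupling _ (by omega) le_rfl, h'.coupling _ (by omega) le_rfl] at this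
      linarith
    · have e1 := f2 x
      have e2 := f2' x
      rw [hl2, show V' (2 + 1) (R + 1) = V (2 + 1) (R + 1) from h3, hβ] at e2
      rw [fderiv_sub_self d2' hd, fderiv_add_self d2 (dc.const_mul _), fderiv_const_mul_self dc,
        euler_cutoffSum]
      push_cast at e1 e2
      linear_combination e2 - e1
  have d1 := (h.vertex 1 (R + 1)).differentiable
  have d1' := (h'.vertex 1 (R + 1)).differentiable
  have hdiff : ∀ p, fderiv ℝ (fun x => V' 1 (R + 1) x - V 1 (R + 1) x) p p -
      2 * (V' 1 (R + 1) p - V 1 (R + 1) p) =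
      -(((R + 1).choose 2 : ℝ) * b' 2 * ζ * ‖p 0‖ ^ 2 +
        (4 * (R + 1) * ζ * (cutoff (p 0) * ‖p 0‖ ^ 2 * V 1 1 p) +
          (if R = 1 then 4 * ζ ^ 2 else 0) * (cutoff (p 0) * ‖p 0‖ ^ 2 * ‖p 0‖ ^ 2))) +
      -((R + 1) * ζ) * loopTerm (n := 1) cutoffSum p := fun p => by
    have e1 := h.flow 1 (R + 1) le_rfl (by omega) le_rfl p
    have e2 := h'.flow 1 (R + 1) le_rfl (by omega) le_rfl p
    rw [lowerTerms_shift_one hR hsh hb1 (h.vertex 1 1),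
      show V' (1 + 1) (R + 1) = _ from hV2,
      loopTerm_add (n := 1) ((h.vertex 2 (R + 1)).tame 0)
        ((isVertex_cutoffSum.const_mul _).tame 0), loopTerm_const_mul (n := 1)] at e2
    rw [fderiv_sub_self d1' d1]
    push_cast at e1 e2
    linear_combination e2 - e1
  have hW := (h'.vertex 1 (R + 1)).sub (h.vertex 1 (R + 1))
  -- The left side of `hdiff` has no p² coefficient, the right side has −binom(R + 1, 2) β⁽²⁾ ζ. So
  -- the ambiguity at order R disappears and only the kernel ζ'p² at order R + 1 remains.
  have hζ : ζ = 0 := by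
    have q1 := hW.hasQuadCoeff_euler
    rw [funext hdiff] at q1
    have q2 := q1.unique (hasQuadCoeff_shift (R + 1) _ ζ _
      (h.vertex 1 1).differentiable.continuous (h.two_one_zero (by omega)))
    have hch : (((R + 1).choose 2 : ℕ) : ℝ) ≠ 0 := by
      exact_mod_cast (Nat.choose_pos (by omega)).ne'
    have hb2 : b' 2 ≠ 0 := by rw [h'.beta_two (by omega)]; exact beta_two_ne_zero
    have q3 : ((R + 1).choose 2 : ℝ) * b' 2 * ζ = 0 := by linarith
    exact (mul_eq_zero.1 q3).resolve_left (mul_ne_zero hch hb2)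
  subst hζ
  obtain ⟨ζ', hζ'⟩ := hW.eq_norm_sq_of_euler fun p => by
    rw [hdiff]
    simp
  refine ⟨⟨ζ', fun n s hs p => ?_⟩, hb1⟩
  by_cases hs' : s = R + 1
  · subst hs'
    match n with
    | 0 => rw [h.no_constant, h'.no_constant]; simp [quadSlice]
    | 1 =>
      rw [quadSlice_one, if_pos rfl, ← hζ']
      ring
    | 2 => rw [hV2]; simp [quadSlice]
    | (n + 3) => rw [high R (n + 3) (by omega) (by omega)]; simp [quadSlice]
  · rw [hsh n s (by omega), if_neg hs']
    simp

theorem exists_isShift (hR : 1 ≤ R) (h : IsTruncSolution lam R b V)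
    (h' : IsTruncSolution lam R b' V') :
    (∃ ζ, IsShift R ζ V V') ∧ ∀ s ≤ R, b' s = b s := by
  induction R, hR using Nat.le_induction with
  | base =>
    refine ⟨isShift_one h h', fun s hs => ?_⟩
    obtain rfl | rfl : s = 0 ∨ s = 1 := by omega
    · rw [h.beta_zero, h'.beta_zero]
    · rw [h.beta_one, h'.beta_one]
  | succ R hR ih =>
    obtain ⟨⟨ζ, hζ⟩, hb⟩ := ih (h.mono (by omega)) (h'.mono (by omega))
    exact isShift_succ hR h h' hζ hb

/-- Comparing the solutions truncated at s + 1 confines the ambiguity to order s + 1, so order s is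
already final. -/
theorem eq_of_lt {S : ℕ} (h : IsTruncSolution lam R b V) (h' : IsTruncSolution lam S b' V')
    {s : ℕ} (hR : s < R) (hS : s < S) : (∀ n, V' n s = V n s) ∧ b' s = b s := by
  obtain ⟨⟨ζ, hζ⟩, hb⟩ := exists_isShift (R := s + 1) (by omega) (h.mono (by omega))
    (h'.mono (by omega))
  refine ⟨fun n => funext fun p => ?_, hb s (by omega)⟩
  rw [hζ n s (by omega)]
  simp

/-- The solution of first order without wave function term. -/
def firstOrder : VertexFamily := fun n r _ =>
  if r = 1 then if n = 1 then -(1 / 2) / (4 * Real.pi) ^ 2 else if n = 2 then 1 else 0 else 0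

theorem isTruncSolution_firstOrder (lam : ℕ → ℝ) :
    IsTruncSolution lam 1 (fun _ => 0) firstOrder where
  no_constant r p := by simp [firstOrder]
  no_order_zero n p := by simp [firstOrder]
  vertex n r := .const _
  connected n r h p := by
    simp only [firstOrder]
    split_ifs <;> first | rfl | omega
  coupling r h1 h2 := by omega
  order_one_two := ⟨-(1 / 2) / (4 * Real.pi) ^ 2, 0, fun p => by simp [firstOrder]⟩
  order_one_four p := by simp [firstOrder]
  beta_zero := rfl
  beta_one := rfl
  flow n r hn h1 h2 p := by
    obtain rfl : r = 1 := by omega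
    have hl : lowerTerms (fun _ => 0) firstOrder n 1 p = 0 := by
      simp [lowerTerms, betaSum, treeSum]
    rw [hl]
    have hd : fderiv ℝ (firstOrder n 1) p p = 0 := by
      have : firstOrder n 1 = fun _ => firstOrder n 1 0 := rfl
      rw [this]; simp
    rw [hd]
    have hlp : loopTerm (firstOrder (n + 1) 1) p = firstOrder (n + 1) 1 0 / (4 * Real.pi) ^ 2 :=
      loopTerm_const _ p
    rw [hlp]
    by_cases h1 : n = 1
    · subst h1
      simp [firstOrder]
      ring
    · by_cases h2 : n = 2
      · subst h2
        norm_num [firstOrder]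
      · have h0 : ¬n = 0 := by omega
        simp [firstOrder, h1, h2, h0]

theorem exists_solution (lam : ℕ → ℝ) (R : ℕ) (hR : 1 ≤ R) :
    ∃ b V, IsTruncSolution lam R b V := by
  induction R, hR using Nat.le_induction with
  | base => exact ⟨_, _, isTruncSolution_firstOrder lam⟩
  | succ R hR ih =>
    obtain ⟨b, V, h⟩ := ih
    exact h.exists_extension hR

end IsTruncSolution

/-! ### Infrared asymptotic freedom of the flow -/

section RunningCoupling

/-- The solution of `L dg/dL = -κ g²` with `g(1) = 1 / y`. -/
def logCoupling (κ y L : ℝ) : ℝ := (y + κ * Real.log L)⁻¹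

variable {κ y L : ℝ}

theorem logCoupling_denom_pos (hκ : 0 < κ) (hy : 0 < y) (hL : 1 ≤ L) : 0 < y + κ * Real.log L := by
  have := Real.log_nonneg hL
  positivity

theorem logCoupling_pos (hκ : 0 < κ) (hy : 0 < y) (hL : 1 ≤ L) : 0 < logCoupling κ y L :=
  inv_pos.2 (logCoupling_denom_pos hκ hy hL)

theorem logCoupling_le (hκ : 0 < κ) (hy : 0 < y) (hL : 1 ≤ L) : logCoupling κ y L ≤ y⁻¹ := by
  refine inv_anti₀ hy ?_
  have := mul_nonneg hκ.le (Real.log_nonneg hL)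
  linarith

theorem logCoupling_one (κ y : ℝ) : logCoupling κ y 1 = y⁻¹ := by simp [logCoupling]

theorem hasDerivAt_logCoupling (hκ : 0 < κ) (hy : 0 < y) (hL : 1 ≤ L) :
    HasDerivAt (logCoupling κ y) (-κ * logCoupling κ y L ^ 2 / L) L := by
  have hd := (logCoupling_denom_pos hκ hy hL).ne'
  have hL0 : L ≠ 0 := by positivity
  have h := (((Real.hasDerivAt_log hL0).const_mul κ).const_add y).fun_inv hd
  refine h.congr_deriv ?_
  rw [logCoupling]
  field_simp

theorem tendsto_logCoupling (hκ : 0 < κ) (y : ℝ) :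
    Tendsto (logCoupling κ y) atTop (𝓝 0) :=
  (tendsto_atTop_add_const_left _ _ (Real.tendsto_log_atTop.const_mul_atTop hκ)).inv_tendsto_atTop

variable {b : ℝ → ℝ} {a δ : ℝ}

/-- A fencing argument: wherever g touches a barrier, the strict bounds on b order the two
derivatives and prevent crossing. It applies to every solution and needs no Lipschitz condition on
b. -/
theorem IsRunningCoupling.between {g : ℝ → ℝ} (hg : IsRunningCoupling b g) (ha : 0 < a)
    (hb : ∀ x, 0 < x → x < δ → -(2 * a) * x ^ 2 < b x ∧ b x < -(a / 4) * x ^ 2)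
    (h0 : 0 < g 1) (h1 : g 1 < δ) (hL : 1 ≤ L) :
    logCoupling (2 * a) (g 1)⁻¹ L ≤ g L ∧ g L ≤ logCoupling (a / 4) (g 1)⁻¹ L := by
  have hy : 0 < (g 1)⁻¹ := inv_pos.2 h0
  have hgc : ContinuousOn g (Set.Icc 1 L) := fun x hx =>
    (hg x hx.1).continuousWithinAt.mono Set.Icc_subset_Ici_self
  have hgd : ∀ x ∈ Set.Ico 1 L, HasDerivWithinAt g (b (g x) / x) (Set.Ici x) x := fun x hx =>
    (hg x hx.1).mono (Set.Ici_subset_Ici.2 hx.1)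
  have hc : ∀ κ : ℝ, 0 < κ → ContinuousOn (logCoupling κ (g 1)⁻¹) (Set.Icc 1 L) := fun κ hκ x hx =>
    (hasDerivAt_logCoupling hκ hy hx.1).continuousAt.continuousWithinAt
  have hd : ∀ κ : ℝ, 0 < κ → ∀ x ∈ Set.Ico 1 L, HasDerivWithinAt (logCoupling κ (g 1)⁻¹)
      (-κ * logCoupling κ (g 1)⁻¹ x ^ 2 / x) (Set.Ici x) x := fun κ hκ x hx =>
    (hasDerivAt_logCoupling hκ hy hx.1).hasDerivWithinAt
  have hr : ∀ κ : ℝ, 0 < κ → ∀ x ∈ Set.Ico 1 L, 0 < logCoupling κ (g 1)⁻¹ x ∧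
      logCoupling κ (g 1)⁻¹ x < δ := fun κ hκ x hx =>
    ⟨logCoupling_pos hκ hy hx.1, (logCoupling_le hκ hy hx.1).trans_lt (by rwa [inv_inv])⟩
  constructor
  · refine image_le_of_deriv_right_lt_deriv_boundary' (hc (2 * a) (by positivity))
      (hd (2 * a) (by positivity)) (by rw [logCoupling_one, inv_inv]) hgc hgd (fun x hx he => ?_)
      (Set.right_mem_Icc.2 hL)
    have hx0 : 0 < x := by linarith [hx.1]
    obtain ⟨p1, p2⟩ := hr (2 * a) (by positivity) x hx
    rw [he] at p1 p2 ⊢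
    exact div_lt_div_of_pos_right (hb _ p1 p2).1 hx0
  · refine image_le_of_deriv_right_lt_deriv_boundary' hgc hgd
      (by rw [logCoupling_one, inv_inv]) (hc (a / 4) (by positivity)) (hd (a / 4) (by positivity))
      (fun x hx he => ?_) (Set.right_mem_Icc.2 hL)
    have hx0 : 0 < x := by linarith [hx.1]
    obtain ⟨p1, p2⟩ := hr (a / 4) (by positivity) x hx
    rw [← he] at p1 p2 ⊢
    exact div_lt_div_of_pos_right (hb _ p1 p2).2 hx0

/-- A scalar autonomous equation whose right hand side lies between two positive constants has a
global solution. -/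
theorem exists_autonomous_solution {c : ℝ → ℝ} (hc : Continuous c) {m M : ℝ} (hm : 0 < m)
    (hcm : ∀ y, m ≤ c y) (hcM : ∀ y, c y ≤ M) (y₀ : ℝ) :
    ∃ Y : ℝ → ℝ, Y 0 = y₀ ∧ Monotone Y ∧ ∀ t, HasDerivAt Y (c (Y t)) t := by
  have hpos : ∀ y, 0 < c y := fun y => hm.trans_le (hcm y)
  have hM : 0 < M := (hpos 0).trans_le (hcM 0)
  have hci : Continuous fun y => (c y)⁻¹ := hc.inv₀ fun y => (hpos y).ne'
  -- Separation of variables: F is the time needed to reach y. Its slope is at least 1/M, so F is a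
  -- bijection of the line and the solution is its inverse.
  set F : ℝ → ℝ := fun y => ∫ x in y₀..y, (c x)⁻¹ with hF
  have hFd : ∀ y, HasDerivAt F (c y)⁻¹ y := fun y =>
    intervalIntegral.integral_hasDerivAt_right (hci.intervalIntegrable _ _)
      (hci.stronglyMeasurableAtFilter _ _) hci.continuousAt
  have hFdiff : Differentiable ℝ F := fun y => (hFd y).differentiableAt
  have hmono : StrictMono F := strictMono_of_hasDerivAt_pos hFd fun y => inv_pos.2 (hpos y)
  have hslope := mul_sub_le_image_sub_of_le_deriv hFdiff (C := M⁻¹) fun y => by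
    rw [(hFd y).deriv]; exact inv_anti₀ (hpos y) (hcM y)
  have hM' : 0 < M⁻¹ := inv_pos.2 hM
  have hF0 : F y₀ = 0 := intervalIntegral.integral_same
  have htop : Tendsto F atTop atTop := by
    refine tendsto_atTop_mono' _ ?_
      ((tendsto_atTop_add_const_right _ (-y₀) tendsto_id).const_mul_atTop hM')
    filter_upwards [eventually_ge_atTop y₀] with y hy
    have := hslope hy
    simp only [id]
    linarith
  have hbot : Tendsto F atBot atBot := by
    refine tendsto_atBot_mono' _ ?_
      ((tendsto_atBot_add_const_right _ (-y₀) tendsto_id).const_mul_atBot hM')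
    filter_upwards [eventually_le_atBot y₀] with y hy
    have := hslope hy
    simp only [id]
    linarith
  set e := hmono.orderIsoOfSurjective F (hFdiff.continuous.surjective htop hbot) with he
  have hFe : ∀ t, F (e.symm t) = t := fun t => e.apply_symm_apply t
  refine ⟨e.symm, hmono.injective (by rw [hFe, hF0]), e.symm.monotone, fun t => ?_⟩
  have := HasDerivAt.of_local_left_inverse e.symm.continuous.continuousAt (hFd (e.symm t))
    (inv_pos.2 (hpos _)).ne' (.of_forall hFe)
  rwa [inv_inv] at this

theorem exists_runningCoupling (hb : Continuous b) (ha : 0 < a)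
    (hbd : ∀ x, 0 < x → x ≤ δ → -(2 * a) * x ^ 2 ≤ b x ∧ b x ≤ -(a / 4) * x ^ 2)
    {g₁ : ℝ} (h0 : 0 < g₁) (h1 : g₁ ≤ δ) : ∃ g : ℝ → ℝ, IsRunningCoupling b g ∧ g 1 = g₁ := by
  have hδ : 0 < δ := h0.trans_le h1
  -- In the variables y = 1/g and t = log L the flow becomes y' = −b(1/y) y², with right side
  -- between a/4 and 2a. The clamp makes these bounds global and stays inactive because y increases
  -- from 1/g₁ ≥ 1/δ.
  set u : ℝ → ℝ := fun y => max y δ⁻¹ with hu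
  have hupos : ∀ y, 0 < u y := fun y => (inv_pos.2 hδ).trans_le (le_max_right _ _)
  have huc : Continuous u := continuous_id.max continuous_const
  have hui : Continuous fun y => (u y)⁻¹ := huc.inv₀ fun y => (hupos y).ne'
  have hbound : ∀ y, -(2 * a) * ((u y)⁻¹) ^ 2 ≤ b (u y)⁻¹ ∧
      b (u y)⁻¹ ≤ -(a / 4) * ((u y)⁻¹) ^ 2 := fun y =>
    hbd _ (inv_pos.2 (hupos y)) (inv_le_of_inv_le₀ hδ (le_max_right _ _))
  have hmul : ∀ y, ((u y)⁻¹) ^ 2 * u y ^ 2 = 1 := fun y => by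
    rw [← mul_pow, inv_mul_cancel₀ (hupos y).ne', one_pow]
  obtain ⟨Y, hY0, hYm, hYd⟩ := exists_autonomous_solution
    (c := fun y => -b (u y)⁻¹ * u y ^ 2) (((hb.comp hui).neg).mul (huc.pow 2))
    (m := a / 4) (M := 2 * a) (by positivity)
    (fun y => by nlinarith [(hbound y).2, hmul y, pow_pos (hupos y) 2])
    (fun y => by nlinarith [(hbound y).1, hmul y, pow_pos (hupos y) 2]) g₁⁻¹
  refine ⟨fun L => (Y (Real.log L))⁻¹, fun L hL => ?_, by simp [hY0]⟩
  have hY : δ⁻¹ ≤ Y (Real.log L) := (inv_anti₀ h0 h1).trans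
    (hY0 ▸ hYm (Real.log_nonneg hL))
  have hYpos : 0 < Y (Real.log L) := (inv_pos.2 hδ).trans_le hY
  have huY : u (Y (Real.log L)) = Y (Real.log L) := max_eq_left hY
  have hL0 : L ≠ 0 := by positivity
  have h2 := ((hYd (Real.log L)).comp L (Real.hasDerivAt_log hL0)).fun_inv hYpos.ne'
  refine (h2.congr_deriv ?_).hasDerivWithinAt
  simp only [huY, Function.comp_apply]
  field_simp

theorem exists_bounds_of_isBigO (ha : 0 < a)
    (h : (fun x => b x - -a * x ^ 2) =O[𝓝[>] 0] (fun x => x ^ 3)) :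
    ∃ δ : ℝ, 0 < δ ∧ ∀ x, 0 < x → x < δ → -(2 * a) * x ^ 2 < b x ∧ b x < -(a / 4) * x ^ 2 := by
  obtain ⟨C, hC, hb⟩ := h.exists_pos
  obtain ⟨δ, hδ, hs⟩ := mem_nhdsGT_iff_exists_Ioo_subset.1 hb.bound
  have hδ0 : 0 < δ := hδ
  -- Below a/(2C) the cubic error is at most (a/2)x², so b lies between −(3a/2)x² and −(a/2)x²,
  -- strictly inside the claimed bounds.
  refine ⟨min δ (a / (2 * C)), lt_min hδ0 (by positivity), fun x hx hxδ => ?_⟩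
  have h1 := hs ⟨hx, hxδ.trans_le (min_le_left _ _)⟩
  simp only [Set.mem_ofPred_eq, Real.norm_eq_abs, abs_of_pos (pow_pos hx 3)] at h1
  have h2 : x * (2 * C) < a := (lt_div_iff₀ (by positivity)).1 (hxδ.trans_le (min_le_right _ _))
  have h3 : C * x ^ 3 ≤ a / 2 * x ^ 2 := by nlinarith [pow_pos hx 2]
  have h4 := abs_le.1 (h1.trans h3)
  have h5 := mul_pos ha (pow_pos hx 2)
  constructor <;> nlinarith [h4.1, h4.2]

theorem isInfraredFree_of_trunc {β : PowerSeries ℝ} (ha : 0 < a)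
    (h : ∀ x, (PowerSeries.trunc 3 β).eval x = -a * x ^ 2) : IsInfraredFree β := by
  intro b hb hO
  simp only [h] at hO
  obtain ⟨δ, hδ, hbd⟩ := exists_bounds_of_isBigO ha hO
  refine ⟨δ, hδ, fun g₁ h0 h1 => ⟨?_, fun g hg hg1 => ?_⟩⟩
  · refine exists_runningCoupling (δ := g₁) hb ha (fun x hx hx' => ?_) h0 le_rfl
    have := hbd x hx (hx'.trans_lt h1)
    exact ⟨this.1.le, this.2.le⟩
  · subst hg1
    have hy : 0 < (g 1)⁻¹ := inv_pos.2 h0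
    have hbt := fun L (hL : 1 ≤ L) => hg.between ha hbd h0 h1 hL
    refine tendsto_nhdsWithin_iff.2 ⟨?_, ?_⟩
    · refine tendsto_of_tendsto_of_tendsto_of_le_of_le'
        (tendsto_logCoupling (by positivity : 0 < 2 * a) (g 1)⁻¹)
        (tendsto_logCoupling (by positivity : 0 < a / 4) (g 1)⁻¹) ?_ ?_
      · filter_upwards [eventually_ge_atTop 1] with L hL using (hbt L hL).1
      · filter_upwards [eventually_ge_atTop 1] with L hL using (hbt L hL).2
    · filter_upwards [eventually_ge_atTop 1] with L hL
      exact (logCoupling_pos (by positivity) hy hL).trans_le (hbt L hL).1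

end RunningCoupling

/-! ### Equivalence of the two growth conditions -/

section Conversion

variable {n : ℕ} {f : Conf n → ℝ}

theorem sum_norm_sq_le (p : Conf n) : ∑ i, ‖p i‖ ^ 2 ≤ ((2 * n - 1 : ℕ) : ℝ) * ‖p‖ ^ 2 := by
  have h : ∀ i ∈ Finset.univ, ‖p i‖ ^ 2 ≤ ‖p‖ ^ 2 := fun i _ => by
    gcongr; exact norm_le_pi_norm p i
  simpa using Finset.sum_le_card_nsmul Finset.univ (fun i => ‖p i‖ ^ 2) _ h

theorem norm_sq_le_sum (p : Conf n) : ‖p‖ ^ 2 ≤ ∑ i, ‖p i‖ ^ 2 := by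
  have h0 : 0 ≤ ∑ i, ‖p i‖ ^ 2 := Finset.sum_nonneg fun i _ => by positivity
  have h : ‖p‖ ≤ Real.sqrt (∑ i, ‖p i‖ ^ 2) :=
    (pi_norm_le_iff_of_nonneg (Real.sqrt_nonneg _)).2 fun i => Real.le_sqrt_of_sq_le
      (Finset.single_le_sum (f := fun i => ‖p i‖ ^ 2) (fun i _ => by positivity)
        (Finset.mem_univ i))
  calc ‖p‖ ^ 2 ≤ Real.sqrt (∑ i, ‖p i‖ ^ 2) ^ 2 := by gcongr
    _ = _ := Real.sq_sqrt h0

/-- Bounds for small ε imply those for large ε, so the restriction ε < 1/2 loses nothing; dividing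
by N + 1 pays for passing from the sum of squares to the sup norm. -/
theorem tame_of_bddAbove (hs : ContDiff ℝ ∞ f)
    (hb : ∀ (k : ℕ) (ε : ℝ), 0 < ε → ε < 1 / 2 → BddAbove (Set.range fun p : Conf n =>
      ‖iteratedFDeriv ℝ k f p‖ * Real.exp (-ε * ∑ i, ‖p i‖ ^ 2))) (m : ℕ) : Tame m f := by
  refine ⟨hs.of_le (by exact_mod_cast le_top), fun k _ ε hε => ?_⟩
  set N : ℝ := ((2 * n - 1 : ℕ) : ℝ) with hN
  have hN0 : 0 ≤ N := Nat.cast_nonneg _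
  set δ : ℝ := min (ε / (N + 1)) (1 / 4) with hδ
  have hδ0 : 0 < δ := lt_min (by positivity) (by norm_num)
  obtain ⟨C, hC⟩ := hb k δ hδ0 ((min_le_right _ _).trans_lt (by norm_num))
  have hC' : ∀ p, ‖iteratedFDeriv ℝ k f p‖ * Real.exp (-δ * ∑ i, ‖p i‖ ^ 2) ≤ C := fun p =>
    hC ⟨p, rfl⟩
  have hC0 : 0 ≤ C := (by positivity : (0 : ℝ) ≤ _).trans (hC' 0)
  refine ⟨C, hC0, fun p => ?_⟩
  have h1 : ‖iteratedFDeriv ℝ k f p‖ ≤ C * Real.exp (δ * ∑ i, ‖p i‖ ^ 2) := by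
    have := mul_le_mul_of_nonneg_right (hC' p) (Real.exp_pos (δ * ∑ i, ‖p i‖ ^ 2)).le
    rwa [mul_assoc, ← Real.exp_add, neg_mul, neg_add_cancel, Real.exp_zero, mul_one] at this
  refine h1.trans (mul_le_mul_of_nonneg_left (Real.exp_le_exp.2 ?_) hC0)
  have h2 : δ * (N + 1) ≤ ε := (le_div_iff₀ (by positivity)).1 (min_le_left _ _)
  calc δ * ∑ i, ‖p i‖ ^ 2 ≤ δ * (N * ‖p‖ ^ 2) := by gcongr; exact sum_norm_sq_le p
    _ ≤ (δ * (N + 1)) * ‖p‖ ^ 2 := by nlinarith [mul_nonneg hδ0.le (sq_nonneg ‖p‖)]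
    _ ≤ ε * ‖p‖ ^ 2 := by gcongr

theorem bddAbove_of_tame (hf : ∀ m, Tame m f) (k : ℕ) {ε : ℝ} (hε : 0 < ε) :
    BddAbove (Set.range fun p : Conf n =>
      ‖iteratedFDeriv ℝ k f p‖ * Real.exp (-ε * ∑ i, ‖p i‖ ^ 2)) := by
  obtain ⟨C, hC0, hC⟩ := (hf k).growth k le_rfl ε hε
  refine ⟨C, ?_⟩
  rintro _ ⟨p, rfl⟩
  calc ‖iteratedFDeriv ℝ k f p‖ * Real.exp (-ε * ∑ i, ‖p i‖ ^ 2)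
      ≤ (C * Real.exp (ε * ‖p‖ ^ 2)) * Real.exp (-ε * ‖p‖ ^ 2) := by
        refine mul_le_mul (hC p) (Real.exp_le_exp.2 ?_) (Real.exp_pos _).le (by positivity)
        have := mul_le_mul_of_nonneg_left (norm_sq_le_sum p) hε.le
        linarith
    _ = C := by rw [mul_assoc, ← Real.exp_add]; simp

end Conversion

/-! ### From truncated solutions to scaling pairs -/

section Pairs

variable {lam β : PowerSeries ℝ} {V : VertexFamily}

theorem IsPhi4Vertices.isVertex (h : IsPhi4Vertices lam V) (n r : ℕ) : IsVertex n (V n r) :=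
  ⟨tame_of_bddAbove (h.smooth n r) (h.large_momentum n r), h.bose n r, h.orthogonal n r⟩

/-- For four legs at first order the vertex is 1 and the six point vertex vanishes; at zero momentum
the equation reduces to β⁽¹⁾ = 0. -/
theorem IsScalingPair.beta_one (h : IsPhi4Vertices lam V) (hβ : IsScalingPair β V) :
    ordCoeff β 1 = 0 := by
  have h1 := hβ.equation 2 1 (by norm_num) le_rfl 0
  rw [map_zero, h.order_one_quartic, show V (2 + 1) 1 = fun _ => 0 from
    funext (h.order_one_higher 3 (by norm_num)), loopTerm_zero] at h1
  norm_num at h1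
  exact h1

theorem flowEq_iff (b : ℕ → ℝ) (V : VertexFamily) (n r : ℕ) :
    FlowEq b V n r ↔ ∀ p, fderiv ℝ (V n r) p p + (-4 + 2 * (n : ℝ)) * V n r p =
      -(∑ s ∈ Finset.Icc 2 r, (r.choose s : ℝ) * b s * V n (r - s + 1) p)
      + loopTerm (V (n + 1) r) p
      - ∑ s ∈ Finset.Icc 1 (r - 1), (r.choose s : ℝ) *
          ∑ m ∈ Finset.Icc 1 n, ((2 * n).choose (2 * m - 1) : ℝ) *
            boseSymm (treeProduct n m (V m s) (V (n - m + 1) (r - s))) p := by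
  refine forall_congr' fun p => ?_
  have : loopTerm (V (n + 1) r) p + lowerTerms b V n r p =
      -betaSum b V n r p + loopTerm (V (n + 1) r) p - treeSum V n r p := by
    rw [lowerTerms]; ring
  rw [this]
  rfl

theorem isTruncSolution_of_pair (h : IsPhi4Vertices lam V) (hβ : IsScalingPair β V) (R : ℕ) :
    IsTruncSolution (ordCoeff lam) R (ordCoeff β) V where
  no_constant := h.no_constant
  no_order_zero := h.no_order_zero
  vertex := h.isVertex
  connected n r hn p := by
    rcases r with _ | r
    · exact h.no_order_zero n p
    · exact h.connected n (r + 1) (by omega) hn p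
  coupling r hr _ := h.coupling r hr
  order_one_two := h.order_one_quadratic
  order_one_four := h.order_one_quartic
  beta_zero := by
    have := hβ.beta_zero
    rw [← PowerSeries.coeff_zero_eq_constantCoeff_apply] at this
    simp [ordCoeff, this]
  beta_one := IsScalingPair.beta_one h hβ
  flow n r hn hr _ := by
    rw [flowEq_iff]
    intro p
    have := hβ.equation n r hn hr p
    rwa [IsScalingPair.beta_one h hβ, mul_zero, add_zero] at this

theorem ordCoeff_injective {β β' : PowerSeries ℝ} (h : ∀ r, ordCoeff β r = ordCoeff β' r) :
    β = β' := by
  ext r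
  have hr : (r ! : ℝ) ≠ 0 := by exact_mod_cast Nat.factorial_ne_zero r
  exact mul_left_cancel₀ hr (h r)

theorem ordCoeff_mk (b : ℕ → ℝ) (r : ℕ) :
    ordCoeff (PowerSeries.mk fun r => b r / (r ! : ℝ)) r = b r := by
  have hr : (r ! : ℝ) ≠ 0 := by exact_mod_cast Nat.factorial_ne_zero r
  rw [ordCoeff, PowerSeries.coeff_mk]
  field_simp

/-- The truncated solutions fit together. -/
theorem exists_isTruncSolution_all (lam : ℕ → ℝ) :
    ∃ b V, ∀ R, IsTruncSolution lam R b V := by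
  -- Order r is taken from a solution up to order r + 1, where it is no longer subject to a wave
  -- function shift.
  have hex := fun r : ℕ => IsTruncSolution.exists_solution lam (r + 1) (by omega)
  choose B U hU using hex
  have agree : ∀ r s, s ≤ r → (∀ n, U s n s = U r n s) ∧ B s s = B r s := fun r s hs =>
    (hU r).eq_of_lt (hU s) (by omega) (by omega)
  refine ⟨fun r => B r r, fun n r => U r n r, fun R => ?_⟩
  exact
    { no_constant := fun r => (hU r).no_constant r
      no_order_zero := fun n => (hU 0).no_order_zero n
      vertex := fun n r => (hU r).vertex n r
      connected := fun n r => (hU r).connected n r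
      coupling := fun r hr _ => (hU r).coupling r hr (by omega)
      order_one_two := (hU 1).order_one_two
      order_one_four := (hU 1).order_one_four
      beta_zero := (hU 0).beta_zero
      beta_one := (hU 1).beta_one
      flow := fun n r hn hr _ p => by
        have h := (hU r).flow n r hn hr (by omega) p
        rw [← lowerTerms_congr (V' := fun n r => U r n r) (b' := fun r => B r r)
          (fun n s hs => (agree r s hs.le).1 n) (fun s hs => (agree r s hs).2)] at h
        exact h }

theorem exists_pair (lam : PowerSeries ℝ) :
    ∃ (β : PowerSeries ℝ) (V : VertexFamily), IsPhi4Vertices lam V ∧ IsScalingPair β V := by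
  obtain ⟨b, V, h⟩ := exists_isTruncSolution_all (ordCoeff lam)
  have hv := (h 0).vertex
  refine ⟨PowerSeries.mk fun r => b r / (r ! : ℝ), V, ?_, ?_⟩
  · exact
      { no_constant := (h 0).no_constant
        no_order_zero := (h 0).no_order_zero
        bose := fun n r => (hv n r).bose
        orthogonal := fun n r => (hv n r).orthogonal
        smooth := fun n r => contDiff_infty.2 fun m => ((hv n r).tame m).smooth
        large_momentum := fun n r k ε hε _ => bddAbove_of_tame (hv n r).tame k hε
        connected := fun n r _ => (h 0).connected n r
        coupling := fun r hr => (h r).coupling r hr le_rfl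
        order_one_quadratic := (h 0).order_one_two
        order_one_quartic := (h 0).order_one_four
        order_one_higher := fun n hn => (h 0).connected n 1 (by omega) }
  · refine ⟨?_, fun n r _ _ p => integrable_loopIntegrand ((hv (n + 1) r).tame 0) p,
      fun n r hn hr p => ?_⟩
    · rw [← PowerSeries.coeff_zero_eq_constantCoeff_apply, PowerSeries.coeff_mk, (h 0).beta_zero,
        zero_div]
    · simp only [ordCoeff_mk]
      rw [(h 0).beta_one, mul_zero, add_zero]
      exact (flowEq_iff b V n r).1 ((h r).flow n r hn hr le_rfl) p

theorem pair_unique {β' : PowerSeries ℝ} {V' : VertexFamily} (h : IsPhi4Vertices lam V)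
    (hβ : IsScalingPair β V) (h' : IsPhi4Vertices lam V') (hβ' : IsScalingPair β' V') :
    β' = β ∧ V' = V := by
  have e := fun s => (isTruncSolution_of_pair h hβ (s + 1)).eq_of_lt
    (isTruncSolution_of_pair h' hβ' (s + 1)) s.lt_succ_self s.lt_succ_self
  exact ⟨ordCoeff_injective fun s => (e s).2, funext fun n => funext fun s => (e s).1 n⟩

theorem eval_trunc_three (h0 : PowerSeries.constantCoeff β = 0) (h1 : ordCoeff β 1 = 0) (x : ℝ) :
    (PowerSeries.trunc 3 β).eval x = ordCoeff β 2 / 2 * x ^ 2 := by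
  have h1' : PowerSeries.coeff 1 β = 0 := by simpa [ordCoeff] using h1
  have := PowerSeries.eval₂_trunc_eq_sum_range x (RingHom.id ℝ) 3 β
  rw [Polynomial.eval, this, Finset.sum_range_succ, Finset.sum_range_succ, Finset.sum_range_one,
    PowerSeries.coeff_zero_eq_constantCoeff_apply, h0, h1']
  simp [ordCoeff]

theorem X_cubed_dvd (h0 : PowerSeries.constantCoeff β = 0) (h1 : ordCoeff β 1 = 0) {c : ℝ}
    (h2 : ordCoeff β 2 = 2 * c) :
    (PowerSeries.X : PowerSeries ℝ) ^ 3 ∣ β - PowerSeries.C c * PowerSeries.X ^ 2 := by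
  have h1' : PowerSeries.coeff 1 β = 0 := by simpa [ordCoeff] using h1
  have h2' : PowerSeries.coeff 2 β = c := by
    have : 2 * PowerSeries.coeff 2 β = 2 * c := by simpa [ordCoeff] using h2
    linarith
  refine PowerSeries.X_pow_dvd_iff.2 fun m hm => ?_
  interval_cases m
  · simp [h0]
  · simp [h1', PowerSeries.coeff_X_pow]
  · simp [h2', PowerSeries.coeff_X_pow]

end Pairs

end

end Phi4

theorem mainTheorem1 (lam : PowerSeries ℝ)
    (hlam0 : PowerSeries.constantCoeff lam = 0) (hlam1 : PowerSeries.coeff 1 lam = 1) :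
    (∃! T : PowerSeries ℝ × Phi4.VertexFamily,
      Phi4.IsPhi4Vertices lam T.2 ∧ Phi4.IsScalingPair T.1 T.2) ∧
    (∀ (β : PowerSeries ℝ) (V : Phi4.VertexFamily),
      Phi4.IsPhi4Vertices lam V → Phi4.IsScalingPair β V →
        Phi4.ordCoeff β 1 = 0 ∧
        Phi4.ordCoeff β 2 = -6 / (4 * Real.pi) ^ 2 ∧
        (PowerSeries.X : PowerSeries ℝ) ^ 3 ∣
          β - PowerSeries.C (-3 / (4 * Real.pi) ^ 2) * PowerSeries.X ^ 2 ∧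
        Phi4.IsInfraredFree β) := by
  constructor
  · obtain ⟨β, V, hV, hβ⟩ := Phi4.exists_pair lam
    refine ⟨(β, V), ⟨hV, hβ⟩, fun T hT => ?_⟩
    have h := Phi4.pair_unique hV hβ hT.1 hT.2
    exact Prod.ext h.1 h.2
  · intro β V hV hβ
    have h1 := Phi4.IsScalingPair.beta_one hV hβ
    have h2 := (Phi4.isTruncSolution_of_pair hV hβ 2).beta_two le_rfl
    have hpi := Real.pi_pos
    refine ⟨h1, h2, Phi4.X_cubed_dvd hβ.beta_zero h1 (by rw [h2]; ring), ?_⟩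
    refine Phi4.isInfraredFree_of_trunc (a := 3 / (4 * Real.pi) ^ 2) (by positivity) fun x => ?_
    rw [Phi4.eval_trunc_three hβ.beta_zero h1, h2]
    ring
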